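/- **Setting.** For a tempered distribution $v$ on $\mathbb R^3$ let $\widehat v$ be its Fourier transform, normalised by $\widehat f(\xi)=\int_{\mathbb R^3}e^{ix\cdot\xi}f(x)\,dx$. For $v\in\mathcal S'(\mathbb R^3)$ with $\widehat v\in L^1_{loc}$ put $\|v\|_{\mathcal{PM}^2}=\operatorname{ess\,sup}_\xi|\xi|^2|\widehat v(\xi)|$; for vector fields take the maximum over the three components. $C_w([0,\infty);\mathcal{PM}^2)$ is the set of vector fields $u$ with $\sup_{t\ge0}\|u(t)\|_{\mathcal{PM}^2}<\infty$ such that $t\mapsto\langle u(t),\varphi\rangle$ is continuous on $[0,\infty)$ for every Schwartz function $\varphi$ (componentwise). With $\widehat{\mathbb P}(\xi)_{jk}=\delta_{jk}-\xi_j\xi_k/|\xi|^2$, let $B$ be given by $$\widehat{B(u,v)}(\xi,t)=\int_0^te^{-(t-\tau)|\xi|^2}\,\widehat{\mathbb P}(\xi)\,i\xi\cdot\widehat{(u\otimes v)}(\xi,\tau)\,d\tau,\qquad \widehat{u_lv_k}=(2\pi)^{-3}\,\widehat{u_l}*\widehat{v_k}.$$ For $|c|>1$ let $V^c$ be the Slezkin–Landau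 field $$V^c_1=2\,\frac{c|x|^2-2x_1|x|+cx_1^2}{|x|(c|x|-x_1)^2},\qquad V^c_k=2\,\frac{x_k(cx_1-|x|)}{|x|(c|x|-x_1)^2}\quad(k=2,3),$$ and let $$\kappa(c)=\frac{8\pi c}{3(c^2-1)}\Big(2+6c^2-3c(c^2-1)\log\frac{c+1}{c-1}\Big).$$ For $\gamma:[0,\infty)\to\mathbb R^3$ put $V^c_\gamma(x,t)=V^c(x-\gamma(t))$ and $$\widehat{y_0}(\xi,t)=|\xi|^2\int_0^te^{-(t-\tau)|\xi|^2}\big(e^{i\gamma(\tau)\cdot\xi}-e^{i\gamma(t)\cdot\xi}\big)\widehat{V^c}(\xi)\,d\tau-e^{-t|\xi|^2}e^{i\gamma(t)\cdot\xi}\widehat{V^c}(\xi).$$ Consider for $\omega,u\in C_w([0,\infty);\mathcal{PM}^2)$ the perturbation equation $$\omega=B(\omega,\omega)+B(V^c_\gamma,\omega)+B(\omega,V^c_\gamma)+y_0\tag{1}$$ and the mild form of the Navier–Stokes system with zero initial datum and force $\kappa(c)\,\delta_{\gamma(t)}\bar e_1$, $\bar e_1=(1,0,0)$, $$\widehat u(\xi,t)=\widehat{B(u,u)}(\xi,t)+\kappa(c)\int_0^te^{-(t-\tau)|\xi|^2}\,\widehat{\mathbb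 P}(\xi)\,e^{i\gamma(\tau)\cdot\xi}\,\bar e_1\,d\tau,\tag{2}$$ each understood as an equality of Fourier transforms for all $t\ge0$ and almost all $\xi$. **Theorem 5.3.** There are constants $\eta_2>0$ and $K>0$ such that $$\sup_{t>0}\|B(u,v)(t)\|_{\mathcal{PM}^2}\le\eta_2\,\sup_{t>0}\|u(t)\|_{\mathcal{PM}^2}\,\sup_{t>0}\|v(t)\|_{\mathcal{PM}^2}\quad\text{for all }u,v\in C_w([0,\infty);\mathcal{PM}^2),$$ $$\|V^c\|_{\mathcal{PM}^2}\le K/|c|\quad\text{for all }|c|>2 .$$ For any such $\eta_2$ and $K$ there exists $c_0>\max\{1,12K\eta_2\}$ such that for every $c$ with $|c|\ge c_0$ and every continuous $\gamma:[0,\infty)\to\mathbb R^3$ the following holds. (i) $2\eta_2\|V^c\|_{\mathcal{PM}^2}<1$, and equation (1) has a solution $\omega\in C_w([0,\infty);\mathcal{PM}^2)$ with $$\sup_{t>0}\|\omega(t)\|_{\mathcal{PM}^2}\le\frac{1-2\eta_2\|V^c\|_{\mathcal{PM}^2}}{2\eta_2};$$ it is the only solution in $C_w([0,\infty);\mathcal{PM}^2)$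 satisfying this bound. (ii) $|\kappa(c)|<\frac1{8\eta_2}$, equation (2) has exactly one solution $u\in C_w([0,\infty);\mathcal{PM}^2)$ with $\sup_{t>0}\|u(t)\|_{\mathcal{PM}^2}\le4|\kappa(c)|$, and $\omega(t)=u(t)-V^c_\gamma(t)$ for all $t\ge0$. -/

import Mathlib

open MeasureTheory SchwartzMap
open scoped ENNReal SchwartzMap FourierTransform

noncomputable section

namespace SingularNS

/-- Euclidean space `ℝ³`. -/
abbrev E3 : Type := EuclideanSpace ℝ (Fin 3)

/-- A vector field on `ℝ³` whose three components are tempered distributions. -/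
abbrev VecDist : Type := Fin 3 → 𝓢'(E3, ℂ)

/-! ### Tempered distributions given by functions -/

/-- The tempered distribution `T` is given by the locally integrable function `f`:
`⟨T, φ⟩ = ∫ φ f` for every Schwartz function `φ`. -/
def IsFun (T : 𝓢'(E3, ℂ)) (f : E3 → ℂ) : Prop :=
  LocallyIntegrable f volume ∧
    ∀ φ : 𝓢(E3, ℂ), Integrable (fun x => φ x * f x) volume ∧ T φ = ∫ x, φ x * f x

/-- A function representing a tempered distribution is unique almost everywhere. -/
theorem IsFun.ae_eq {T : 𝓢'(E3, ℂ)} {f g : E3 → ℂ} (hf : IsFun T f) (hg : IsFun T g) :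
    f =ᵐ[volume] g := by
  apply ae_eq_of_integral_contDiff_smul_eq hf.1 hg.1
  intro φ hφ hc
  have hg₁ : HasCompactSupport (Complex.ofRealCLM ∘ φ) := hc.comp_left rfl
  have hg₂ : ContDiff ℝ (⊤ : ℕ∞) (Complex.ofRealCLM ∘ φ) := by fun_prop
  have h1 := (hf.2 (hg₁.toSchwartzMap hg₂)).2
  have h2 := (hg.2 (hg₁.toSchwartzMap hg₂)).2
  simpa using h1.symm.trans h2

open Classical in
/-- The tempered distribution given by a function `f` (and `0` if `f` does not define one). -/
def ofFun (f : E3 → ℂ) : 𝓢'(E3, ℂ) :=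
  if h : ∃ T : 𝓢'(E3, ℂ), IsFun T f then h.choose else 0

theorem isFun_ofFun {f : E3 → ℂ} (h : ∃ T : 𝓢'(E3, ℂ), IsFun T f) : IsFun (ofFun f) f := by
  rw [ofFun, dif_pos h]
  exact h.choose_spec

/-! ### The Fourier transform, with the convention `f̂ ξ = ∫ exp (i x · ξ) f x dx` -/

/-- The dilation `x ↦ (2π)⁻¹ x` of `ℝ³`. -/
def dilation : E3 ≃L[ℝ] E3 :=
  ContinuousLinearEquiv.smulLeft (Units.mk0 ((2 * Real.pi)⁻¹ : ℝ) (by positivity))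

/-- The Fourier transform `φ̂ ξ = ∫ exp (i x · ξ) φ x dx` of Schwartz functions. -/
def hatSchwartz : 𝓢(E3, ℂ) →L[ℂ] 𝓢(E3, ℂ) :=
  (SchwartzMap.compCLMOfContinuousLinearEquiv ℂ dilation) ∘L
    (FourierTransform.fourierInvCLM ℂ 𝓢(E3, ℂ))

theorem hatSchwartz_apply (φ : 𝓢(E3, ℂ)) (ξ : E3) :
    hatSchwartz φ ξ = ∫ x, Complex.exp (Complex.I * (inner ℝ x ξ : ℝ)) * φ x := by
  have h : hatSchwartz φ ξ = 𝓕⁻ (φ : E3 → ℂ) ((2 * Real.pi)⁻¹ • ξ) := by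
    rw [← SchwartzMap.fourierInv_coe]
    rfl
  rw [h, Real.fourierInv_eq']
  congr 1
  ext x
  rw [smul_eq_mul, inner_smul_right]
  congr 2
  push_cast
  have : (Real.pi : ℂ) ≠ 0 := by exact_mod_cast Real.pi_ne_zero
  field_simp

/-- The Fourier transform of tempered distributions, `⟨v̂, φ⟩ = ⟨v, φ̂⟩`. -/
def hat (v : 𝓢'(E3, ℂ)) : 𝓢'(E3, ℂ) :=
  PointwiseConvergenceCLM.precomp ℂ hatSchwartz v

theorem hat_apply (v : 𝓢'(E3, ℂ)) (φ : 𝓢(E3, ℂ)) : hat v φ = v (hatSchwartz φ) := rfl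

open Classical in
/-- The Fourier transform of `v` as a function, when `v̂` is given by a locally integrable
function (and `0` otherwise). It is determined up to a null set. -/
def hatFun (v : 𝓢'(E3, ℂ)) : E3 → ℂ :=
  if h : ∃ f : E3 → ℂ, IsFun (hat v) f then h.choose else 0

theorem isFun_hatFun {v : 𝓢'(E3, ℂ)} (h : ∃ f : E3 → ℂ, IsFun (hat v) f) :
    IsFun (hat v) (hatFun v) := by
  rw [hatFun, dif_pos h]
  exact h.choose_spec

/-! ### The spaces `PM^a` and `C_w([0,∞); PM²)` -/

/-- `ess sup |ξ|^a |f ξ|`. -/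
def weightedSup (a : ℝ) (f : E3 → ℂ) : ℝ≥0∞ :=
  essSup (fun ξ => ‖ξ‖ₑ ^ a * ‖f ξ‖ₑ) volume

/-- The `PM^a` norm of a tempered distribution: `ess sup |ξ|^a |v̂ ξ|` if `v̂` is a locally
integrable function, and `∞` otherwise. (The function is unique almost everywhere, so the infimum
runs over at most one value.) The space `PM^a` consists of the `v` for which this is finite. -/
def pmNorm (a : ℝ) (v : 𝓢'(E3, ℂ)) : ℝ≥0∞ :=
  ⨅ (f : E3 → ℂ) (_ : IsFun (hat v) f), weightedSup a f

/-- The `PM^a` norm of a vector field: the maximum over the components. -/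
def vecNorm (a : ℝ) (v : VecDist) : ℝ≥0∞ := ⨆ j, pmNorm a (v j)

/-- `u ∈ C_w([0,∞); PM²)`: bounded in `PM²`, and `t ↦ ⟨u(t), φ⟩` is continuous on `[0,∞)` for
every Schwartz function `φ`. Only the values `u t` with `t ≥ 0` matter. -/
def MemCw (u : ℝ → VecDist) : Prop :=
  (⨆ t ∈ Set.Ici (0 : ℝ), vecNorm 2 (u t)) < ⊤ ∧
    ∀ (j : Fin 3) (φ : 𝓢(E3, ℂ)), ContinuousOn (fun t => u t j φ) (Set.Ici 0)

/-- `sup_{t > 0} ‖u(t)‖_{PM²}`. -/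
def supNorm (u : ℝ → VecDist) : ℝ≥0∞ := ⨆ t ∈ Set.Ioi (0 : ℝ), vecNorm 2 (u t)

/-! ### The bilinear form -/

/-- The symbol `δ_{jk} - ξ_j ξ_k / |ξ|²` of the Leray projector. -/
def leray (ξ : E3) (j k : Fin 3) : ℝ := (if j = k then 1 else 0) - ξ j * ξ k / ‖ξ‖ ^ 2

/-- The Fourier transform of the product `u_l v_k`, that is `(2π)⁻³ (û_l ∗ v̂_k)`. -/
def tensorHat (u v : VecDist) (l k : Fin 3) (ξ : E3) : ℂ :=
  ((2 * Real.pi) ^ 3 : ℝ)⁻¹ * ∫ η, hatFun (u l) (ξ - η) * hatFun (v k) η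

/-- The `j`-th component of the Fourier transform of
`B(u,v)(t) = -∫₀ᵗ S(t-τ) ℙ ∇·(u ⊗ v)(τ) dτ`. With the convention in force the Fourier transform
turns `-∂_l` into multiplication by `i ξ_l`. -/
def bilinHat (u v : ℝ → VecDist) (t : ℝ) (j : Fin 3) (ξ : E3) : ℂ :=
  ∫ τ in (0 : ℝ)..t, (Real.exp (-(t - τ) * ‖ξ‖ ^ 2) : ℂ) *
    ∑ k, (leray ξ j k : ℂ) * ∑ l, Complex.I * (ξ l : ℂ) * tensorHat (u τ) (v τ) l k ξ

/-- `η` is an admissible constant in the estimate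
`sup_{t>0} ‖B(u,v)(t)‖_{PM²} ≤ η · sup_{t>0} ‖u(t)‖_{PM²} · sup_{t>0} ‖v(t)‖_{PM²}` on
`C_w([0,∞); PM²)`. -/
def IsBilinearConstant (η : ℝ) : Prop :=
  0 < η ∧ ∀ u v : ℝ → VecDist, MemCw u → MemCw v → ∀ t > 0, ∀ j,
    weightedSup 2 (bilinHat u v t j) ≤ ENNReal.ofReal η * supNorm u * supNorm v

/-! ### Slezkin–Landau solutions -/

/-- The velocity field `V^c` of the Slezkin–Landau solution. -/
def landauField (c : ℝ) (x : E3) : Fin 3 → ℝ :=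
  ![2 * (c * ‖x‖ ^ 2 - 2 * x 0 * ‖x‖ + c * x 0 ^ 2) / (‖x‖ * (c * ‖x‖ - x 0) ^ 2),
    2 * (x 1 * (c * x 0 - ‖x‖)) / (‖x‖ * (c * ‖x‖ - x 0) ^ 2),
    2 * (x 2 * (c * x 0 - ‖x‖)) / (‖x‖ * (c * ‖x‖ - x 0) ^ 2)]

/-- The translate `x ↦ V^c(x - a)`, as a vector of tempered distributions. -/
def landau (c : ℝ) (a : E3) : VecDist := fun j => ofFun (fun x => (landauField c (x - a) j : ℂ))

/-- A measurable function of size `O(1/|x - a|)` defines a tempered distribution. -/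
theorem exists_isFun_of_le {f : E3 → ℂ} (hm : Measurable f) {C : ℝ} {a : E3}
    (hf : ∀ x, ‖f x‖ ≤ C * ‖x - a‖⁻¹) : ∃ T : 𝓢'(E3, ℂ), IsFun T f := by
  have hd : Module.finrank ℝ E3 = 3 := by simp
  have hloc : LocallyIntegrable f volume := by
    have h0 : LocallyIntegrable (fun x => f (x + a)) volume := by
      refine locallyIntegrable_of_norm_le_rpow (C := C) (α := 1) (by rw [hd]; norm_num)
        (by rw [hd]; norm_num) (Filter.Eventually.of_forall fun x => ?_)
        (hm.comp (measurable_add_const a)).aestronglyMeasurable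
      simpa [Real.rpow_neg_one] using hf (x + a)
    rw [locallyIntegrable_iff] at h0 ⊢
    intro K hK
    have h1 := h0 _ (hK.image (continuous_sub_right a))
    have h2 := (measurePreserving_add_right (volume : Measure E3) (-a)).integrableOn_comp_preimage
      (MeasurableEquiv.addRight (-a)).measurableEmbedding (f := fun x => f (x + a))
      (s := (fun x => x - a) '' K)
    have h3 := h2.2 h1
    refine (h3.mono_set (fun x hx => ⟨x, hx, by simp [sub_eq_add_neg]⟩)).congr_fun_ae ?_
    exact Filter.Eventually.of_forall fun x => by simp
  set s : Set E3 := Metric.closedBall a 1 with hs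
  have hsm : MeasurableSet s := Metric.isClosed_closedBall.measurableSet
  have h1 : MemLp (s.indicator f) 1 volume := by
    rw [memLp_one_iff_integrable, integrable_indicator_iff hsm]
    exact (locallyIntegrable_iff.1 hloc) _ (isCompact_closedBall a 1)
  have h2 : MemLp (sᶜ.indicator f) ⊤ volume := by
    refine memLp_top_of_bound (hm.indicator hsm.compl).aestronglyMeasurable (max C 0)
      (Filter.Eventually.of_forall fun x => ?_)
    by_cases hx : x ∈ sᶜ
    · rw [Set.indicator_of_mem hx]
      have hx1 : 1 < ‖x - a‖ := by simpa [hs, dist_eq_norm] using hx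
      have hi : ‖x - a‖⁻¹ ≤ 1 := inv_le_one_of_one_le₀ hx1.le
      have hi0 : 0 ≤ ‖x - a‖⁻¹ := by positivity
      calc ‖f x‖ ≤ C * ‖x - a‖⁻¹ := hf x
        _ ≤ max C 0 * ‖x - a‖⁻¹ := by gcongr; exact le_max_left _ _
        _ ≤ max C 0 * 1 := by gcongr
        _ = _ := mul_one _
    · rw [Set.indicator_of_notMem hx]; simp
  have i1 : ∀ φ : 𝓢(E3, ℂ), Integrable (fun x => φ x * s.indicator f x) volume := fun φ =>
    (memLp_one_iff_integrable.1 h1).bdd_mul φ.continuous.aestronglyMeasurable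
      (c := SchwartzMap.seminorm ℝ 0 0 φ)
      (Filter.Eventually.of_forall fun x => SchwartzMap.norm_le_seminorm ℝ φ x)
  have i2 : ∀ φ : 𝓢(E3, ℂ), Integrable (fun x => φ x * sᶜ.indicator f x) volume := fun φ =>
    memLp_one_iff_integrable.1 (h2.mul (φ.memLp 1 volume) (r := 1))
  have hsum : ∀ (φ : 𝓢(E3, ℂ)) (x : E3),
      φ x * f x = φ x * s.indicator f x + φ x * sᶜ.indicator f x := fun φ x => by
    rw [← mul_add]; congr 1; exact (congrFun (Set.indicator_self_add_compl s f) x).symm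
  refine ⟨Lp.toTemperedDistribution (h1.toLp _) + Lp.toTemperedDistribution (h2.toLp _), hloc,
    fun φ => ⟨?_, ?_⟩⟩
  · simp_rw [hsum φ]
    exact (i1 φ).add (i2 φ)
  · simp_rw [hsum φ]
    rw [integral_add (i1 φ) (i2 φ)]
    change (Lp.toTemperedDistribution (h1.toLp _)) φ + (Lp.toTemperedDistribution (h2.toLp _)) φ = _
    refine congrArg₂ (· + ·) ?_ ?_
    · refine (Lp.toTemperedDistribution_apply _ φ).trans (integral_congr_ae ?_)
      filter_upwards [h1.coeFn_toLp] with x hx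
      rw [hx, smul_eq_mul]
    · refine (Lp.toTemperedDistribution_apply _ φ).trans (integral_congr_ae ?_)
      filter_upwards [h2.coeFn_toLp] with x hx
      rw [hx, smul_eq_mul]

theorem landauField_bound {c : ℝ} (hc : 1 < |c|) :
   ∃ C, ∀ (x : E3) j, |landauField c x j| ≤ C * ‖x‖⁻¹ := by
  refine ⟨2 * (2 * |c| + 2) / (|c| - 1) ^ 2, fun x j => ?_⟩
  rcases eq_or_ne x 0 with rfl | hx
  · fin_cases j <;> simp [landauField]
  have hr : 0 < ‖x‖ := norm_pos_iff.2 hx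
  have hk : ∀ i, |x i| ≤ ‖x‖ := fun i => by simpa using PiLp.norm_apply_le x i
  have hd : (|c| - 1) * ‖x‖ ≤ |c * ‖x‖ - x 0| := by
    have := abs_sub_abs_le_abs_sub (c * ‖x‖) (x 0)
    rw [abs_mul, abs_of_pos hr] at this
    linarith [hk 0]
  have hc1 : 0 < |c| - 1 := by linarith
  have hd2 : ((|c| - 1) * ‖x‖) ^ 2 ≤ (c * ‖x‖ - x 0) ^ 2 := by
    rw [← sq_abs (c * ‖x‖ - x 0)]; gcongr
  have key : ∀ N : ℝ, |N| ≤ 2 * (2 * |c| + 2) * ‖x‖ ^ 2 →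
      |N / (‖x‖ * (c * ‖x‖ - x 0) ^ 2)| ≤ 2 * (2 * |c| + 2) / (|c| - 1) ^ 2 * ‖x‖⁻¹ := by
    intro N hN
    rw [abs_div, abs_mul, abs_of_pos hr, abs_of_nonneg (sq_nonneg (c * ‖x‖ - x 0))]
    calc _ ≤ 2 * (2 * |c| + 2) * ‖x‖ ^ 2 / (‖x‖ * ((|c| - 1) * ‖x‖) ^ 2) := by gcongr
      _ = _ := by field_simp
  have hcx : |c * x 0 - ‖x‖| ≤ (|c| + 1) * ‖x‖ := by
    refine (abs_sub _ _).trans ?_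
    rw [abs_mul, abs_of_pos hr]
    nlinarith [hk 0, abs_nonneg c]
  have hq : ∀ i, |2 * (x i * (c * x 0 - ‖x‖))| ≤ 2 * (2 * |c| + 2) * ‖x‖ ^ 2 := fun i => by
    rw [abs_mul, abs_mul, abs_two]
    have : |x i| * |c * x 0 - ‖x‖| ≤ ‖x‖ * ((|c| + 1) * ‖x‖) := by
      gcongr; exact hk i
    nlinarith [abs_nonneg c, sq_nonneg ‖x‖]
  fin_cases j
  · refine key _ ?_
    have h1 : |x 0| * ‖x‖ ≤ ‖x‖ * ‖x‖ := by gcongr; exact hk 0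
    have h2 : x 0 ^ 2 ≤ ‖x‖ ^ 2 := by rw [← sq_abs (x 0)]; gcongr; exact hk 0
    have h3 : |c * ‖x‖ ^ 2 - 2 * x 0 * ‖x‖ + c * x 0 ^ 2| ≤
        |c| * ‖x‖ ^ 2 + 2 * (|x 0| * ‖x‖) + |c| * x 0 ^ 2 := by
      refine (abs_add_le _ _).trans ?_
      refine add_le_add ((abs_sub _ _).trans ?_) ?_
      · simp [abs_mul, mul_assoc]
      · simp [abs_mul]
    rw [abs_mul, abs_two]
    nlinarith [mul_le_mul_of_nonneg_left h2 (abs_nonneg c)]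
  · exact key _ (hq 1)
  · exact key _ (hq 2)

/-- For `|c| > 1` the Slezkin–Landau field does define tempered distributions. -/
theorem isFun_landau {c : ℝ} (hc : 1 < |c|) (a : E3) (j : Fin 3) :
    IsFun (landau c a j) (fun x => (landauField c (x - a) j : ℂ)) := by
  obtain ⟨C, hC⟩ := landauField_bound hc
  refine isFun_ofFun (exists_isFun_of_le ?_ (C := C) (a := a) fun x => by simpa using hC (x - a) j)
  fin_cases j <;> simp [landauField] <;> fun_prop

/-- The strength `κ(c)` of the point force which generates `V^c`. -/
def landauKappa (c : ℝ) : ℝ :=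
  8 * Real.pi * c / (3 * (c ^ 2 - 1)) *
    (2 + 6 * c ^ 2 - 3 * c * (c ^ 2 - 1) * Real.log ((c + 1) / (c - 1)))

/-- `K` is an admissible constant in the estimate `‖V^c‖_{PM²} ≤ K / |c|` for all `|c| > 2`. -/
def IsLandauConstant (K : ℝ) : Prop :=
  0 < K ∧ ∀ c : ℝ, 2 < |c| → vecNorm 2 (landau c 0) ≤ ENNReal.ofReal (K / |c|)

/-! ### The two equations -/

/-- The `j`-th component of the Fourier transform of `κ ∫₀ᵗ S(t-τ) ℙ(δ_{γ(τ)} e₁) dτ`. -/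
def forceHat (κ : ℝ) (γ : ℝ → E3) (t : ℝ) (j : Fin 3) (ξ : E3) : ℂ :=
  κ * ∫ τ in (0 : ℝ)..t, (Real.exp (-(t - τ) * ‖ξ‖ ^ 2) : ℂ) *
    ((leray ξ j 0 : ℂ) * Complex.exp (Complex.I * (inner ℝ (γ τ) ξ : ℝ)))

/-- `u` solves, in the mild sense, the Navier–Stokes system with the force `κ δ_{γ(t)} e₁` and zero
initial datum: `û = B(u,u)^ + κ ∫₀ᵗ exp(-(t-τ)|ξ|²) ℙ̂(ξ) exp(i γ(τ)·ξ) e₁ dτ` for all `t ≥ 0` and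
almost all `ξ`. -/
def IsForcedSolution (κ : ℝ) (γ : ℝ → E3) (u : ℝ → VecDist) : Prop :=
  ∀ t ≥ 0, ∀ j, ∀ᵐ ξ : E3, hatFun (u t j) ξ = bilinHat u u t j ξ + forceHat κ γ t j ξ

/-- The `j`-th component of the Fourier transform of `y₀(t)`. -/
def yHat (c : ℝ) (γ : ℝ → E3) (t : ℝ) (j : Fin 3) (ξ : E3) : ℂ :=
  (‖ξ‖ ^ 2 : ℝ) * (∫ τ in (0 : ℝ)..t, (Real.exp (-(t - τ) * ‖ξ‖ ^ 2) : ℂ) *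
      ((Complex.exp (Complex.I * (inner ℝ (γ τ) ξ : ℝ)) -
        Complex.exp (Complex.I * (inner ℝ (γ t) ξ : ℝ))) * hatFun (landau c 0 j) ξ)) -
    (Real.exp (-t * ‖ξ‖ ^ 2) : ℂ) * Complex.exp (Complex.I * (inner ℝ (γ t) ξ : ℝ)) *
      hatFun (landau c 0 j) ξ

/-- `ω = B(ω,ω) + B(V^c_γ,ω) + B(ω,V^c_γ) + y₀`, where `V^c_γ(x,t) = V^c(x - γ(t))`: equality of
Fourier transforms for all `t ≥ 0` and almost all `ξ`. -/
def IsPerturbationSolution (c : ℝ) (γ : ℝ → E3) (ω : ℝ → VecDist) : Prop :=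
  ∀ t ≥ 0, ∀ j, ∀ᵐ ξ : E3,
    hatFun (ω t j) ξ = bilinHat ω ω t j ξ + bilinHat (fun s => landau c (γ s)) ω t j ξ +
      bilinHat ω (fun s => landau c (γ s)) t j ξ + yHat c γ t j ξ

end SingularNS

end

open SingularNS

/-!
# Singularly forced Navier–Stokes flow and perturbations of the Slezkin–Landau solutions

Coordinates are numbered from `0`, so that `e₀` is the direction of the force. In the variables
`û = F` the Navier–Stokes system with force `κ δ_{γ(t)} e₀` reads `F = B(F, F) + Y`, where `Y` is
the Duhamel integral of the force. Since the convolution of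
`‖ξ‖⁻²` with itself is `O(‖ξ‖⁻¹)`, the symbol of `-ℙ ∇·(u ⊗ v)` is bounded, and the heat kernel
gains the weight `‖ξ‖⁻²`: this is the bilinear estimate (`exists_isBilinearConstant`). The force has
size `2 |κ| ‖ξ‖⁻²`. Picard iteration therefore gives a solution of size `4 |κ|` for small `κ`
(`exists_forcedSolution`), and the bilinear estimate separates two solutions `u`, `v` whenever
`η (‖u‖ + ‖v‖) < 1` (`forcedSolution_unique`). Elements of `C_w([0,∞); PM²)` are only weakly
continuous in time; `MemCw.exists_isAdm` provides jointly measurable representatives of their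
Fourier transforms, so that the time integrals can be handled.

The two equations are related by the fact that `V = V^c` is a stationary solution for the force
`κ(c) δ₀ e₀`, that is, `‖ξ‖² V̂ = (symbol of -ℙ ∇·(V ⊗ V)) + κ(c) ℙ̂ e₀`
(`norm_sq_mul_landauHat`). Translation by `γ(t)` multiplies `V̂` by a phase, which factors out of the
convolution. Hence the quadratic and the force terms of `V_γ` add up to `V_γ + y₀`, and `ω` solves
the perturbation equation if and only if `ω + V_γ` solves the forced system
(`IsLandauTransform.isPerturbationSolution_iff`). As both `κ(c)` and the norm of `V^c` are
`O(1/|c|)`, everything is small enough for large `|c|` (`exists_threshold`), and the ball for `ω` is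
tuned so that the uniqueness criterion applies to `ω + V_γ` as well.

What remains is the Slezkin–Landau field itself. Since `V^c` is built from powers of
`(c ‖x‖ - x₀)⁻¹`, it is, for `c > 0`, the superposition over `k > 0` of divergence free fields made
from `exp (-k (c ‖x‖ - x₀))` (`integral_landauMode`); for `c < 0` the sign is absorbed into the
modes. Subordination to Gaussians yields the transform `8 π μ / (μ² + (ξ - i m e₀)²)²` of
`exp (-μ ‖x‖ + m x₀)` (`integral_phase_mul_expField`), hence the transform of each mode in closed
form, and summing up gives `V̂^c = O(‖ξ‖⁻² / |c|)` (`isFun_hat_landau`, `norm_landauHat_le`). The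
modes have integrable transforms, so the convolution theorem for `V_l V_m` also follows mode by mode
(`integral_hatSchwartz_mul_landauField_mul_landauField`).

Off the origin `V^c` satisfies the stationary system with the pressure
`4 (c x₀ / ‖x‖ - 1) / (c ‖x‖ - x₀)²` by direct computation (`sum_stressDerivPoly`). The stress tensor
`V ⊗ V + p - ∇V` is homogeneous of degree `-2`, so that its distributional divergence is its flux out
of the origin times `δ₀` (`sum_integral_mul_lineDeriv`). Integration in spherical coordinates shows
that this flux is `κ(c) e₀` (`originFlux_landauStress`). Testing against Fourier transforms of
solenoidal test functions removes the pressure, which gives the stationary equation.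
-/

open MeasureTheory SchwartzMap
open scoped ENNReal SchwartzMap FourierTransform

noncomputable section

namespace SingularNS

/-! ### Weights `‖x‖⁻ᵃ` on `ℝ³` -/

theorem finrank_E3 : Module.finrank ℝ E3 = 3 := by simp

theorem locallyIntegrable_of_le_inv_sq {f : E3 → ℂ} (hm : AEStronglyMeasurable f volume) {C : ℝ}
    (hf : ∀ᵐ x : E3, ‖f x‖ ≤ C * (‖x‖ ^ 2)⁻¹) : LocallyIntegrable f volume := by
  refine locallyIntegrable_of_norm_le_rpow (C := C) (α := 2) (by rw [finrank_E3]; norm_num)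
    (by rw [finrank_E3]; norm_num) ?_ hm
  filter_upwards [hf] with x hx
  rw [Real.rpow_neg (norm_nonneg _)]
  simpa using hx

/-- A function integrable on the unit ball and bounded outside defines a tempered distribution. -/
theorem exists_isFun_of_integrableOn_ball {f : E3 → ℂ} (hm : AEStronglyMeasurable f volume)
    (hl : LocallyIntegrable f volume) {C : ℝ}
    (hf : ∀ᵐ x : E3, x ∉ Metric.closedBall (0 : E3) 1 → ‖f x‖ ≤ C) :
    ∃ T : 𝓢'(E3, ℂ), IsFun T f := by
  set s : Set E3 := Metric.closedBall 0 1 with hs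
  have hsm : MeasurableSet s := Metric.isClosed_closedBall.measurableSet
  have h1 : MemLp (s.indicator f) 1 volume := by
    rw [memLp_one_iff_integrable, integrable_indicator_iff hsm]
    exact (locallyIntegrable_iff.1 hl) _ (isCompact_closedBall 0 1)
  have h2 : MemLp (sᶜ.indicator f) ⊤ volume := by
    refine memLp_top_of_bound (hm.indicator hsm.compl) (max C 0) ?_
    filter_upwards [hf] with x hx
    by_cases hxs : x ∈ sᶜ
    · rw [Set.indicator_of_mem hxs]
      exact (hx hxs).trans (le_max_left _ _)
    · rw [Set.indicator_of_notMem hxs]; simp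
  have i1 : ∀ φ : 𝓢(E3, ℂ), Integrable (fun x => φ x * s.indicator f x) volume := fun φ =>
    (memLp_one_iff_integrable.1 h1).bdd_mul φ.continuous.aestronglyMeasurable
      (c := SchwartzMap.seminorm ℝ 0 0 φ)
      (Filter.Eventually.of_forall fun x => SchwartzMap.norm_le_seminorm ℝ φ x)
  have i2 : ∀ φ : 𝓢(E3, ℂ), Integrable (fun x => φ x * sᶜ.indicator f x) volume := fun φ =>
    memLp_one_iff_integrable.1 (h2.mul (φ.memLp 1 volume) (r := 1))
  have hsum : ∀ (φ : 𝓢(E3, ℂ)) (x : E3),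
      φ x * f x = φ x * s.indicator f x + φ x * sᶜ.indicator f x := fun φ x => by
    rw [← mul_add]; congr 1; exact (congrFun (Set.indicator_self_add_compl s f) x).symm
  refine ⟨Lp.toTemperedDistribution (h1.toLp _) + Lp.toTemperedDistribution (h2.toLp _), hl,
    fun φ => ⟨?_, ?_⟩⟩
  · simp_rw [hsum φ]
    exact (i1 φ).add (i2 φ)
  · simp_rw [hsum φ]
    rw [integral_add (i1 φ) (i2 φ)]
    change (Lp.toTemperedDistribution (h1.toLp _)) φ + (Lp.toTemperedDistribution (h2.toLp _)) φ = _
    refine congrArg₂ (· + ·) ?_ ?_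
    · refine (Lp.toTemperedDistribution_apply _ φ).trans (integral_congr_ae ?_)
      filter_upwards [h1.coeFn_toLp] with x hx
      rw [hx, smul_eq_mul]
    · refine (Lp.toTemperedDistribution_apply _ φ).trans (integral_congr_ae ?_)
      filter_upwards [h2.coeFn_toLp] with x hx
      rw [hx, smul_eq_mul]

theorem exists_isFun_of_le_inv_sq {f : E3 → ℂ} (hm : AEStronglyMeasurable f volume) {C : ℝ}
    (hf : ∀ᵐ x : E3, ‖f x‖ ≤ C * (‖x‖ ^ 2)⁻¹) : ∃ T : 𝓢'(E3, ℂ), IsFun T f := by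
  refine exists_isFun_of_integrableOn_ball hm (locallyIntegrable_of_le_inv_sq hm hf)
    (C := max C 0) ?_
  filter_upwards [hf] with x hx hxs
  have hx1 : 1 < ‖x‖ := by simpa using hxs
  have hi : (‖x‖ ^ 2)⁻¹ ≤ 1 := inv_le_one_of_one_le₀ (by nlinarith)
  have hi0 : 0 ≤ (‖x‖ ^ 2)⁻¹ := by positivity
  calc ‖f x‖ ≤ C * (‖x‖ ^ 2)⁻¹ := hx
    _ ≤ max C 0 * (‖x‖ ^ 2)⁻¹ := by gcongr; exact le_max_left _ _
    _ ≤ max C 0 * 1 := by gcongr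
    _ = _ := mul_one _

theorem integrable_schwartz_mul_of_le_inv_sq (φ : 𝓢(E3, ℂ)) {f : E3 → ℂ}
    (hm : AEStronglyMeasurable f volume) {C : ℝ} (hf : ∀ᵐ x : E3, ‖f x‖ ≤ C * (‖x‖ ^ 2)⁻¹) :
    Integrable (fun x => φ x * f x) volume := by
  obtain ⟨T, hT⟩ := exists_isFun_of_le_inv_sq hm hf
  exact (hT.2 φ).1

theorem integrable_inv_sq_mul_norm_schwartz (φ : 𝓢(E3, ℂ)) :
    Integrable (fun x => (‖x‖ ^ 2)⁻¹ * ‖φ x‖) volume := by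
  have h := (integrable_schwartz_mul_of_le_inv_sq φ (C := 1)
    (f := fun x => (((‖x‖ ^ 2)⁻¹ : ℝ) : ℂ))
    (by fun_prop : Measurable fun x : E3 => (((‖x‖ ^ 2)⁻¹ : ℝ) : ℂ)).aestronglyMeasurable
    (Filter.Eventually.of_forall fun x => by simp)).norm
  refine h.congr (Filter.Eventually.of_forall fun x => ?_)
  simp [mul_comm]

theorem integrable_inv_mul_norm_schwartz (φ : 𝓢(E3, ℂ)) :
    Integrable (fun x => ‖x‖⁻¹ * ‖φ x‖) volume := by
  refine ((integrable_inv_sq_mul_norm_schwartz φ).add φ.integrable.norm).mono'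
    (by fun_prop : Measurable fun x : E3 => ‖x‖⁻¹ * ‖φ x‖).aestronglyMeasurable
    (Filter.Eventually.of_forall fun x => ?_)
  have h : ‖x‖⁻¹ ≤ (‖x‖ ^ 2)⁻¹ + 1 := by
    rw [← inv_pow]
    nlinarith [sq_nonneg (‖x‖⁻¹ - 1)]
  simp only [norm_mul, norm_inv, norm_norm, Pi.add_apply]
  nlinarith [mul_le_mul_of_nonneg_right h (norm_nonneg (φ x))]

/-! ### The convolution of `‖ξ‖⁻²` with itself -/

/-- A radial profile, integrable on `ℝ³`: for `‖ξ‖ = 1` the sum of its values at `‖ξ - η‖` and `‖η‖`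
bounds `‖ξ - η‖⁻² ‖η‖⁻²`. -/
def kernelProfile (y : ℝ) : ℝ := if y < 1 / 2 then 4 * (y ^ 2)⁻¹ else (y ^ 4)⁻¹

theorem integrable_kernelProfile : Integrable (fun x : E3 => kernelProfile ‖x‖) volume := by
  rw [integrable_fun_norm_addHaar (μ := (volume : Measure E3)) (f := kernelProfile), finrank_E3]
  rw [← Set.Ioo_union_Ici_eq_Ioi (show (0 : ℝ) < 1 / 2 by norm_num), integrableOn_union]
  constructor
  · refine IntegrableOn.congr_fun (f := fun _ => (4 : ℝ)) (integrableOn_const (by simp)) ?_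
      measurableSet_Ioo
    intro y hy
    have : y ≠ 0 := hy.1.ne'
    simp only [kernelProfile, if_pos hy.2, smul_eq_mul]
    field_simp
  · rw [integrableOn_Ici_iff_integrableOn_Ioi]
    refine IntegrableOn.congr_fun (f := fun y : ℝ => y ^ (-2 : ℝ))
      (integrableOn_Ioi_rpow_of_lt (by norm_num) (by norm_num)) ?_ measurableSet_Ioi
    intro y hy
    have hy' : (1 : ℝ) / 2 < y := hy
    have h0 : 0 < y := by linarith
    simp only [kernelProfile, if_neg (not_lt.2 hy'.le), smul_eq_mul]
    rw [Real.rpow_neg h0.le]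
    norm_cast
    field_simp

theorem kernelProfile_nonneg (y : ℝ) : 0 ≤ kernelProfile y := by
  unfold kernelProfile; split_ifs <;> positivity

/-- The constant `C` in `∫ ‖ξ - η‖⁻² ‖η‖⁻² dη ≤ C ‖ξ‖⁻¹`. -/
def convConst : ℝ := 2 * ∫ x : E3, kernelProfile ‖x‖

theorem convConst_nonneg : 0 ≤ convConst :=
  mul_nonneg zero_le_two (integral_nonneg fun _ => kernelProfile_nonneg _)

theorem inv_sq_mul_inv_sq_le {a b R : ℝ} (ha : 0 ≤ a) (hb : 0 ≤ b) (hR : 0 < R) (h : R ≤ a + b) :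
    (a ^ 2)⁻¹ * (b ^ 2)⁻¹ ≤
      (R ^ 4)⁻¹ * (kernelProfile (R⁻¹ * a) + kernelProfile (R⁻¹ * b)) := by
  have hlt : ∀ y, R⁻¹ * y < 1 / 2 ↔ y < R / 2 := fun y => by
    rw [inv_mul_lt_iff₀ hR]; constructor <;> intro h <;> linarith
  have h2 : ∀ y, 0 ≤ y → (R ^ 4)⁻¹ * (4 * ((R⁻¹ * y) ^ 2)⁻¹) = 4 * (R ^ 2)⁻¹ * (y ^ 2)⁻¹ :=
    fun y _ => by
      rw [mul_pow, mul_inv, inv_pow, inv_inv]; field_simp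
  have h4 : ∀ y, (R ^ 4)⁻¹ * ((R⁻¹ * y) ^ 4)⁻¹ = (y ^ 4)⁻¹ := fun y => by
    rw [mul_pow, mul_inv, inv_pow, inv_inv]; field_simp
  have hbig : ∀ y, R / 2 ≤ y → (y ^ 2)⁻¹ ≤ 4 * (R ^ 2)⁻¹ := fun y hy => by
    have : (R / 2) ^ 2 ≤ y ^ 2 := by gcongr
    calc (y ^ 2)⁻¹ ≤ ((R / 2) ^ 2)⁻¹ := by gcongr
      _ = _ := by field_simp; norm_num
  have hn : ∀ y, 0 ≤ (R ^ 4)⁻¹ * kernelProfile y := fun y =>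
    mul_nonneg (by positivity) (kernelProfile_nonneg y)
  rw [mul_add]
  -- if one of `a`, `b` is less than `R / 2`, then the other is at least `R / 2`;
  -- otherwise `2 a⁻² b⁻² ≤ a⁻⁴ + b⁻⁴`
  rcases lt_or_ge a (R / 2) with h1 | h1
  · have hb' : R / 2 ≤ b := by linarith
    have e : (R ^ 4)⁻¹ * kernelProfile (R⁻¹ * a) = 4 * (R ^ 2)⁻¹ * (a ^ 2)⁻¹ := by
      rw [kernelProfile, if_pos ((hlt a).2 h1), h2 a ha]
    rw [e]
    have := mul_le_mul_of_nonneg_left (hbig b hb') (by positivity : 0 ≤ (a ^ 2)⁻¹)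
    linarith [hn (R⁻¹ * b)]
  rcases lt_or_ge b (R / 2) with h3 | h3
  · have e : (R ^ 4)⁻¹ * kernelProfile (R⁻¹ * b) = 4 * (R ^ 2)⁻¹ * (b ^ 2)⁻¹ := by
      rw [kernelProfile, if_pos ((hlt b).2 h3), h2 b hb]
    rw [e]
    have := mul_le_mul_of_nonneg_right (hbig a h1) (by positivity : 0 ≤ (b ^ 2)⁻¹)
    linarith [hn (R⁻¹ * a)]
  · rw [kernelProfile, kernelProfile, if_neg (by rw [hlt]; linarith),
      if_neg (by rw [hlt]; linarith), h4, h4]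
    have e : ∀ y : ℝ, (y ^ 4)⁻¹ = ((y ^ 2)⁻¹) ^ 2 := fun y => by rw [inv_pow, ← pow_mul]
    rw [e, e]
    nlinarith [sq_nonneg ((a ^ 2)⁻¹ - (b ^ 2)⁻¹), sq_nonneg ((a ^ 2)⁻¹ + (b ^ 2)⁻¹)]

theorem integrable_kernelProfile_scaled {R : ℝ} (hR : 0 < R) :
    Integrable (fun x : E3 => kernelProfile (R⁻¹ * ‖x‖)) volume ∧
      ∫ x : E3, kernelProfile (R⁻¹ * ‖x‖) = R ^ 3 * ∫ x : E3, kernelProfile ‖x‖ := by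
  have e : (fun x : E3 => kernelProfile (R⁻¹ * ‖x‖)) =
      fun x : E3 => (fun y : E3 => kernelProfile ‖y‖) (R⁻¹ • x) := by
    ext x
    simp [norm_smul, abs_of_pos hR]
  rw [e]
  refine ⟨integrable_kernelProfile.comp_smul (inv_ne_zero hR.ne'), ?_⟩
  refine (Measure.integral_comp_inv_smul volume (fun y : E3 => kernelProfile ‖y‖) R).trans ?_
  rw [finrank_E3, abs_of_pos (by positivity), smul_eq_mul]

theorem integrable_conv_inv_sq {ξ : E3} (hξ : ξ ≠ 0) :
    Integrable (fun η : E3 => (‖ξ - η‖ ^ 2)⁻¹ * (‖η‖ ^ 2)⁻¹) volume ∧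
      ∫ η : E3, (‖ξ - η‖ ^ 2)⁻¹ * (‖η‖ ^ 2)⁻¹ ≤ convConst * ‖ξ‖⁻¹ := by
  have hR : 0 < ‖ξ‖ := norm_pos_iff.2 hξ
  obtain ⟨i0, e0⟩ := integrable_kernelProfile_scaled hR
  have i1 : Integrable (fun η : E3 => kernelProfile (‖ξ‖⁻¹ * ‖ξ - η‖)) volume :=
    i0.comp_sub_left ξ
  have e1 : ∫ η : E3, kernelProfile (‖ξ‖⁻¹ * ‖ξ - η‖) =
      ‖ξ‖ ^ 3 * ∫ x : E3, kernelProfile ‖x‖ := by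
    rw [← e0]
    exact integral_sub_left_eq_self (fun x : E3 => kernelProfile (‖ξ‖⁻¹ * ‖x‖)) volume ξ
  have hle : ∀ η : E3, (‖ξ - η‖ ^ 2)⁻¹ * (‖η‖ ^ 2)⁻¹ ≤ (‖ξ‖ ^ 4)⁻¹ *
      (kernelProfile (‖ξ‖⁻¹ * ‖ξ - η‖) + kernelProfile (‖ξ‖⁻¹ * ‖η‖)) := fun η =>
    inv_sq_mul_inv_sq_le (norm_nonneg _) (norm_nonneg _) hR (by
      simpa using norm_add_le (ξ - η) η)
  have im := (i1.add i0).const_mul (‖ξ‖ ^ 4)⁻¹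
  have i : Integrable (fun η : E3 => (‖ξ - η‖ ^ 2)⁻¹ * (‖η‖ ^ 2)⁻¹) volume := by
    refine im.mono'
      (by fun_prop : Measurable fun η : E3 => (‖ξ - η‖ ^ 2)⁻¹ * (‖η‖ ^ 2)⁻¹).aestronglyMeasurable
      (Filter.Eventually.of_forall fun η => ?_)
    rw [Real.norm_of_nonneg (by positivity)]
    exact hle η
  refine ⟨i, (integral_mono i im hle).trans (le_of_eq ?_)⟩
  rw [integral_const_mul]
  simp only [Pi.add_apply]
  rw [integral_add i1 i0, e0, e1, convConst]
  field_simp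
  ring

/-! ### The Fourier transform on tempered distributions and the `PM²` norm -/

/-- The inverse of `hatSchwartz`. -/
def hatSchwartzInv : 𝓢(E3, ℂ) →L[ℂ] 𝓢(E3, ℂ) :=
  (FourierTransform.fourierCLM ℂ 𝓢(E3, ℂ)) ∘L
    (SchwartzMap.compCLMOfContinuousLinearEquiv ℂ dilation.symm)

theorem hatSchwartz_hatSchwartzInv (φ : 𝓢(E3, ℂ)) : hatSchwartz (hatSchwartzInv φ) = φ := by
  ext x
  simp [hatSchwartz, hatSchwartzInv]

theorem hatSchwartzInv_hatSchwartz (φ : 𝓢(E3, ℂ)) : hatSchwartzInv (hatSchwartz φ) = φ := by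
  have : SchwartzMap.compCLMOfContinuousLinearEquiv ℂ dilation.symm (hatSchwartz φ) =
      FourierTransform.fourierInvCLM ℂ 𝓢(E3, ℂ) φ := by
    ext x
    simp [hatSchwartz]
  rw [hatSchwartzInv, ContinuousLinearMap.comp_apply, this]
  simp

theorem hat_injective {v w : 𝓢'(E3, ℂ)} (h : hat v = hat w) : v = w := by
  ext φ
  have := DFunLike.congr_fun h (hatSchwartzInv φ)
  rwa [hat_apply, hat_apply, hatSchwartz_hatSchwartzInv] at this

theorem exists_hat_eq (T : 𝓢'(E3, ℂ)) : ∃ v : 𝓢'(E3, ℂ), hat v = T := by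
  refine ⟨PointwiseConvergenceCLM.precomp ℂ hatSchwartzInv T, ?_⟩
  ext φ
  change T (hatSchwartzInv (hatSchwartz φ)) = T φ
  rw [hatSchwartzInv_hatSchwartz]

theorem IsFun.sub {S T : 𝓢'(E3, ℂ)} {f g : E3 → ℂ} (hf : IsFun S f) (hg : IsFun T g) :
    IsFun (S - T) (fun x => f x - g x) := by
  refine ⟨hf.1.sub hg.1, fun φ => ⟨?_, ?_⟩⟩
  · simp_rw [mul_sub]
    exact (hf.2 φ).1.sub (hg.2 φ).1
  · simp_rw [mul_sub]
    rw [integral_sub (hf.2 φ).1 (hg.2 φ).1, ← (hf.2 φ).2, ← (hg.2 φ).2]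
    rfl

theorem IsFun.dist_eq {S T : 𝓢'(E3, ℂ)} {f g : E3 → ℂ} (hf : IsFun S f) (hg : IsFun T g)
    (h : f =ᵐ[volume] g) : S = T := by
  ext φ
  rw [(hf.2 φ).2, (hg.2 φ).2]
  refine integral_congr_ae ?_
  filter_upwards [h] with x hx
  rw [hx]

theorem hatFun_ae_eq {v : 𝓢'(E3, ℂ)} {f : E3 → ℂ} (hf : IsFun (hat v) f) :
    hatFun v =ᵐ[volume] f :=
  (isFun_hatFun ⟨f, hf⟩).ae_eq hf

theorem ae_ne_zero : ∀ᵐ ξ : E3, ξ ≠ 0 := by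
  simp [ae_iff, measure_singleton]

theorem weightedSup_congr {f g : E3 → ℂ} (h : f =ᵐ[volume] g) :
    weightedSup 2 f = weightedSup 2 g := by
  refine essSup_congr_ae ?_
  filter_upwards [h] with x hx
  rw [hx]

theorem weightedSup_le_iff {f : E3 → ℂ} {M : ℝ} (hM : 0 ≤ M) :
    weightedSup 2 f ≤ ENNReal.ofReal M ↔ ∀ᵐ ξ : E3, ‖f ξ‖ ≤ M * (‖ξ‖ ^ 2)⁻¹ := by
  have key : ∀ ξ : E3, ξ ≠ 0 →
      (‖ξ‖ₑ ^ (2 : ℝ) * ‖f ξ‖ₑ ≤ ENNReal.ofReal M ↔ ‖f ξ‖ ≤ M * (‖ξ‖ ^ 2)⁻¹) := fun ξ hξ => by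
    have h0 : 0 < ‖ξ‖ := norm_pos_iff.2 hξ
    rw [← ofReal_norm, ← ofReal_norm,
      ENNReal.ofReal_rpow_of_nonneg h0.le (by norm_num), ← ENNReal.ofReal_mul (by positivity),
      ENNReal.ofReal_le_ofReal_iff hM, ← div_eq_mul_inv, le_div_iff₀ (by positivity), mul_comm]
    norm_num
  constructor
  · intro h
    filter_upwards [ENNReal.ae_le_essSup (μ := (volume : Measure E3))
      (fun ξ : E3 => ‖ξ‖ₑ ^ (2 : ℝ) * ‖f ξ‖ₑ), ae_ne_zero] with ξ h1 h2
    exact (key ξ h2).1 (h1.trans h)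
  · intro h
    refine essSup_le_of_ae_le _ ?_
    filter_upwards [h, ae_ne_zero] with ξ h1 h2
    exact (key ξ h2).2 h1

theorem pmNorm_eq {v : 𝓢'(E3, ℂ)} {f : E3 → ℂ} (hf : IsFun (hat v) f) :
    pmNorm 2 v = weightedSup 2 f := by
  refine le_antisymm (iInf₂_le f hf) (le_iInf₂ fun g hg => ?_)
  exact (weightedSup_congr (hf.ae_eq hg)).le

theorem isFun_hatFun_of_pmNorm_lt {v : 𝓢'(E3, ℂ)} (h : pmNorm 2 v < ⊤) :
    IsFun (hat v) (hatFun v) := by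
  refine isFun_hatFun ?_
  by_contra hc
  push Not at hc
  simp [pmNorm, hc] at h

theorem pmNorm_le_iff {v : 𝓢'(E3, ℂ)} {M : ℝ} (hM : 0 ≤ M) :
    pmNorm 2 v ≤ ENNReal.ofReal M ↔
      IsFun (hat v) (hatFun v) ∧ ∀ᵐ ξ : E3, ‖hatFun v ξ‖ ≤ M * (‖ξ‖ ^ 2)⁻¹ := by
  constructor
  · intro h
    have h1 := isFun_hatFun_of_pmNorm_lt (h.trans_lt ENNReal.ofReal_lt_top)
    exact ⟨h1, (weightedSup_le_iff hM).1 (pmNorm_eq h1 ▸ h)⟩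
  · rintro ⟨h1, h2⟩
    rw [pmNorm_eq h1]
    exact (weightedSup_le_iff hM).2 h2

theorem vecNorm_le_iff {v : VecDist} {M : ℝ≥0∞} : vecNorm 2 v ≤ M ↔ ∀ j, pmNorm 2 (v j) ≤ M :=
  iSup_le_iff

theorem weightedSup_add_le (f g : E3 → ℂ) :
    weightedSup 2 (fun ξ => f ξ + g ξ) ≤ weightedSup 2 f + weightedSup 2 g := by
  refine essSup_le_of_ae_le _ ?_
  filter_upwards [ENNReal.ae_le_essSup (μ := (volume : Measure E3))
    (fun ξ : E3 => ‖ξ‖ₑ ^ (2 : ℝ) * ‖f ξ‖ₑ), ENNReal.ae_le_essSup (μ := (volume : Measure E3))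
    (fun ξ : E3 => ‖ξ‖ₑ ^ (2 : ℝ) * ‖g ξ‖ₑ)] with ξ h1 h2
  calc ‖ξ‖ₑ ^ (2 : ℝ) * ‖f ξ + g ξ‖ₑ ≤ ‖ξ‖ₑ ^ (2 : ℝ) * (‖f ξ‖ₑ + ‖g ξ‖ₑ) := by
        gcongr; exact enorm_add_le _ _
    _ ≤ _ := by rw [mul_add]; exact add_le_add h1 h2

theorem weightedSup_neg (f : E3 → ℂ) : weightedSup 2 (fun ξ => -f ξ) = weightedSup 2 f := by
  simp [weightedSup]

theorem pmNorm_sub_le (v w : 𝓢'(E3, ℂ)) : pmNorm 2 (v - w) ≤ pmNorm 2 v + pmNorm 2 w := by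
  rcases eq_or_ne (pmNorm 2 v) ⊤ with h1 | h1
  · simp [h1]
  rcases eq_or_ne (pmNorm 2 w) ⊤ with h2 | h2
  · simp [h2]
  have i1 := isFun_hatFun_of_pmNorm_lt (lt_top_iff_ne_top.2 h1)
  have i2 := isFun_hatFun_of_pmNorm_lt (lt_top_iff_ne_top.2 h2)
  have i3 : IsFun (hat (v - w)) (fun ξ => hatFun v ξ - hatFun w ξ) := by
    have : hat (v - w) = hat v - hat w :=
      map_sub (PointwiseConvergenceCLM.precomp ℂ hatSchwartz) v w
    rw [this]
    exact i1.sub i2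
  rw [pmNorm_eq i1, pmNorm_eq i2, pmNorm_eq i3]
  simp_rw [sub_eq_add_neg]
  refine (weightedSup_add_le _ _).trans ?_
  rw [weightedSup_neg]

theorem vecNorm_sub_le (v w : VecDist) : vecNorm 2 (v - w) ≤ vecNorm 2 v + vecNorm 2 w :=
  vecNorm_le_iff.2 fun j => (pmNorm_sub_le (v j) (w j)).trans
    (add_le_add (le_iSup (fun j => pmNorm 2 (v j)) j) (le_iSup (fun j => pmNorm 2 (w j)) j))

theorem hatFun_sub_ae {v w : 𝓢'(E3, ℂ)} (hv : IsFun (hat v) (hatFun v))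
    (hw : IsFun (hat w) (hatFun w)) :
    hatFun (v - w) =ᵐ[volume] fun ξ => hatFun v ξ - hatFun w ξ := by
  have : hat (v - w) = hat v - hat w := map_sub (PointwiseConvergenceCLM.precomp ℂ hatSchwartz) v w
  exact hatFun_ae_eq (this ▸ hv.sub hw)

theorem eq_of_hatFun_ae_eq {v w : 𝓢'(E3, ℂ)} (hv : IsFun (hat v) (hatFun v))
    (hw : IsFun (hat w) (hatFun w)) (h : hatFun v =ᵐ[volume] hatFun w) : v = w :=
  hat_injective (hv.dist_eq hw h)

/-! ### Fields in `C_w([0,∞); PM²)` -/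

theorem MemCw.exists_bound {u : ℝ → VecDist} (hu : MemCw u) :
    ∃ M : ℝ, 0 ≤ M ∧ ∀ t ≥ 0, ∀ j, IsFun (hat (u t j)) (hatFun (u t j)) ∧
      ∀ᵐ ξ : E3, ‖hatFun (u t j) ξ‖ ≤ M * (‖ξ‖ ^ 2)⁻¹ := by
  refine ⟨(⨆ t ∈ Set.Ici (0 : ℝ), vecNorm 2 (u t)).toReal, ENNReal.toReal_nonneg,
    fun t ht j => (pmNorm_le_iff ENNReal.toReal_nonneg).1 ?_⟩
  rw [ENNReal.ofReal_toReal hu.1.ne]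
  exact (le_iSup (fun j => pmNorm 2 (u t j)) j).trans
    (le_iSup₂ (f := fun t (_ : t ∈ Set.Ici (0 : ℝ)) => vecNorm 2 (u t)) t ht)

theorem MemCw.isFun {u : ℝ → VecDist} (hu : MemCw u) {t : ℝ} (ht : 0 ≤ t) (j : Fin 3) :
    IsFun (hat (u t j)) (hatFun (u t j)) :=
  (hu.exists_bound.choose_spec.2 t ht j).1

theorem MemCw.supNorm_lt_top {u : ℝ → VecDist} (hu : MemCw u) : supNorm u < ⊤ :=
  (biSup_mono fun _ h => Set.mem_Ici.2 (le_of_lt h)).trans_lt hu.1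

theorem MemCw.sub {u v : ℝ → VecDist} (hu : MemCw u) (hv : MemCw v) :
    MemCw (fun t => u t - v t) := by
  refine ⟨lt_of_le_of_lt ?_ (ENNReal.add_lt_top.2 ⟨hu.1, hv.1⟩), fun j φ => ?_⟩
  · refine iSup₂_le fun t ht => (vecNorm_sub_le _ _).trans (add_le_add ?_ ?_)
    · exact le_iSup₂ (f := fun t (_ : t ∈ Set.Ici (0 : ℝ)) => vecNorm 2 (u t)) t ht
    · exact le_iSup₂ (f := fun t (_ : t ∈ Set.Ici (0 : ℝ)) => vecNorm 2 (v t)) t ht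
  · exact (hu.2 j φ).sub (hv.2 j φ)

theorem vecNorm_le_supNorm (u : ℝ → VecDist) {t : ℝ} (ht : 0 < t) : vecNorm 2 (u t) ≤ supNorm u :=
  le_iSup₂ (f := fun t (_ : t ∈ Set.Ioi (0 : ℝ)) => vecNorm 2 (u t)) t ht

theorem MemCw.ae_le_supNorm {u : ℝ → VecDist} (hu : MemCw u) {t : ℝ} (ht : 0 < t) (j : Fin 3) :
    ∀ᵐ ξ : E3, ‖hatFun (u t j) ξ‖ ≤ (supNorm u).toReal * (‖ξ‖ ^ 2)⁻¹ := by
  refine ((pmNorm_le_iff ENNReal.toReal_nonneg).1 ?_).2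
  rw [ENNReal.ofReal_toReal hu.supNorm_lt_top.ne]
  exact (le_iSup (fun j => pmNorm 2 (u t j)) j).trans (vecNorm_le_supNorm u ht)

/-! ### The quadratic term -/

theorem abs_apply_le (ξ : E3) (i : Fin 3) : |ξ i| ≤ ‖ξ‖ := by
  simpa using PiLp.norm_apply_le ξ i

theorem abs_leray_le (ξ : E3) (j k : Fin 3) : |leray ξ j k| ≤ 2 := by
  have h : |ξ j * ξ k / ‖ξ‖ ^ 2| ≤ 1 := by
    rw [abs_div, abs_mul, abs_of_nonneg (sq_nonneg ‖ξ‖)]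
    refine div_le_one_of_le₀ ?_ (sq_nonneg _)
    rw [sq]
    gcongr
    · exact abs_apply_le ξ j
    · exact abs_apply_le ξ k
  have h' : |(if j = k then (1 : ℝ) else 0)| ≤ 1 := by split_ifs <;> simp
  exact (abs_sub _ _).trans (by linarith)

/-- `(2π)⁻³ f_l ∗ g_k`, the Fourier transform of `u_l v_k` for `f = û` and `g = v̂`. -/
@[irreducible]
def convHat (f g : Fin 3 → E3 → ℂ) (l k : Fin 3) (ξ : E3) : ℂ :=
  ((2 * Real.pi) ^ 3 : ℝ)⁻¹ * ∫ η, f l (ξ - η) * g k η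

/-- The Fourier symbol of `-ℙ ∇·(u ⊗ v)` in terms of `f = û` and `g = v̂`. -/
@[irreducible]
def quadHat (f g : Fin 3 → E3 → ℂ) (j : Fin 3) (ξ : E3) : ℂ :=
  ∑ k, (leray ξ j k : ℂ) * ∑ l, Complex.I * (ξ l : ℂ) * convHat f g l k ξ

/-- `B(u,v)` in terms of the Fourier transforms `F = û` and `G = v̂`. -/
def bil (F G : ℝ → Fin 3 → E3 → ℂ) (t : ℝ) (j : Fin 3) (ξ : E3) : ℂ :=
  ∫ τ in (0 : ℝ)..t, (Real.exp (-(t - τ) * ‖ξ‖ ^ 2) : ℂ) * quadHat (F τ) (G τ) j ξ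

theorem tensorHat_eq_convHat (u v : VecDist) :
    tensorHat u v = convHat (fun j => hatFun (u j)) (fun j => hatFun (v j)) := by
  funext l k ξ
  rw [convHat, tensorHat]

theorem bilinHat_eq_bil (u v : ℝ → VecDist) :
    bilinHat u v = bil (fun t j => hatFun (u t j)) (fun t j => hatFun (v t j)) := by
  funext t j ξ
  simp only [bilinHat, bil, quadHat, tensorHat_eq_convHat]

theorem ae_comp_sub_left {p : E3 → Prop} (h : ∀ᵐ η : E3, p η) (ξ : E3) : ∀ᵐ η : E3, p (ξ - η) :=
  (Measure.measurePreserving_sub_left (volume : Measure E3) ξ).quasiMeasurePreserving.ae h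

theorem norm_conv_integrand_le {f g : E3 → ℂ} {M N : ℝ} (hM : 0 ≤ M)
    (hf : ∀ᵐ ξ : E3, ‖f ξ‖ ≤ M * (‖ξ‖ ^ 2)⁻¹) (hg : ∀ᵐ ξ : E3, ‖g ξ‖ ≤ N * (‖ξ‖ ^ 2)⁻¹)
    (ξ : E3) : ∀ᵐ η : E3, ‖f (ξ - η) * g η‖ ≤ M * N * ((‖ξ - η‖ ^ 2)⁻¹ * (‖η‖ ^ 2)⁻¹) := by
  filter_upwards [ae_comp_sub_left hf ξ, hg] with η h1 h2
  rw [norm_mul]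
  calc ‖f (ξ - η)‖ * ‖g η‖ ≤ (M * (‖ξ - η‖ ^ 2)⁻¹) * (N * (‖η‖ ^ 2)⁻¹) := by gcongr
    _ = _ := by ring

theorem norm_conv_le {f g : E3 → ℂ} {M N : ℝ} (hM : 0 ≤ M) (hN : 0 ≤ N)
    (hf : ∀ᵐ ξ : E3, ‖f ξ‖ ≤ M * (‖ξ‖ ^ 2)⁻¹) (hg : ∀ᵐ ξ : E3, ‖g ξ‖ ≤ N * (‖ξ‖ ^ 2)⁻¹)
    {ξ : E3} (hξ : ξ ≠ 0) : ‖∫ η, f (ξ - η) * g η‖ ≤ M * N * (convConst * ‖ξ‖⁻¹) := by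
  obtain ⟨i, e⟩ := integrable_conv_inv_sq hξ
  calc ‖∫ η, f (ξ - η) * g η‖ ≤ ∫ η : E3, M * N * ((‖ξ - η‖ ^ 2)⁻¹ * (‖η‖ ^ 2)⁻¹) :=
        norm_integral_le_of_norm_le (i.const_mul _) (norm_conv_integrand_le hM hf hg ξ)
    _ = M * N * ∫ η : E3, (‖ξ - η‖ ^ 2)⁻¹ * (‖η‖ ^ 2)⁻¹ := integral_const_mul _ _
    _ ≤ _ := by gcongr

theorem integrable_conv {f g : E3 → ℂ} {M N : ℝ} (hM : 0 ≤ M)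
    (mf : AEStronglyMeasurable f volume) (mg : AEStronglyMeasurable g volume)
    (hf : ∀ᵐ ξ : E3, ‖f ξ‖ ≤ M * (‖ξ‖ ^ 2)⁻¹) (hg : ∀ᵐ ξ : E3, ‖g ξ‖ ≤ N * (‖ξ‖ ^ 2)⁻¹)
    {ξ : E3} (hξ : ξ ≠ 0) : Integrable (fun η => f (ξ - η) * g η) volume := by
  refine ((integrable_conv_inv_sq hξ).1.const_mul (M * N)).mono' ?_
    (norm_conv_integrand_le hM hf hg ξ)
  exact (mf.comp_measurePreserving (Measure.measurePreserving_sub_left volume ξ)).mul mg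

/-- The constant in the bilinear estimate. -/
def quadConst : ℝ := 18 * ((2 * Real.pi) ^ 3)⁻¹ * convConst

theorem quadConst_nonneg : 0 ≤ quadConst := by
  have := convConst_nonneg
  have := Real.pi_pos
  unfold quadConst
  positivity

theorem norm_convHat_le {f g : Fin 3 → E3 → ℂ} {M N : ℝ} (hM : 0 ≤ M) (hN : 0 ≤ N)
    (hf : ∀ l, ∀ᵐ ξ : E3, ‖f l ξ‖ ≤ M * (‖ξ‖ ^ 2)⁻¹)
    (hg : ∀ k, ∀ᵐ ξ : E3, ‖g k ξ‖ ≤ N * (‖ξ‖ ^ 2)⁻¹) (l k : Fin 3) {ξ : E3} (hξ : ξ ≠ 0) :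
    ‖convHat f g l k ξ‖ ≤ ((2 * Real.pi) ^ 3)⁻¹ * (M * N * (convConst * ‖ξ‖⁻¹)) := by
  have hp : 0 ≤ (2 * Real.pi) ^ 3 := by have := Real.pi_pos; positivity
  have h := norm_conv_le hM hN (hf l) (hg k) hξ
  rw [convHat, norm_mul]
  generalize (2 * Real.pi) ^ 3 = w at hp ⊢
  rw [Complex.norm_real, Real.norm_of_nonneg (inv_nonneg.2 hp)]
  gcongr

theorem norm_quadHat_le {f g : Fin 3 → E3 → ℂ} {M N : ℝ} (hM : 0 ≤ M) (hN : 0 ≤ N)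
    (hf : ∀ l, ∀ᵐ ξ : E3, ‖f l ξ‖ ≤ M * (‖ξ‖ ^ 2)⁻¹)
    (hg : ∀ k, ∀ᵐ ξ : E3, ‖g k ξ‖ ≤ N * (‖ξ‖ ^ 2)⁻¹) (j : Fin 3) (ξ : E3) :
    ‖quadHat f g j ξ‖ ≤ quadConst * M * N := by
  rcases eq_or_ne ξ 0 with rfl | hξ
  · have := quadConst_nonneg
    simp only [quadHat, PiLp.zero_apply, Complex.ofReal_zero, mul_zero, zero_mul,
      Finset.sum_const_zero, norm_zero]
    positivity
  have hr : 0 < ‖ξ‖ := norm_pos_iff.2 hξ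
  have h1 : ∀ k l, ‖Complex.I * (ξ l : ℂ) * convHat f g l k ξ‖ ≤
      ((2 * Real.pi) ^ 3)⁻¹ * convConst * (M * N) := fun k l => by
    have e1 := abs_apply_le ξ l
    have e2 := norm_convHat_le hM hN hf hg l k hξ
    rw [norm_mul, norm_mul, Complex.norm_I, one_mul, Complex.norm_real, Real.norm_eq_abs]
    calc |ξ l| * ‖convHat f g l k ξ‖
        ≤ ‖ξ‖ * (((2 * Real.pi) ^ 3)⁻¹ * (M * N * (convConst * ‖ξ‖⁻¹))) := by gcongr
      _ = _ := by
        generalize (2 * Real.pi) ^ 3 = w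
        field_simp
  have h2 : ∀ k, ‖(leray ξ j k : ℂ) * ∑ l, Complex.I * (ξ l : ℂ) * convHat f g l k ξ‖ ≤
      2 * (3 * (((2 * Real.pi) ^ 3)⁻¹ * convConst * (M * N))) := fun k => by
    rw [norm_mul, Complex.norm_real]
    refine mul_le_mul (abs_leray_le ξ j k) ?_ (norm_nonneg _) zero_le_two
    refine (norm_sum_le_of_le _ (fun l _ => h1 k l)).trans (le_of_eq ?_)
    simp
  rw [quadHat]
  refine (norm_sum_le_of_le _ (fun k _ => h2 k)).trans (le_of_eq ?_)
  simp only [Finset.sum_const, Finset.card_univ, Fintype.card_fin, quadConst, nsmul_eq_mul]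
  push_cast
  ring

theorem quadHat_congr {f f' g g' : Fin 3 → E3 → ℂ} (hf : ∀ l, f l =ᵐ[volume] f' l)
    (hg : ∀ k, g k =ᵐ[volume] g' k) (j : Fin 3) (ξ : E3) :
    quadHat f g j ξ = quadHat f' g' j ξ := by
  have : ∀ l k, convHat f g l k ξ = convHat f' g' l k ξ := fun l k => by
    rw [convHat, convHat]
    congr 1
    refine integral_congr_ae ?_
    filter_upwards [ae_comp_sub_left (hf l) ξ, hg k] with η h1 h2
    rw [h1, h2]
  simp only [quadHat, this]

/-! ### Duhamel integrals -/

theorem duhamel_kernel_integral {a t : ℝ} (ha : 0 < a) :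
    ∫ τ in (0 : ℝ)..t, Real.exp (-(t - τ) * a) = (1 - Real.exp (-t * a)) * a⁻¹ := by
  have h : ∀ τ ∈ Set.uIcc 0 t, HasDerivAt (fun τ : ℝ => Real.exp (-(t - τ) * a) * a⁻¹)
      (Real.exp (-(t - τ) * a)) τ := fun τ _ => by
    have h1 : HasDerivAt (fun τ : ℝ => -(t - τ) * a) a τ := by
      have := (((hasDerivAt_id τ).const_sub t).neg).mul_const a
      simpa using this
    convert! h1.exp.mul_const a⁻¹ using 1
    field_simp
  rw [intervalIntegral.integral_eq_sub_of_hasDerivAt h]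
  · simp
    ring
  · exact (by fun_prop : Continuous fun τ : ℝ => Real.exp (-(t - τ) * a)).intervalIntegrable _ _

theorem norm_duhamel_le {h : ℝ → ℂ} {t A : ℝ} (ht : 0 ≤ t) (hA : 0 ≤ A)
    (hh : ∀ τ ∈ Set.Ioc 0 t, ‖h τ‖ ≤ A) {ξ : E3} (hξ : ξ ≠ 0) :
    ‖∫ τ in (0 : ℝ)..t, (Real.exp (-(t - τ) * ‖ξ‖ ^ 2) : ℂ) * h τ‖ ≤ A * (‖ξ‖ ^ 2)⁻¹ := by
  have hr : 0 < ‖ξ‖ := norm_pos_iff.2 hξ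
  calc _ ≤ ∫ τ in (0 : ℝ)..t, Real.exp (-(t - τ) * ‖ξ‖ ^ 2) * A := by
        refine intervalIntegral.norm_integral_le_of_norm_le ht
          (Filter.Eventually.of_forall fun τ hτ => ?_)
          ((by fun_prop : Continuous fun τ : ℝ =>
            Real.exp (-(t - τ) * ‖ξ‖ ^ 2) * A).intervalIntegrable _ _)
        rw [norm_mul, Complex.norm_real, Real.norm_of_nonneg (Real.exp_pos _).le]
        gcongr
        exact hh τ hτ
    _ = (1 - Real.exp (-t * ‖ξ‖ ^ 2)) * (‖ξ‖ ^ 2)⁻¹ * A := by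
        rw [intervalIntegral.integral_mul_const, duhamel_kernel_integral (by positivity)]
    _ ≤ 1 * (‖ξ‖ ^ 2)⁻¹ * A := by
        gcongr
        linarith [Real.exp_pos (-t * ‖ξ‖ ^ 2)]
    _ = _ := by ring

theorem intervalIntegrable_of_bounded {h : ℝ → ℂ} (hm : Measurable h) {A : ℝ}
    (hh : ∀ τ, ‖h τ‖ ≤ A) (a b : ℝ) : IntervalIntegrable h volume a b :=
  (intervalIntegrable_const (c := A)).mono_fun' hm.aestronglyMeasurable
    (Filter.Eventually.of_forall hh)

theorem IntervalIntegrable.exp_mul {h : ℝ → ℂ} {a b : ℝ} (hh : IntervalIntegrable h volume a b)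
    (t r : ℝ) : IntervalIntegrable (fun τ => (Real.exp (-(t - τ) * r) : ℂ) * h τ) volume a b :=
  hh.continuousOn_mul (by fun_prop : Continuous fun τ : ℝ =>
    (Real.exp (-(t - τ) * r) : ℂ)).continuousOn

theorem continuous_duhamel {h : ℝ → ℂ} (hh : ∀ a b, IntervalIntegrable h volume a b) (r : ℝ) :
    Continuous fun t => ∫ τ in (0 : ℝ)..t, (Real.exp (-(t - τ) * r) : ℂ) * h τ := by
  have e : (fun t => ∫ τ in (0 : ℝ)..t, (Real.exp (-(t - τ) * r) : ℂ) * h τ) =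
      fun t => (Real.exp (-t * r) : ℂ) * ∫ τ in (0 : ℝ)..t, (Real.exp (τ * r) : ℂ) * h τ := by
    ext t
    rw [← intervalIntegral.integral_const_mul]
    congr 1
    ext τ
    rw [← mul_assoc, ← Complex.ofReal_mul, ← Real.exp_add]
    ring_nf
  rw [e]
  refine Continuous.mul (by fun_prop) (intervalIntegral.continuous_primitive (fun a b => ?_) 0)
  exact (hh a b).continuousOn_mul (by fun_prop : Continuous fun τ : ℝ =>
    (Real.exp (τ * r) : ℂ)).continuousOn

/-! ### The bilinear estimate -/

theorem bil_zero_right (F G : ℝ → Fin 3 → E3 → ℂ) (t : ℝ) (j : Fin 3) : bil F G t j 0 = 0 := by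
  simp [bil, quadHat]

theorem norm_bil_le {F G : ℝ → Fin 3 → E3 → ℂ} {M N t : ℝ} (hM : 0 ≤ M) (hN : 0 ≤ N)
    (ht : 0 ≤ t) (hF : ∀ τ ∈ Set.Ioc 0 t, ∀ l, ∀ᵐ ξ : E3, ‖F τ l ξ‖ ≤ M * (‖ξ‖ ^ 2)⁻¹)
    (hG : ∀ τ ∈ Set.Ioc 0 t, ∀ l, ∀ᵐ ξ : E3, ‖G τ l ξ‖ ≤ N * (‖ξ‖ ^ 2)⁻¹) (j : Fin 3) (ξ : E3) :
    ‖bil F G t j ξ‖ ≤ quadConst * M * N * (‖ξ‖ ^ 2)⁻¹ := by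
  have := quadConst_nonneg
  rcases eq_or_ne ξ 0 with rfl | hξ
  · simp [bil_zero_right]
  · exact norm_duhamel_le ht (by positivity)
      (fun τ hτ => norm_quadHat_le hM hN (hF τ hτ) (hG τ hτ) j ξ) hξ

theorem bil_congr {F F' G G' : ℝ → Fin 3 → E3 → ℂ} {t : ℝ} (ht : 0 ≤ t)
    (hF : ∀ τ ∈ Set.Ioc 0 t, ∀ l, F τ l =ᵐ[volume] F' τ l)
    (hG : ∀ τ ∈ Set.Ioc 0 t, ∀ l, G τ l =ᵐ[volume] G' τ l) (j : Fin 3) (ξ : E3) :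
    bil F G t j ξ = bil F' G' t j ξ := by
  refine intervalIntegral.integral_congr_ae (Filter.Eventually.of_forall fun τ hτ => ?_)
  rw [Set.uIoc_of_le ht] at hτ
  rw [quadHat_congr (hF τ hτ) (hG τ hτ)]

theorem exists_isBilinearConstant : ∃ η : ℝ, IsBilinearConstant η := by
  have hq := quadConst_nonneg
  refine ⟨quadConst + 1, by positivity, fun u v hu hv t ht j => ?_⟩
  have h : weightedSup 2 (bilinHat u v t j) ≤
      ENNReal.ofReal (quadConst * (supNorm u).toReal * (supNorm v).toReal) := by
    refine (weightedSup_le_iff (by positivity)).2 (Filter.Eventually.of_forall fun ξ => ?_)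
    rw [bilinHat_eq_bil]
    exact norm_bil_le ENNReal.toReal_nonneg ENNReal.toReal_nonneg ht.le
      (fun τ hτ l => hu.ae_le_supNorm hτ.1 l) (fun τ hτ l => hv.ae_le_supNorm hτ.1 l) j ξ
  refine h.trans ?_
  rw [ENNReal.ofReal_mul (by positivity), ENNReal.ofReal_mul hq,
    ENNReal.ofReal_toReal hu.supNorm_lt_top.ne, ENNReal.ofReal_toReal hv.supNorm_lt_top.ne]
  gcongr
  linarith

/-! ### Jointly measurable families -/

/-- A family `F t` of triples of functions of size `M ‖ξ‖⁻²`, jointly measurable in `(t, ξ)`. -/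
structure IsAdm (M : ℝ) (F : ℝ → Fin 3 → E3 → ℂ) : Prop where
  measurable : ∀ j, Measurable fun p : ℝ × E3 => F p.1 j p.2
  bound : ∀ t j ξ, ‖F t j ξ‖ ≤ M * (‖ξ‖ ^ 2)⁻¹

theorem IsAdm.measurable_slice {M : ℝ} {F : ℝ → Fin 3 → E3 → ℂ} (hF : IsAdm M F) (t : ℝ)
    (j : Fin 3) : Measurable (F t j) :=
  (hF.measurable j).comp (by fun_prop : Measurable fun ξ : E3 => (t, ξ))

theorem IsAdm.nonneg {M : ℝ} {F : ℝ → Fin 3 → E3 → ℂ} (hF : IsAdm M F) : 0 ≤ M := by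
  have h := (norm_nonneg _).trans (hF.bound 0 0 (EuclideanSpace.single 0 1))
  simpa using h

theorem IsAdm.measurable_convHat {M N : ℝ} {F G : ℝ → Fin 3 → E3 → ℂ} (hF : IsAdm M F)
    (hG : IsAdm N G) (l k : Fin 3) :
    Measurable fun p : ℝ × E3 => convHat (F p.1) (G p.1) l k p.2 := by
  have h : Measurable fun q : (ℝ × E3) × E3 => F q.1.1 l (q.1.2 - q.2) * G q.1.1 k q.2 :=
    ((hF.measurable l).comp (by fun_prop : Measurable fun q : (ℝ × E3) × E3 =>
      (q.1.1, q.1.2 - q.2))).mul ((hG.measurable k).comp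
        (by fun_prop : Measurable fun q : (ℝ × E3) × E3 => (q.1.1, q.2)))
  simp only [convHat]
  exact (h.stronglyMeasurable.integral_prod_right
    (ν := (volume : Measure E3))).measurable.const_mul _

theorem measurable_leray (j k : Fin 3) : Measurable fun ξ : E3 => leray ξ j k := by
  unfold leray
  fun_prop

theorem IsAdm.measurable_quadHat {M N : ℝ} {F G : ℝ → Fin 3 → E3 → ℂ} (hF : IsAdm M F)
    (hG : IsAdm N G) (j : Fin 3) :
    Measurable fun p : ℝ × E3 => quadHat (F p.1) (G p.1) j p.2 := by
  simp only [quadHat]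
  refine Finset.measurable_sum _ fun k _ => Measurable.mul ?_
    (Finset.measurable_sum _ fun l _ => ?_)
  · exact Complex.measurable_ofReal.comp ((measurable_leray j k).comp measurable_snd)
  · exact Measurable.mul (by fun_prop) (hF.measurable_convHat hG l k)

theorem IsAdm.norm_quadHat_le {M N : ℝ} {F G : ℝ → Fin 3 → E3 → ℂ} (hF : IsAdm M F)
    (hG : IsAdm N G) (τ : ℝ) (j : Fin 3) (ξ : E3) :
    ‖quadHat (F τ) (G τ) j ξ‖ ≤ quadConst * M * N :=
  SingularNS.norm_quadHat_le hF.nonneg hG.nonneg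
    (fun l => Filter.Eventually.of_forall (hF.bound τ l))
    (fun l => Filter.Eventually.of_forall (hG.bound τ l)) j ξ

theorem IsAdm.intervalIntegrable_quadHat {M N : ℝ} {F G : ℝ → Fin 3 → E3 → ℂ} (hF : IsAdm M F)
    (hG : IsAdm N G) (j : Fin 3) (ξ : E3) (a b : ℝ) :
    IntervalIntegrable (fun τ => quadHat (F τ) (G τ) j ξ) volume a b :=
  intervalIntegrable_of_bounded ((hF.measurable_quadHat hG j).comp
    (by fun_prop : Measurable fun τ : ℝ => (τ, ξ))) (fun τ => hF.norm_quadHat_le hG τ j ξ) a b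

theorem IsAdm.continuous_bil {M N : ℝ} {F G : ℝ → Fin 3 → E3 → ℂ} (hF : IsAdm M F)
    (hG : IsAdm N G) (j : Fin 3) (ξ : E3) : Continuous fun t => bil F G t j ξ :=
  continuous_duhamel (hF.intervalIntegrable_quadHat hG j ξ) _

theorem IsAdm.measurable_bil {M N : ℝ} {F G : ℝ → Fin 3 → E3 → ℂ} (hF : IsAdm M F)
    (hG : IsAdm N G) (j : Fin 3) : Measurable fun p : ℝ × E3 => bil F G p.1 j p.2 := by
  refine measurable_uncurry_of_continuous_of_measurable (u := fun t ξ => bil F G t j ξ)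
    (fun ξ => hF.continuous_bil hG j ξ) fun t => ?_
  have h0 : Measurable fun q : E3 × ℝ => quadHat (F q.2) (G q.2) j q.1 :=
    (hF.measurable_quadHat hG j).comp (measurable_snd.prodMk measurable_fst)
  have h : Measurable fun q : E3 × ℝ =>
      (Real.exp (-(t - q.2) * ‖q.1‖ ^ 2) : ℂ) * quadHat (F q.2) (G q.2) j q.1 :=
    (by fun_prop : Measurable fun q : E3 × ℝ => (Real.exp (-(t - q.2) * ‖q.1‖ ^ 2) : ℂ)).mul h0
  unfold bil
  simp only [intervalIntegral]
  exact (h.stronglyMeasurable.integral_prod_right).measurable.sub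
    (h.stronglyMeasurable.integral_prod_right).measurable

theorem IsAdm.bound_bil {M N : ℝ} {F G : ℝ → Fin 3 → E3 → ℂ} (hF : IsAdm M F)
    (hG : IsAdm N G) {t : ℝ} (ht : 0 ≤ t) (j : Fin 3) (ξ : E3) :
    ‖bil F G t j ξ‖ ≤ quadConst * M * N * (‖ξ‖ ^ 2)⁻¹ :=
  norm_bil_le hF.nonneg hG.nonneg ht
    (fun τ _ l => Filter.Eventually.of_forall (hF.bound τ l))
    (fun τ _ l => Filter.Eventually.of_forall (hG.bound τ l)) j ξ

theorem IsAdm.sub {M N : ℝ} {F G : ℝ → Fin 3 → E3 → ℂ} (hF : IsAdm M F) (hG : IsAdm N G) :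
    IsAdm (M + N) (fun t j ξ => F t j ξ - G t j ξ) :=
  ⟨fun j => (hF.measurable j).sub (hG.measurable j), fun t j ξ =>
    (norm_sub_le _ _).trans (by rw [add_mul]; exact add_le_add (hF.bound t j ξ) (hG.bound t j ξ))⟩

theorem IsAdm.quadHat_sub_left {M M' N : ℝ} {F F' G : ℝ → Fin 3 → E3 → ℂ} (hF : IsAdm M F)
    (hF' : IsAdm M' F') (hG : IsAdm N G) (τ : ℝ) (j : Fin 3) (ξ : E3) :
    quadHat (fun l ξ => F τ l ξ - F' τ l ξ) (G τ) j ξ =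
      quadHat (F τ) (G τ) j ξ - quadHat (F' τ) (G τ) j ξ := by
  rcases eq_or_ne ξ 0 with rfl | hξ
  · simp [quadHat]
  have h : ∀ l k, convHat (fun l ξ => F τ l ξ - F' τ l ξ) (G τ) l k ξ =
      convHat (F τ) (G τ) l k ξ - convHat (F' τ) (G τ) l k ξ := fun l k => by
    simp only [convHat]
    rw [← mul_sub, ← integral_sub]
    · simp_rw [sub_mul]
    · exact integrable_conv hF.nonneg (hF.measurable_slice τ l).aestronglyMeasurable
        (hG.measurable_slice τ k).aestronglyMeasurable
        (Filter.Eventually.of_forall (hF.bound τ l))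
        (Filter.Eventually.of_forall (hG.bound τ k)) hξ
    · exact integrable_conv hF'.nonneg (hF'.measurable_slice τ l).aestronglyMeasurable
        (hG.measurable_slice τ k).aestronglyMeasurable
        (Filter.Eventually.of_forall (hF'.bound τ l))
        (Filter.Eventually.of_forall (hG.bound τ k)) hξ
  simp only [quadHat, h, mul_sub, Finset.sum_sub_distrib]

theorem IsAdm.quadHat_sub_right {M N N' : ℝ} {F G G' : ℝ → Fin 3 → E3 → ℂ} (hF : IsAdm M F)
    (hG : IsAdm N G) (hG' : IsAdm N' G') (τ : ℝ) (j : Fin 3) (ξ : E3) :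
    quadHat (F τ) (fun l ξ => G τ l ξ - G' τ l ξ) j ξ =
      quadHat (F τ) (G τ) j ξ - quadHat (F τ) (G' τ) j ξ := by
  rcases eq_or_ne ξ 0 with rfl | hξ
  · simp [quadHat]
  have h : ∀ l k, convHat (F τ) (fun l ξ => G τ l ξ - G' τ l ξ) l k ξ =
      convHat (F τ) (G τ) l k ξ - convHat (F τ) (G' τ) l k ξ := fun l k => by
    simp only [convHat]
    rw [← mul_sub, ← integral_sub]
    · simp_rw [mul_sub (F τ _ _)]
    · exact integrable_conv hF.nonneg (hF.measurable_slice τ l).aestronglyMeasurable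
        (hG.measurable_slice τ k).aestronglyMeasurable
        (Filter.Eventually.of_forall (hF.bound τ l))
        (Filter.Eventually.of_forall (hG.bound τ k)) hξ
    · exact integrable_conv hF.nonneg (hF.measurable_slice τ l).aestronglyMeasurable
        (hG'.measurable_slice τ k).aestronglyMeasurable
        (Filter.Eventually.of_forall (hF.bound τ l))
        (Filter.Eventually.of_forall (hG'.bound τ k)) hξ
  simp only [quadHat, h, mul_sub, Finset.sum_sub_distrib]

theorem IsAdm.bil_sub_left {M M' N : ℝ} {F F' G : ℝ → Fin 3 → E3 → ℂ} (hF : IsAdm M F)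
    (hF' : IsAdm M' F') (hG : IsAdm N G) (t : ℝ) (j : Fin 3) (ξ : E3) :
    bil (fun t j ξ => F t j ξ - F' t j ξ) G t j ξ = bil F G t j ξ - bil F' G t j ξ := by
  unfold bil
  rw [← intervalIntegral.integral_sub ((hF.intervalIntegrable_quadHat hG j ξ 0 t).exp_mul t _)
    ((hF'.intervalIntegrable_quadHat hG j ξ 0 t).exp_mul t _)]
  simp_rw [hF.quadHat_sub_left hF' hG, mul_sub]

theorem IsAdm.bil_sub_right {M N N' : ℝ} {F G G' : ℝ → Fin 3 → E3 → ℂ} (hF : IsAdm M F)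
    (hG : IsAdm N G) (hG' : IsAdm N' G') (t : ℝ) (j : Fin 3) (ξ : E3) :
    bil F (fun t j ξ => G t j ξ - G' t j ξ) t j ξ = bil F G t j ξ - bil F G' t j ξ := by
  unfold bil
  rw [← intervalIntegral.integral_sub ((hF.intervalIntegrable_quadHat hG j ξ 0 t).exp_mul t _)
    ((hF.intervalIntegrable_quadHat hG' j ξ 0 t).exp_mul t _)]
  simp_rw [hF.quadHat_sub_right hG hG', mul_sub]

/-! ### Jointly measurable representatives of weakly continuous families -/

/-- Smooth bumps at the origin with radii `(n + 1)⁻¹`. -/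
def shrinkingBump (n : ℕ) : ContDiffBump (0 : E3) where
  rIn := ((n : ℝ) + 1)⁻¹ / 2
  rOut := ((n : ℝ) + 1)⁻¹
  rIn_pos := by positivity
  rIn_lt_rOut := half_lt_self (by positivity)

/-- The reflected and translated mollifier `x ↦ ρ_n (η - x)`, as a Schwartz function. -/
theorem exists_schwartz_mollifier (n : ℕ) (η : E3) : ∃ ψ : 𝓢(E3, ℂ),
    ∀ x, ψ x = ((shrinkingBump n).normed volume (η - x) : ℂ) := by
  have h1 : HasCompactSupport fun x : E3 => ((shrinkingBump n).normed volume (η - x) : ℂ) :=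
    (((shrinkingBump n).hasCompactSupport_normed (μ := (volume : Measure E3))).comp_homeomorph
      (Homeomorph.subLeft η)).comp_left (g := Complex.ofReal) rfl
  have h2 : ContDiff ℝ (⊤ : ℕ∞) fun x : E3 => ((shrinkingBump n).normed volume (η - x) : ℂ) := by
    have := ((shrinkingBump n).contDiff_normed (μ := (volume : Measure E3)) (n := (⊤ : ℕ∞)))
    exact Complex.ofRealCLM.contDiff.comp (this.comp (contDiff_const.sub contDiff_id))
  exact ⟨h1.toSchwartzMap h2, fun x => rfl⟩

theorem mollify_eq {T : 𝓢'(E3, ℂ)} {f : E3 → ℂ} (hf : IsFun T f) (n : ℕ) (η : E3) :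
    convolution ((shrinkingBump n).normed volume) f (ContinuousLinearMap.lsmul ℝ ℝ) volume η =
      T (exists_schwartz_mollifier n η).choose := by
  rw [(hf.2 _).2, convolution_eq_swap]
  refine integral_congr_ae (Filter.Eventually.of_forall fun x => ?_)
  simp [(exists_schwartz_mollifier n η).choose_spec x]

theorem tendsto_mollify {f : E3 → ℂ} (hf : LocallyIntegrable f volume) :
    ∀ᵐ η : E3, Filter.Tendsto (fun n => convolution ((shrinkingBump n).normed volume) f
      (ContinuousLinearMap.lsmul ℝ ℝ) volume η) Filter.atTop (nhds (f η)) := by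
  refine ContDiffBump.ae_convolution_tendsto_right_of_locallyIntegrable (K := 2) ?_ ?_ hf
  · simpa [shrinkingBump] using tendsto_one_div_add_atTop_nhds_zero_nat (𝕜 := ℝ)
  · refine Filter.Eventually.of_forall fun n => ?_
    simp only [shrinkingBump]
    linarith

/-- The Fourier transforms of a weakly continuous bounded family can be chosen jointly measurable in
time and frequency: they are limits of mollifications, which are continuous in each variable. -/
theorem MemCw.exists_isAdm {u : ℝ → VecDist} (hu : MemCw u) :
    ∃ M F, IsAdm M F ∧ ∀ t ≥ 0, ∀ j, F t j =ᵐ[volume] hatFun (u t j) := by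
  obtain ⟨M, hM, hb⟩ := hu.exists_bound
  have hmax : ∀ t : ℝ, max t 0 ≥ 0 := fun t => le_max_right t 0
  -- `max t 0` extends the family, which matters for `t ≥ 0` only, to all times
  let G : ℕ → Fin 3 → ℝ → E3 → ℂ := fun n j t => convolution ((shrinkingBump n).normed volume)
    (hatFun (u (max t 0) j)) (ContinuousLinearMap.lsmul ℝ ℝ) volume
  have hG : ∀ n j, Measurable (Function.uncurry (G n j)) := fun n j => by
    refine measurable_uncurry_of_continuous_of_measurable (fun η => ?_) fun t => ?_
    · have e : (fun t => G n j t η) = fun t =>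
          u (max t 0) j (hatSchwartz (exists_schwartz_mollifier n η).choose) := by
        ext t
        exact mollify_eq (hb _ (hmax t) j).1 n η
      rw [e]
      exact (hu.2 j _).comp_continuous (by fun_prop) hmax
    · exact ((shrinkingBump n).hasCompactSupport_normed.continuous_convolution_left _
        (shrinkingBump n).continuous_normed (hb _ (hmax t) j).1.1).measurable
  let L : Fin 3 → ℝ × E3 → ℂ := fun j p =>
    Filter.limUnder Filter.atTop (fun n => Function.uncurry (G n j) p)
  have hL : ∀ j, Measurable (L j) := fun j =>
    (StronglyMeasurable.limUnder (l := Filter.atTop)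
      (fun n => (hG n j).stronglyMeasurable)).measurable
  classical
  -- the truncation makes the bound hold everywhere, not only where the mollifications converge
  refine ⟨M, fun t j ξ => if ‖L j (t, ξ)‖ ≤ M * (‖ξ‖ ^ 2)⁻¹ then L j (t, ξ) else 0,
    ⟨fun j => ?_, fun t j ξ => ?_⟩, fun t ht j => ?_⟩
  · refine Measurable.ite (measurableSet_le (hL j).norm (by fun_prop)) (hL j) measurable_const
  · split_ifs with h
    · exact h
    · simp only [norm_zero]
      positivity
  · filter_upwards [(hb t ht j).2, tendsto_mollify (hb t ht j).1.1] with ξ h1 h2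
    have e : L j (t, ξ) = hatFun (u t j) ξ := by
      refine Filter.Tendsto.limUnder_eq ?_
      simpa only [Function.uncurry, G, max_eq_left ht] using h2
    rw [e, if_pos h1]

/-! ### Existence for the forced problem -/

theorem memCw_of_isAdm {u : ℝ → VecDist} {M : ℝ} {F : ℝ → Fin 3 → E3 → ℂ} (hF : IsAdm M F)
    (hc : ∀ j ξ, Continuous fun t => F t j ξ) (h : ∀ t ≥ 0, ∀ j, IsFun (hat (u t j)) (F t j)) :
    MemCw u ∧ ∀ t ≥ 0, vecNorm 2 (u t) ≤ ENNReal.ofReal M := by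
  have hn : ∀ t ≥ 0, vecNorm 2 (u t) ≤ ENNReal.ofReal M := fun t ht =>
    vecNorm_le_iff.2 fun j => by
      rw [pmNorm_eq (h t ht j)]
      exact (weightedSup_le_iff hF.nonneg).2 (Filter.Eventually.of_forall (hF.bound t j))
  refine ⟨⟨(iSup₂_le hn).trans_lt ENNReal.ofReal_lt_top, fun j φ => ?_⟩, hn⟩
  have e : Set.EqOn (fun t => u t j φ) (fun t => ∫ ξ, hatSchwartzInv φ ξ * F t j ξ)
      (Set.Ici 0) := fun t ht => by
    have := ((h t ht j).2 (hatSchwartzInv φ)).2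
    rwa [hat_apply, hatSchwartz_hatSchwartzInv] at this
  refine ContinuousOn.congr (Continuous.continuousOn ?_) e
  refine continuous_of_dominated
    (bound := fun ξ => M * ((‖ξ‖ ^ 2)⁻¹ * ‖hatSchwartzInv φ ξ‖)) (fun t => ?_) (fun t => ?_)
    ((integrable_inv_sq_mul_norm_schwartz _).const_mul M) ?_
  · exact (hatSchwartzInv φ).continuous.aestronglyMeasurable.mul
      (hF.measurable_slice t j).aestronglyMeasurable
  · refine Filter.Eventually.of_forall fun ξ => ?_
    rw [norm_mul, mul_comm, ← mul_assoc]
    gcongr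
    exact hF.bound t j ξ
  · exact Filter.Eventually.of_forall fun ξ => continuous_const.mul (hc j ξ)

theorem exists_memCw_of_isAdm {M : ℝ} {F : ℝ → Fin 3 → E3 → ℂ} (hF : IsAdm M F)
    (hc : ∀ j ξ, Continuous fun t => F t j ξ) :
    ∃ u : ℝ → VecDist, MemCw u ∧ supNorm u ≤ ENNReal.ofReal M ∧
      ∀ t j, hatFun (u t j) =ᵐ[volume] F t j := by
  have h : ∀ t j, ∃ v : 𝓢'(E3, ℂ), IsFun (hat v) (F t j) := fun t j => by
    obtain ⟨T, hT⟩ := exists_isFun_of_le_inv_sq (hF.measurable_slice t j).aestronglyMeasurable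
      (Filter.Eventually.of_forall (hF.bound t j))
    obtain ⟨v, hv⟩ := exists_hat_eq T
    exact ⟨v, hv ▸ hT⟩
  choose u hu using h
  obtain ⟨h1, h2⟩ := memCw_of_isAdm hF hc (u := u) fun t _ j => hu t j
  exact ⟨u, h1, iSup₂_le fun t ht => h2 t (le_of_lt ht), fun t j => hatFun_ae_eq (hu t j)⟩

theorem IsAdm.norm_bil_self_sub_le {M a : ℝ} {F G : ℝ → Fin 3 → E3 → ℂ} (hF : IsAdm M F)
    (hG : IsAdm M G) (ha : ∀ t j ξ, ‖F t j ξ - G t j ξ‖ ≤ a * (‖ξ‖ ^ 2)⁻¹) {t : ℝ} (ht : 0 ≤ t)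
    (j : Fin 3) (ξ : E3) :
    ‖bil F F t j ξ - bil G G t j ξ‖ ≤ 2 * quadConst * M * a * (‖ξ‖ ^ 2)⁻¹ := by
  have hD : IsAdm a (fun t j ξ => F t j ξ - G t j ξ) := ⟨(hF.sub hG).measurable, ha⟩
  have e : bil F F t j ξ - bil G G t j ξ = bil F (fun t j ξ => F t j ξ - G t j ξ) t j ξ +
      bil (fun t j ξ => F t j ξ - G t j ξ) G t j ξ := by
    rw [hF.bil_sub_right hF hG, hF.bil_sub_left hG hG]
    ring
  rw [e]
  refine (norm_add_le _ _).trans ?_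
  have h1 := hF.bound_bil hD ht j ξ
  have h2 := hD.bound_bil hG ht j ξ
  calc _ ≤ _ := add_le_add h1 h2
    _ = _ := by ring

/-- The equation `F = B(F,F) + Y` has a solution of size `2m` when the datum `Y` has size `m` and
`m` is small. It is the limit of the Picard iterates starting from `0`. -/
theorem exists_fixedPoint {m : ℝ} {Y : ℝ → Fin 3 → E3 → ℂ} (hY : IsAdm m Y)
    (hYc : ∀ j ξ, Continuous fun t => Y t j ξ) (hm : 8 * quadConst * m ≤ 1) :
    ∃ F, IsAdm (2 * m) F ∧ (∀ j ξ, Continuous fun t => F t j ξ) ∧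
      ∀ t ≥ 0, ∀ j ξ, F t j ξ = bil F F t j ξ + Y t j ξ := by
  have hm0 := hY.nonneg
  have hq := quadConst_nonneg
  let Φ : (ℝ → Fin 3 → E3 → ℂ) → ℝ → Fin 3 → E3 → ℂ := fun F t j ξ =>
    bil F F (max t 0) j ξ + Y (max t 0) j ξ
  have hmax : ∀ t : ℝ, 0 ≤ max t 0 := fun t => le_max_right t 0
  have hmm : Measurable fun p : ℝ × E3 => (max p.1 0, p.2) := by fun_prop
  have hΦ : ∀ F, IsAdm (2 * m) F → IsAdm (2 * m) (Φ F) := fun F hF => by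
    refine ⟨fun j => ((hF.measurable_bil hF j).comp hmm).add ((hY.measurable j).comp hmm),
      fun t j ξ => ?_⟩
    refine (norm_add_le _ _).trans ?_
    have h1 := hF.bound_bil hF (hmax t) j ξ
    have h2 := hY.bound (max t 0) j ξ
    have h3 : quadConst * (2 * m) * (2 * m) + m ≤ 2 * m := by nlinarith
    calc _ ≤ _ := add_le_add h1 h2
      _ = (quadConst * (2 * m) * (2 * m) + m) * (‖ξ‖ ^ 2)⁻¹ := by ring
      _ ≤ _ := by gcongr
  have hdiff : ∀ F G a, IsAdm (2 * m) F → IsAdm (2 * m) G → 0 ≤ a →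
      (∀ t j ξ, ‖F t j ξ - G t j ξ‖ ≤ a * (‖ξ‖ ^ 2)⁻¹) →
      ∀ t j ξ, ‖Φ F t j ξ - Φ G t j ξ‖ ≤ a / 2 * (‖ξ‖ ^ 2)⁻¹ := fun F G a hF hG ha hd t j ξ => by
    simp only [Φ, add_sub_add_right_eq_sub]
    refine (hF.norm_bil_self_sub_le hG hd (hmax t) j ξ).trans ?_
    gcongr
    nlinarith
  let f : ℕ → ℝ → Fin 3 → E3 → ℂ := fun n => Φ^[n] (fun _ _ _ => 0)
  have hfs : ∀ n, f (n + 1) = Φ (f n) := fun n => Function.iterate_succ_apply' Φ n _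
  have hf : ∀ n, IsAdm (2 * m) (f n) := fun n => by
    induction n with
    | zero =>
      refine ⟨fun j => measurable_const, fun t j ξ => ?_⟩
      simp only [f, Function.iterate_zero, id, norm_zero]
      positivity
    | succ n ih => rw [hfs]; exact hΦ _ ih
  have hstep : ∀ n t j ξ, ‖f (n + 1) t j ξ - f n t j ξ‖ ≤ 2 * m * (1 / 2) ^ n * (‖ξ‖ ^ 2)⁻¹ :=
    fun n => by
    induction n with
    | zero =>
      intro t j ξ
      have := (hf 1).bound t j ξ
      simpa [f] using this
    | succ n ih =>
      intro t j ξ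
      have := hdiff _ _ _ (hf (n + 1)) (hf n) (by positivity) ih t j ξ
      rw [hfs (n + 1), hfs n] at *
      refine this.trans (le_of_eq ?_)
      rw [pow_succ]
      ring
  have hdist : ∀ t j ξ n, dist (f n t j ξ) (f (n + 1) t j ξ) ≤
      2 * m * (‖ξ‖ ^ 2)⁻¹ * (1 / 2) ^ n := fun t j ξ n => by
    rw [dist_comm, dist_eq_norm]
    refine (hstep n t j ξ).trans (le_of_eq ?_)
    ring
  have hlim : ∀ t j ξ, ∃ z, Filter.Tendsto (fun n => f n t j ξ) Filter.atTop (nhds z) :=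
    fun t j ξ => cauchySeq_tendsto_of_complete
      (cauchySeq_of_le_geometric (1 / 2) _ (by norm_num) (hdist t j ξ))
  choose F hFl using hlim
  have hF : IsAdm (2 * m) F := by
    refine ⟨fun j => ?_, fun t j ξ => ?_⟩
    · refine measurable_of_tendsto_metrizable (fun n => (hf n).measurable j) ?_
      exact tendsto_pi_nhds.2 fun p => hFl p.1 j p.2
    · exact le_of_tendsto (hFl t j ξ).norm (Filter.Eventually.of_forall fun n => (hf n).bound t j ξ)
  have hfix : ∀ t j ξ, F t j ξ = Φ F t j ξ := fun t j ξ => by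
    have h1 : Filter.Tendsto (fun n => Φ (f n) t j ξ) Filter.atTop (nhds (F t j ξ)) := by
      simp_rw [← hfs]
      exact (Filter.tendsto_add_atTop_iff_nat 1).2 (hFl t j ξ)
    refine tendsto_nhds_unique h1 (tendsto_iff_norm_sub_tendsto_zero.2 ?_)
    have h2 : ∀ n, ∀ t j ξ, ‖f n t j ξ - F t j ξ‖ ≤ 4 * m * (1 / 2) ^ n * (‖ξ‖ ^ 2)⁻¹ :=
      fun n t j ξ => by
      rw [← dist_eq_norm]
      refine (dist_le_of_le_geometric_of_tendsto (1 / 2) _ (by norm_num) (hdist t j ξ)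
        (hFl t j ξ) n).trans (le_of_eq ?_)
      ring
    refine squeeze_zero (fun _ => norm_nonneg _) (fun n =>
      hdiff (f n) F _ (hf n) hF (by positivity) (h2 n) t j ξ) ?_
    have h3 := (tendsto_pow_atTop_nhds_zero_of_lt_one (r := (1 / 2 : ℝ)) (by norm_num)
      (by norm_num)).const_mul (2 * m * (‖ξ‖ ^ 2)⁻¹)
    rw [mul_zero] at h3
    exact h3.congr fun n => by ring
  refine ⟨F, hF, fun j ξ => ?_, fun t ht j ξ => ?_⟩
  · have : (fun t => F t j ξ) = fun t => Φ F t j ξ := funext fun t => hfix t j ξ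
    rw [this]
    have hcm : Continuous fun t : ℝ => max t 0 := by fun_prop
    exact ((hF.continuous_bil hF j ξ).comp hcm).add ((hYc j ξ).comp hcm)
  · have := hfix t j ξ
    simpa only [Φ, max_eq_left ht] using this

theorem forceHat_congr {κ : ℝ} {γ γ' : ℝ → E3} (h : ∀ t ≥ 0, γ t = γ' t) {t : ℝ} (ht : 0 ≤ t)
    (j : Fin 3) (ξ : E3) : forceHat κ γ t j ξ = forceHat κ γ' t j ξ := by
  unfold forceHat
  congr 1
  refine intervalIntegral.integral_congr fun τ hτ => ?_
  rw [Set.uIcc_of_le ht] at hτ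
  simp only [h τ hτ.1]

theorem continuous_forceHat (κ : ℝ) {γ : ℝ → E3} (hγ : Continuous γ) (j : Fin 3) (ξ : E3) :
    Continuous fun t => forceHat κ γ t j ξ := by
  refine continuous_const.mul (continuous_duhamel (fun a b => ?_) _)
  exact (by fun_prop : Continuous fun τ => (leray ξ j 0 : ℂ) *
    Complex.exp (Complex.I * (inner ℝ (γ τ) ξ : ℝ))).intervalIntegrable a b

theorem measurable_forceHat (κ : ℝ) {γ : ℝ → E3} (hγ : Continuous γ) (j : Fin 3) :
    Measurable fun p : ℝ × E3 => forceHat κ γ p.1 j p.2 := by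
  refine measurable_uncurry_of_continuous_of_measurable (u := fun t ξ => forceHat κ γ t j ξ)
    (fun ξ => continuous_forceHat κ hγ j ξ) fun t => ?_
  have hγm := hγ.measurable
  have hl : Measurable fun q : E3 × ℝ => (leray q.1 j 0 : ℂ) :=
    Complex.measurable_ofReal.comp ((measurable_leray j 0).comp measurable_fst)
  have hi : Measurable fun q : E3 × ℝ => Complex.exp (Complex.I * (inner ℝ (γ q.2) q.1 : ℝ)) :=
    (by fun_prop : Continuous fun q : E3 × ℝ =>
      Complex.exp (Complex.I * (inner ℝ (γ q.2) q.1 : ℝ))).measurable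
  have h : Measurable fun q : E3 × ℝ => (Real.exp (-(t - q.2) * ‖q.1‖ ^ 2) : ℂ) *
      ((leray q.1 j 0 : ℂ) * Complex.exp (Complex.I * (inner ℝ (γ q.2) q.1 : ℝ))) :=
    (by fun_prop : Measurable fun q : E3 × ℝ =>
      (Real.exp (-(t - q.2) * ‖q.1‖ ^ 2) : ℂ)).mul (hl.mul hi)
  unfold forceHat
  simp only [intervalIntegral]
  exact ((h.stronglyMeasurable.integral_prod_right).measurable.sub
    (h.stronglyMeasurable.integral_prod_right).measurable).const_mul _

theorem norm_exp_I_mul (x : ℝ) : ‖Complex.exp (Complex.I * (x : ℂ))‖ = 1 := by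
  rw [mul_comm]
  exact Complex.norm_exp_ofReal_mul_I x

theorem norm_forceHat_le (κ : ℝ) (γ : ℝ → E3) {t : ℝ} (ht : 0 ≤ t) (j : Fin 3) {ξ : E3}
    (hξ : ξ ≠ 0) : ‖forceHat κ γ t j ξ‖ ≤ 2 * |κ| * (‖ξ‖ ^ 2)⁻¹ := by
  have h := norm_duhamel_le (h := fun τ => (leray ξ j 0 : ℂ) *
    Complex.exp (Complex.I * (inner ℝ (γ τ) ξ : ℝ))) ht zero_le_two (fun τ _ => by
      rw [norm_mul, norm_exp_I_mul, mul_one, Complex.norm_real]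
      exact abs_leray_le ξ j 0) hξ
  rw [forceHat, norm_mul, Complex.norm_real, Real.norm_eq_abs]
  calc _ ≤ |κ| * (2 * (‖ξ‖ ^ 2)⁻¹) := by gcongr
    _ = _ := by ring

/-- The datum has size `2 |κ|`, since the entries of the Leray symbol are at most `2`; hence the
solution has size `4 |κ|`. -/
theorem exists_forcedSolution {κ : ℝ} (hκ : 16 * quadConst * |κ| ≤ 1) {γ : ℝ → E3}
    (hγ : ContinuousOn γ (Set.Ici 0)) :
    ∃ u, MemCw u ∧ IsForcedSolution κ γ u ∧ supNorm u ≤ ENNReal.ofReal (4 * |κ|) := by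
  classical
  have hγ' : Continuous fun t => γ (max t 0) :=
    hγ.comp_continuous (by fun_prop) fun t => le_max_right t 0
  have hcm : Continuous fun t : ℝ => max t 0 := by fun_prop
  have hmm : Measurable fun p : ℝ × E3 => (max p.1 0, p.2) := by fun_prop
  -- the value at `ξ = 0` is irrelevant, and is set to `0` for the bound by `‖ξ‖⁻²`
  let Y : ℝ → Fin 3 → E3 → ℂ := fun t j ξ =>
    if ξ = 0 then 0 else forceHat κ (fun t => γ (max t 0)) (max t 0) j ξ
  have hY : IsAdm (2 * |κ|) Y := by
    refine ⟨fun j => ?_, fun t j ξ => ?_⟩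
    · have h0 := (measurable_forceHat κ hγ' j).comp hmm
      simp only [Function.comp_def] at h0
      exact Measurable.ite (measurable_snd (measurableSet_singleton (0 : E3))) measurable_const h0
    · simp only [Y]
      split_ifs with h
      · simp [h]
      · exact norm_forceHat_le _ _ (le_max_right t 0) j h
  have hYc : ∀ j ξ, Continuous fun t => Y t j ξ := fun j ξ => by
    simp only [Y]
    split_ifs
    · exact continuous_const
    · exact (continuous_forceHat κ hγ' j ξ).comp hcm
  obtain ⟨F, hF, hFc, hFe⟩ := exists_fixedPoint hY hYc (by linarith)
  obtain ⟨u, hu, hn, hh⟩ := exists_memCw_of_isAdm hF hFc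
  refine ⟨u, hu, fun t ht j => ?_, ?_⟩
  · filter_upwards [hh t j, ae_ne_zero] with ξ h1 h2
    rw [h1, hFe t ht j ξ, bilinHat_eq_bil,
      bil_congr ht (fun τ _ l => hh τ l) (fun τ _ l => hh τ l)]
    simp only [Y, if_neg h2, max_eq_left ht]
    rw [forceHat_congr (γ := γ) (γ' := fun t => γ (max t 0))
      (fun t ht => by simp [max_eq_left ht]) ht]
  · convert hn using 2
    ring

/-! ### Uniqueness for the forced problem -/

theorem bilinHat_sub_right {u v w : ℝ → VecDist} (hu : MemCw u) (hv : MemCw v) (hw : MemCw w)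
    {t : ℝ} (ht : 0 ≤ t) (j : Fin 3) (ξ : E3) :
    bilinHat u (fun t => v t - w t) t j ξ = bilinHat u v t j ξ - bilinHat u w t j ξ := by
  obtain ⟨M, F, hF, hFu⟩ := hu.exists_isAdm
  obtain ⟨N, G, hG, hGv⟩ := hv.exists_isAdm
  obtain ⟨N', G', hG', hGw⟩ := hw.exists_isAdm
  have eF : ∀ τ ∈ Set.Ioc 0 t, ∀ l, hatFun (u τ l) =ᵐ[volume] F τ l :=
    fun τ hτ l => (hFu τ hτ.1.le l).symm
  rw [bilinHat_eq_bil, bilinHat_eq_bil, bilinHat_eq_bil,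
    bil_congr ht eF (fun τ hτ l => (hGv τ hτ.1.le l).symm),
    bil_congr ht eF (fun τ hτ l => (hGw τ hτ.1.le l).symm), ← hF.bil_sub_right hG hG']
  refine bil_congr ht eF (fun τ hτ l => ?_) j ξ
  filter_upwards [hatFun_sub_ae (hv.isFun hτ.1.le l) (hw.isFun hτ.1.le l), hGv τ hτ.1.le l,
    hGw τ hτ.1.le l] with η h1 h2 h3
  rw [h2, h3]
  exact h1

theorem bilinHat_sub_left {u v w : ℝ → VecDist} (hu : MemCw u) (hv : MemCw v) (hw : MemCw w)
    {t : ℝ} (ht : 0 ≤ t) (j : Fin 3) (ξ : E3) :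
    bilinHat (fun t => v t - w t) u t j ξ = bilinHat v u t j ξ - bilinHat w u t j ξ := by
  obtain ⟨M, F, hF, hFu⟩ := hu.exists_isAdm
  obtain ⟨N, G, hG, hGv⟩ := hv.exists_isAdm
  obtain ⟨N', G', hG', hGw⟩ := hw.exists_isAdm
  have eF : ∀ τ ∈ Set.Ioc 0 t, ∀ l, hatFun (u τ l) =ᵐ[volume] F τ l :=
    fun τ hτ l => (hFu τ hτ.1.le l).symm
  rw [bilinHat_eq_bil, bilinHat_eq_bil, bilinHat_eq_bil,
    bil_congr ht (fun τ hτ l => (hGv τ hτ.1.le l).symm) eF,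
    bil_congr ht (fun τ hτ l => (hGw τ hτ.1.le l).symm) eF, ← hG.bil_sub_left hG' hF]
  refine bil_congr ht (fun τ hτ l => ?_) eF j ξ
  filter_upwards [hatFun_sub_ae (hv.isFun hτ.1.le l) (hw.isFun hτ.1.le l), hGv τ hτ.1.le l,
    hGw τ hτ.1.le l] with η h1 h2 h3
  rw [h2, h3]
  exact h1

theorem forcedSolution_unique {η κ : ℝ} {γ : ℝ → E3} (hη : IsBilinearConstant η)
    {u v : ℝ → VecDist} (hu : MemCw u) (hv : MemCw v) (su : IsForcedSolution κ γ u)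
    (sv : IsForcedSolution κ γ v) (hs : ENNReal.ofReal η * (supNorm u + supNorm v) < 1) :
    ∀ t ≥ 0, u t = v t := by
  let d : ℝ → VecDist := fun t => u t - v t
  have hd : MemCw d := hu.sub hv
  have hdh : ∀ t ≥ 0, ∀ j, hatFun (d t j) =ᵐ[volume]
      fun ξ => bilinHat u d t j ξ + bilinHat d v t j ξ := fun t ht j => by
    filter_upwards [hatFun_sub_ae (hu.isFun ht j) (hv.isFun ht j), su t ht j, sv t ht j]
      with ξ h1 h2 h3
    have e1 := bilinHat_sub_right hu hu hv ht j ξ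
    have e2 := bilinHat_sub_left hv hu hv ht j ξ
    change bilinHat u d t j ξ = _ at e1
    change bilinHat d v t j ξ = _ at e2
    rw [e1, e2]
    refine h1.trans ?_
    rw [h2, h3]
    ring
  have hle : supNorm d ≤ ENNReal.ofReal η * (supNorm u + supNorm v) * supNorm d := by
    refine iSup₂_le fun t ht => vecNorm_le_iff.2 fun j => ?_
    rw [pmNorm_eq (hd.isFun (le_of_lt ht) j), weightedSup_congr (hdh t (le_of_lt ht) j)]
    refine (weightedSup_add_le _ _).trans ?_
    calc _ ≤ ENNReal.ofReal η * supNorm u * supNorm d + ENNReal.ofReal η * supNorm d * supNorm v :=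
          add_le_add (hη.2 u d hu hd t ht j) (hη.2 d v hd hv t ht j)
      _ = _ := by ring
  have hd0 : supNorm d = 0 := by
    by_contra hne
    have := ENNReal.mul_lt_mul_left hne hd.supNorm_lt_top.ne hs
    rw [one_mul] at this
    exact absurd hle (not_le.2 this)
  have hzero : ∀ t ≥ 0, ∀ j, hatFun (d t j) =ᵐ[volume] fun _ => 0 := fun t ht j => by
    rcases eq_or_lt_of_le ht with h0 | h0
    · filter_upwards [hdh t ht j] with ξ hξ
      rw [hξ, ← h0]
      simp [bilinHat]
    · filter_upwards [hd.ae_le_supNorm h0 j] with ξ hξ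
      simpa [hd0] using hξ
  intro t ht
  funext j
  refine eq_of_hatFun_ae_eq (hu.isFun ht j) (hv.isFun ht j) ?_
  filter_upwards [hzero t ht j, hatFun_sub_ae (hu.isFun ht j) (hv.isFun ht j)] with ξ h1 h2
  exact sub_eq_zero.1 (h2.symm.trans h1)

/-! ### The perturbation equation -/

/-- The phase `exp (i a · ξ)` by which the translation by `a` acts on Fourier transforms. -/
def phase (a ξ : E3) : ℂ := Complex.exp (Complex.I * (inner ℝ a ξ : ℝ))

theorem norm_phase (a ξ : E3) : ‖phase a ξ‖ = 1 := norm_exp_I_mul _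

theorem phase_sub_mul (a ξ η : E3) : phase a (ξ - η) * phase a η = phase a ξ := by
  rw [phase, phase, phase, ← Complex.exp_add, inner_sub_right]
  congr 1
  push_cast
  ring

theorem quadHat_phase (G : Fin 3 → E3 → ℂ) (a : E3) (j : Fin 3) (ξ : E3) :
    quadHat (fun l ξ => phase a ξ * G l ξ) (fun l ξ => phase a ξ * G l ξ) j ξ =
      phase a ξ * quadHat G G j ξ := by
  have h : ∀ l k, convHat (fun l ξ => phase a ξ * G l ξ) (fun l ξ => phase a ξ * G l ξ) l k ξ =
      phase a ξ * convHat G G l k ξ := fun l k => by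
    rw [convHat, convHat, mul_left_comm, ← integral_const_mul (phase a ξ)]
    congr 2
    ext η
    rw [← phase_sub_mul a ξ η]
    ring
  simp only [quadHat, h, Finset.mul_sum]
  refine Finset.sum_congr rfl fun k _ => Finset.sum_congr rfl fun l _ => ?_
  ring

/-- The facts about the Slezkin–Landau field `V^c` which relate the two equations: the Fourier
transform of its translates is `exp (i a · ξ) G ξ` with `G = O(‖ξ‖⁻²)`, and `G` solves the
stationary Navier–Stokes system with force `κ δ₀ e₀`. -/
structure IsLandauTransform (c κ M : ℝ) (G : Fin 3 → E3 → ℂ) : Prop where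
  measurable : ∀ j, Measurable (G j)
  bound : ∀ j ξ, ‖G j ξ‖ ≤ M * (‖ξ‖ ^ 2)⁻¹
  isFun : ∀ a j, IsFun (hat (landau c a j)) fun ξ => phase a ξ * G j ξ
  stationary : ∀ j, ∀ᵐ ξ : E3,
    ((‖ξ‖ ^ 2 : ℝ) : ℂ) * G j ξ = quadHat G G j ξ + κ * (leray ξ j 0 : ℂ)

namespace IsLandauTransform

variable {c κ M : ℝ} {G : Fin 3 → E3 → ℂ}

theorem hatFun_zero (h : IsLandauTransform c κ M G) (j : Fin 3) :
    hatFun (landau c 0 j) =ᵐ[volume] G j := by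
  filter_upwards [hatFun_ae_eq (h.isFun 0 j)] with ξ hξ
  simpa [phase] using hξ

theorem vecNorm_eq (h : IsLandauTransform c κ M G) (a : E3) :
    vecNorm 2 (landau c a) = vecNorm 2 (landau c 0) := by
  have : ∀ a j, pmNorm 2 (landau c a j) = weightedSup 2 (G j) := fun a j => by
    rw [pmNorm_eq (h.isFun a j)]
    simp [weightedSup, enorm_mul, ← ofReal_norm (phase a _), norm_phase]
  simp only [vecNorm, this]

theorem vecNorm_le (h : IsLandauTransform c κ M G) (hM : 0 ≤ M) :
    vecNorm 2 (landau c 0) ≤ ENNReal.ofReal M :=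
  vecNorm_le_iff.2 fun j => by
    rw [pmNorm_eq (h.isFun 0 j)]
    refine (weightedSup_le_iff hM).2 (Filter.Eventually.of_forall fun ξ => ?_)
    rw [norm_mul, norm_phase, one_mul]
    exact h.bound j ξ

theorem memCw (h : IsLandauTransform c κ M G) {γ : ℝ → E3} (hγ : ContinuousOn γ (Set.Ici 0)) :
    MemCw fun t => landau c (γ t) := by
  have hγ' : Continuous fun t => γ (max t 0) :=
    hγ.comp_continuous (by fun_prop) fun t => le_max_right t 0
  have hp : Continuous fun p : ℝ × E3 => phase (γ (max p.1 0)) p.2 := by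
    have : Continuous fun p : ℝ × E3 => γ (max p.1 0) := hγ'.comp continuous_fst
    exact Complex.continuous_exp.comp
      (continuous_const.mul (Complex.continuous_ofReal.comp (this.inner continuous_snd)))
  refine (memCw_of_isAdm (M := M) (F := fun t j ξ => phase (γ (max t 0)) ξ * G j ξ)
    ⟨fun j => hp.measurable.mul ((h.measurable j).comp measurable_snd), fun t j ξ => ?_⟩
    (fun j ξ => ?_) fun t ht j => ?_).1
  · rw [norm_mul, norm_phase, one_mul]
    exact h.bound j ξ
  · exact (hp.comp (by fun_prop : Continuous fun t : ℝ => (t, ξ))).mul continuous_const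
  · simpa only [max_eq_left (ht : (0 : ℝ) ≤ t)] using h.isFun (γ t) j

/-- By the stationary equation, the quadratic and force terms of the translated field make up the
field itself and the datum `y₀`. -/
theorem bilinHat_add_forceHat (h : IsLandauTransform c κ M G) {γ : ℝ → E3}
    (hγ : ContinuousOn γ (Set.Ici 0)) {t : ℝ} (ht : 0 ≤ t) (j : Fin 3) :
    ∀ᵐ ξ : E3, bilinHat (fun s => landau c (γ s)) (fun s => landau c (γ s)) t j ξ +
      forceHat κ γ t j ξ = hatFun (landau c (γ t) j) ξ + yHat c γ t j ξ := by
  filter_upwards [h.stationary j, h.hatFun_zero j, hatFun_ae_eq (h.isFun (γ t) j), ae_ne_zero]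
    with ξ h1 h2 h3 h4
  have hr : ‖ξ‖ ≠ 0 := norm_ne_zero_iff.2 h4
  have hpc : ContinuousOn (fun τ => phase (γ τ) ξ) (Set.uIcc 0 t) := by
    rw [Set.uIcc_of_le ht]
    have := hγ.mono (Set.Icc_subset_Ici_self : Set.Icc 0 t ⊆ Set.Ici 0)
    unfold phase
    fun_prop
  have hpi : IntervalIntegrable (fun τ => phase (γ τ) ξ) volume 0 t := hpc.intervalIntegrable
  have hI := IntervalIntegrable.exp_mul hpi t (‖ξ‖ ^ 2)
  set I : ℂ := ∫ τ in (0 : ℝ)..t, (Real.exp (-(t - τ) * ‖ξ‖ ^ 2) : ℂ) * phase (γ τ) ξ with hIdef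
  have e1 : bilinHat (fun s => landau c (γ s)) (fun s => landau c (γ s)) t j ξ =
      I * quadHat G G j ξ := by
    rw [bilinHat_eq_bil, bil_congr ht (fun τ _ l => hatFun_ae_eq (h.isFun (γ τ) l))
      (fun τ _ l => hatFun_ae_eq (h.isFun (γ τ) l)), bil, hIdef,
      ← intervalIntegral.integral_mul_const]
    simp only [quadHat_phase, mul_assoc]
  have e2 : forceHat κ γ t j ξ = κ * (I * (leray ξ j 0 : ℂ)) := by
    rw [forceHat, hIdef, ← intervalIntegral.integral_mul_const]
    congr 2
    ext τ
    rw [phase]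
    ring
  have e0 : ∫ τ in (0 : ℝ)..t, (Real.exp (-(t - τ) * ‖ξ‖ ^ 2) : ℂ) =
      (((1 - Real.exp (-t * ‖ξ‖ ^ 2)) * (‖ξ‖ ^ 2)⁻¹ : ℝ) : ℂ) := by
    rw [intervalIntegral.integral_ofReal, duhamel_kernel_integral (by positivity)]
  have e3 : yHat c γ t j ξ = (‖ξ‖ ^ 2 : ℝ) * ((I - (((1 - Real.exp (-t * ‖ξ‖ ^ 2)) *
      (‖ξ‖ ^ 2)⁻¹ : ℝ) : ℂ) * phase (γ t) ξ) * G j ξ) -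
      (Real.exp (-t * ‖ξ‖ ^ 2) : ℂ) * phase (γ t) ξ * G j ξ := by
    rw [yHat, h2, ← e0, hIdef, ← intervalIntegral.integral_mul_const,
      ← intervalIntegral.integral_sub hI, ← intervalIntegral.integral_mul_const]
    · simp only [phase]
      congr 3
      ext τ
      ring
    · exact (by fun_prop : Continuous fun τ : ℝ => (Real.exp (-(t - τ) * ‖ξ‖ ^ 2) : ℂ) *
        phase (γ t) ξ).intervalIntegrable _ _
  rw [e1, e2, e3, h3]
  have h5 : quadHat G G j ξ = ((‖ξ‖ ^ 2 : ℝ) : ℂ) * G j ξ - κ * (leray ξ j 0 : ℂ) := by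
    rw [h1]; ring
  rw [h5]
  have hr' : (‖ξ‖ : ℂ) ≠ 0 := by exact_mod_cast hr
  push_cast
  field_simp
  ring

theorem isPerturbationSolution_iff (h : IsLandauTransform c κ M G) {γ : ℝ → E3}
    (hγ : ContinuousOn γ (Set.Ici 0)) {u : ℝ → VecDist} (hu : MemCw u) :
    IsPerturbationSolution c γ (fun t => u t - landau c (γ t)) ↔ IsForcedSolution κ γ u := by
  have hW := h.memCw hγ
  have hω := hu.sub hW
  refine forall₂_congr fun t ht => forall_congr' fun j => Filter.eventually_congr ?_
  filter_upwards [h.bilinHat_add_forceHat hγ ht j,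
    hatFun_sub_ae (hu.isFun ht j) (hW.isFun ht j)] with ξ h1 h2
  have e1 := bilinHat_sub_right hω hu hW ht j ξ
  have e2 := bilinHat_sub_left hu hu hW ht j ξ
  have e3 := bilinHat_sub_right hW hu hW ht j ξ
  have h2' : hatFun ((u t - landau c (γ t)) j) ξ = _ := h2
  rw [h2', e1, e2, e3]
  constructor
  · intro h3
    linear_combination h3 - h1
  · intro h3
    linear_combination h3 + h1

end IsLandauTransform

/-! ### The function `exp (-a)` as a mixture of Gaussians in `a` -/

/-- The density of the mixture `exp (-a) = ∫₀^∞ (π s)^(-1/2) exp (-s - a² / (4 s)) ds`. -/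
def mixDensity (a s : ℝ) : ℝ := (√(Real.pi * s))⁻¹ * Real.exp (-s - a ^ 2 / (4 * s))

theorem mixDensity_nonneg (a s : ℝ) : 0 ≤ mixDensity a s := by unfold mixDensity; positivity

theorem measurable_mixDensity : Measurable fun p : ℝ × ℝ => mixDensity p.1 p.2 := by
  unfold mixDensity
  fun_prop

/-- The substitution `w = √s - a / (2 √s)` and the symmetry `s ↦ a² / (4 s)` reduce the mixture
integral to the Gaussian integral. -/
theorem integral_mixDensity {a : ℝ} (ha : 0 < a) :
    IntegrableOn (mixDensity a) (Set.Ioi 0) ∧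
      ∫ s in Set.Ioi (0 : ℝ), mixDensity a s = Real.exp (-a) := by
  have hpi := Real.pi_pos
  let w : ℝ → ℝ := fun s => √s - a / (2 * √s)
  let w' : ℝ → ℝ := fun s => 1 / (2 * √s) + a / (4 * s * √s)
  let g : ℝ → ℝ := fun y => Real.exp (-1 * y ^ 2)
  have hw : ∀ s ∈ Set.Ioi (0 : ℝ), HasDerivWithinAt w (w' s) (Set.Ioi 0) s := fun s hs => by
    have hs' : (0 : ℝ) < s := hs
    have h0 : 0 < √s := Real.sqrt_pos.2 hs'
    have h1 := Real.hasDerivAt_sqrt hs'.ne'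
    have h2 := h1.sub ((hasDerivAt_const s a).div (h1.const_mul 2) (by positivity))
    refine (h2.congr_deriv ?_).hasDerivWithinAt
    have h3 : √s ^ 2 = s := Real.sq_sqrt hs'.le
    simp only [w']
    rw [show 4 * s * √s = 4 * √s ^ 3 by rw [← h3, Real.sqrt_sq h0.le]; ring]
    field_simp
    ring
  have hinj : Set.InjOn w (Set.Ioi 0) := by
    refine StrictMonoOn.injOn fun s hs t ht hst => ?_
    have hs' : (0 : ℝ) < s := hs
    have h1 : √s < √t := Real.sqrt_lt_sqrt hs'.le hst
    have h0 : 0 < √s := Real.sqrt_pos.2 hs'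
    have h2 : a / (2 * √t) < a / (2 * √s) := by gcongr
    simp only [w]
    linarith
  have himg : w '' Set.Ioi 0 = Set.univ := by
    refine Set.eq_univ_of_forall fun y => ?_
    have hR : √(y ^ 2 + 2 * a) ^ 2 = y ^ 2 + 2 * a := Real.sq_sqrt (by positivity)
    have hRy : |y| < √(y ^ 2 + 2 * a) := by
      rw [← Real.sqrt_sq_eq_abs]
      exact Real.sqrt_lt_sqrt (sq_nonneg y) (by linarith)
    set R := √(y ^ 2 + 2 * a)
    have hu : 0 < (y + R) / 2 := by linarith [neg_abs_le y]
    refine ⟨((y + R) / 2) ^ 2, Set.mem_Ioi.2 (by positivity), ?_⟩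
    simp only [w]
    rw [Real.sqrt_sq hu.le]
    have : y + R ≠ 0 := by linarith
    field_simp
    nlinarith
  have hgi : Integrable g := integrable_exp_neg_mul_sq one_pos
  have hsumI : IntegrableOn (fun s => |w' s| • g (w s)) (Set.Ioi 0) :=
    (integrableOn_image_iff_integrableOn_abs_deriv_smul measurableSet_Ioi hw hinj g).1
      (by rw [himg]; exact hgi.integrableOn)
  have hsum : ∫ s in Set.Ioi (0 : ℝ), |w' s| • g (w s) = √Real.pi := by
    rw [← integral_image_eq_integral_abs_deriv_smul measurableSet_Ioi hw hinj g, himg,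
      Measure.restrict_univ]
    exact (integral_gaussian 1).trans (by rw [div_one])
  -- the two halves of the integral, exchanged by the symmetry
  let f : ℝ → ℝ := fun s => (√s)⁻¹ * g (w s)
  let f' : ℝ → ℝ := fun s => (√s)⁻¹ * (a / (2 * s)) * g (w s)
  have hff : ∀ s ∈ Set.Ioi (0 : ℝ), |w' s| • g (w s) = 1 / 2 * (f s + f' s) := fun s hs => by
    have hs' : (0 : ℝ) < s := hs
    have h0 : 0 < √s := Real.sqrt_pos.2 hs'
    rw [abs_of_pos (by simp only [w']; positivity)]
    simp only [w', f, f', smul_eq_mul]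
    field_simp
    ring
  have hg0 : ∀ y, 0 < g y := fun y => Real.exp_pos _
  have hfm : Measurable f := by simp only [f, g, w]; fun_prop
  have hf'm : Measurable f' := by simp only [f', g, w]; fun_prop
  have hfI : IntegrableOn f (Set.Ioi 0) := by
    refine (hsumI.const_mul 2).mono' hfm.aestronglyMeasurable ?_
    filter_upwards [ae_restrict_mem measurableSet_Ioi] with s hs
    have hs' : (0 : ℝ) < s := hs
    rw [hff s hs, Real.norm_of_nonneg (by have := hg0 (w s); simp only [f]; positivity)]
    have : 0 ≤ f' s := by have := hg0 (w s); simp only [f']; positivity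
    linarith
  have hf'I : IntegrableOn f' (Set.Ioi 0) := by
    refine (hsumI.const_mul 2).mono' hf'm.aestronglyMeasurable ?_
    filter_upwards [ae_restrict_mem measurableSet_Ioi] with s hs
    have hs' : (0 : ℝ) < s := hs
    rw [hff s hs, Real.norm_of_nonneg (by have := hg0 (w s); simp only [f']; positivity)]
    have : 0 ≤ f s := by have := hg0 (w s); simp only [f]; positivity
    linarith
  have hsym : ∫ s in Set.Ioi (0 : ℝ), f s = ∫ s in Set.Ioi (0 : ℝ), f' s := by
    let q : ℝ → ℝ := fun s => a ^ 2 / 4 / s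
    have hq : ∀ s ∈ Set.Ioi (0 : ℝ), HasDerivWithinAt q (-(a ^ 2 / 4 / s ^ 2)) (Set.Ioi 0) s :=
      fun s hs => by
      have hs' : s ≠ 0 := (Set.mem_Ioi.1 hs).ne'
      have := (hasDerivAt_const s (a ^ 2 / 4)).div (hasDerivAt_id s) hs'
      refine (this.congr_deriv ?_).hasDerivWithinAt
      simp
      ring
    have hqi : Set.InjOn q (Set.Ioi 0) := fun s hs t ht h => by
      have hs' : s ≠ 0 := (Set.mem_Ioi.1 hs).ne'
      have ht' : t ≠ 0 := (Set.mem_Ioi.1 ht).ne'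
      simp only [q] at h
      field_simp at h
      exact h.symm
    have hqimg : q '' Set.Ioi 0 = Set.Ioi 0 := by
      ext y
      constructor
      · rintro ⟨s, hs, rfl⟩
        have hs' : (0 : ℝ) < s := hs
        exact Set.mem_Ioi.2 (by simp only [q]; positivity)
      · intro hy
        have hy' : (0 : ℝ) < y := hy
        refine ⟨q y, Set.mem_Ioi.2 (by simp only [q]; positivity), ?_⟩
        simp only [q]
        field_simp
    conv_lhs => rw [← hqimg]
    rw [integral_image_eq_integral_abs_deriv_smul measurableSet_Ioi hq hqi f]
    refine setIntegral_congr_fun measurableSet_Ioi fun s hs => ?_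
    have hs' : (0 : ℝ) < s := hs
    have h0 : 0 < √s := Real.sqrt_pos.2 hs'
    have hsq : √s ^ 2 = s := Real.sq_sqrt hs'.le
    have e1 : √(q s) = a / (2 * √s) := by
      simp only [q]
      rw [Real.sqrt_div (by positivity), show a ^ 2 / 4 = (a / 2) ^ 2 by ring,
        Real.sqrt_sq (by positivity)]
      field_simp
    have e2 : w (q s) = -w s := by
      simp only [w]
      rw [e1]
      field_simp
      ring
    simp only [f, f', g, smul_eq_mul]
    rw [e1, e2, abs_neg, abs_of_pos (by positivity), neg_sq]
    generalize Real.exp (-1 * w s ^ 2) = z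
    rw [show a / (2 * s) = a / (2 * √s ^ 2) by rw [hsq], show s ^ 2 = √s ^ 4 by
      rw [← hsq]; rw [Real.sqrt_sq h0.le]; ring]
    field_simp
    norm_num
  have hK : ∫ s in Set.Ioi (0 : ℝ), f s = √Real.pi := by
    have h1 : ∫ s in Set.Ioi (0 : ℝ), |w' s| • g (w s) =
        1 / 2 * ((∫ s in Set.Ioi (0 : ℝ), f s) + ∫ s in Set.Ioi (0 : ℝ), f' s) := by
      rw [← integral_add hfI hf'I, ← integral_const_mul]
      exact setIntegral_congr_fun measurableSet_Ioi hff
    rw [hsum, ← hsym] at h1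
    linarith
  have hmix : ∀ s ∈ Set.Ioi (0 : ℝ),
      mixDensity a s = (√Real.pi)⁻¹ * Real.exp (-a) * f s := fun s hs => by
    have hs' : (0 : ℝ) < s := hs
    have h0 : 0 < √s := Real.sqrt_pos.2 hs'
    have hsq : √s ^ 2 = s := Real.sq_sqrt hs'.le
    have e : -s - a ^ 2 / (4 * s) = -a + -1 * (w s) ^ 2 := by
      simp only [w]
      rw [sub_sq, div_pow, mul_pow, hsq]
      field_simp
      ring
    rw [mixDensity, e, Real.exp_add, Real.sqrt_mul hpi.le]
    simp only [f, g]
    field_simp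
  refine ⟨IntegrableOn.congr_fun (hfI.const_mul ((√Real.pi)⁻¹ * Real.exp (-a)))
    (fun s hs => (hmix s hs).symm) measurableSet_Ioi, ?_⟩
  rw [setIntegral_congr_fun measurableSet_Ioi hmix, integral_const_mul, hK]
  field_simp

/-! ### Exponential integrals on the half line -/

theorem integral_pow_mul_cexp_neg {w : ℂ} (hw : 0 < w.re) (n : ℕ) :
    IntegrableOn (fun t : ℝ => (t : ℂ) ^ n * Complex.exp (-w * t)) (Set.Ioi 0) ∧
      ∫ t in Set.Ioi (0 : ℝ), (t : ℂ) ^ n * Complex.exp (-w * t) = n.factorial / w ^ (n + 1) := by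
  have hw0 : w ≠ 0 := fun h => by simp [h] at hw
  have hi : ∀ n : ℕ, IntegrableOn (fun t : ℝ => (t : ℂ) ^ n * Complex.exp (-w * t)) (Set.Ioi 0) :=
    fun n => by
    have h := integrableOn_rpow_mul_exp_neg_mul_rpow (p := 1) (s := n) (b := w.re)
      (by have : (0 : ℝ) ≤ n := n.cast_nonneg
          linarith) one_pos hw
    refine h.mono' (by fun_prop : Measurable fun t : ℝ =>
      (t : ℂ) ^ n * Complex.exp (-w * t)).aestronglyMeasurable ?_
    filter_upwards [ae_restrict_mem measurableSet_Ioi] with t ht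
    have ht' : (0 : ℝ) < t := ht
    rw [norm_mul, norm_pow, Complex.norm_real, Real.norm_of_nonneg ht'.le, Complex.norm_exp]
    simp
  refine ⟨hi n, ?_⟩
  have hlim : ∀ n : ℕ, Filter.Tendsto (fun t : ℝ => (t : ℂ) ^ n * Complex.exp (-w * t))
      Filter.atTop (nhds 0) := fun n => by
    rw [tendsto_zero_iff_norm_tendsto_zero]
    have := Real.tendsto_pow_mul_exp_neg_atTop_nhds_zero n
    have h1 := (this.comp (Filter.tendsto_id.const_mul_atTop hw)).const_mul ((w.re ^ n)⁻¹)
    rw [mul_zero] at h1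
    refine h1.congr' ?_
    filter_upwards [Filter.eventually_gt_atTop 0] with t ht
    rw [norm_mul, norm_pow, Complex.norm_real, Real.norm_of_nonneg ht.le, Complex.norm_exp]
    simp only [Function.comp, id, mul_pow]
    field_simp
    simp
  have hderiv : ∀ t : ℝ, HasDerivAt (fun t : ℝ => Complex.exp (-w * t))
      (-w * Complex.exp (-w * t)) t := fun t => by
    have h1 : HasDerivAt (fun t : ℝ => -w * (t : ℂ)) (-w) t := by
      simpa using (Complex.ofRealCLM.hasDerivAt (x := t)).const_mul (-w)
    convert! h1.cexp using 1
    ring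
  induction n with
  | zero =>
    have h := integral_Ioi_of_hasDerivAt_of_tendsto' (a := 0)
      (f := fun t : ℝ => -w⁻¹ * Complex.exp (-w * t))
      (f' := fun t : ℝ => (t : ℂ) ^ 0 * Complex.exp (-w * t)) (m := -w⁻¹ * 0)
      (fun t _ => ((hderiv t).const_mul (-w⁻¹)).congr_deriv (by field_simp)) (hi 0)
      (by simpa using (hlim 0).const_mul (-w⁻¹))
    rw [h]
    simp
  | succ n ih =>
    have h1 : ∀ t : ℝ, HasDerivAt (fun t : ℝ => (t : ℂ) ^ (n + 1))
        (((n + 1 : ℕ) : ℂ) * (t : ℂ) ^ n) t := fun t => by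
      simpa using! (Complex.ofRealCLM.hasDerivAt (x := t)).pow (n + 1)
    have h := integral_Ioi_of_hasDerivAt_of_tendsto' (a := 0)
      (f := fun t : ℝ => -w⁻¹ * ((t : ℂ) ^ (n + 1) * Complex.exp (-w * t)))
      (f' := fun t : ℝ => (t : ℂ) ^ (n + 1) * Complex.exp (-w * t) -
        w⁻¹ * ((n + 1 : ℕ) : ℂ) * ((t : ℂ) ^ n * Complex.exp (-w * t))) (m := -w⁻¹ * 0)
      (fun t _ => (((h1 t).mul (hderiv t)).const_mul (-w⁻¹)).congr_deriv (by field_simp; ring))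
      ((hi (n + 1)).sub ((hi n).const_mul _)) ((hlim (n + 1)).const_mul (-w⁻¹))
    rw [integral_sub (hi (n + 1)) ((hi n).const_mul _), integral_const_mul, ih] at h
    simp only [mul_zero, Complex.ofReal_zero, ne_eq, Nat.succ_ne_zero, not_false_eq_true,
      zero_pow, zero_mul, sub_zero, sub_eq_zero] at h
    rw [h, Nat.factorial_succ]
    push_cast
    field_simp
    ring

/-! ### The Fourier transform of `exp (-μ ‖x‖ + m x₀)` -/

theorem sum_ofReal_sq (x : E3) : ∑ i, ((x i : ℝ) : ℂ) ^ 2 = ((‖x‖ ^ 2 : ℝ) : ℂ) := by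
  rw [EuclideanSpace.norm_sq_eq]
  push_cast
  simp [← Complex.ofReal_pow]

theorem integral_gaussian_E3 {b : ℝ} (hb : 0 < b) (z : Fin 3 → ℂ) :
    Integrable (fun x : E3 =>
      Complex.exp (-b * ((‖x‖ ^ 2 : ℝ) : ℂ) + ∑ i, z i * (x i : ℂ))) volume ∧
      ∫ x : E3, Complex.exp (-b * ((‖x‖ ^ 2 : ℝ) : ℂ) + ∑ i, z i * (x i : ℂ)) =
        ((Real.pi / b * √(Real.pi / b) : ℝ) : ℂ) * Complex.exp ((∑ i, z i ^ 2) / (4 * b)) := by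
  have hbr : 0 < (b : ℂ).re := hb
  have hpi := Real.pi_pos
  have hmp := PiLp.volume_preserving_toLp (Fin 3)
  have hme := (MeasurableEquiv.toLp 2 (Fin 3 → ℝ)).measurableEmbedding
  have e : ∀ v : Fin 3 → ℝ, Complex.exp (-b * ((‖WithLp.toLp 2 v‖ ^ 2 : ℝ) : ℂ) +
      ∑ i, z i * ((WithLp.toLp 2 v : E3) i : ℂ)) =
      Complex.exp (-b * ∑ i, (v i : ℂ) ^ 2 + ∑ i, z i * v i) := fun v => by
    rw [← sum_ofReal_sq]
  constructor
  · rw [← hmp.integrable_comp_emb hme]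
    refine (GaussianFourier.integrable_cexp_neg_mul_sum_add hbr z).congr
      (Filter.Eventually.of_forall fun v => (e v).symm)
  · rw [← hmp.integral_comp hme]
    refine (integral_congr_ae (Filter.Eventually.of_forall e)).trans ?_
    rw [GaussianFourier.integral_cexp_neg_mul_sum_add hbr z]
    congr 1
    have h0 : 0 < Real.pi / b := by positivity
    rw [← Complex.ofReal_div, show ((Fintype.card (Fin 3) : ℂ) / 2) = ((3 / 2 : ℝ) : ℂ) by simp,
      ← Complex.ofReal_cpow h0.le, show (3 / 2 : ℝ) = 1 + 1 / 2 by norm_num,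
      Real.rpow_add h0, Real.rpow_one, Real.sqrt_eq_rpow]

/-- The denominator of the Fourier transform of `exp (-μ ‖x‖ + m x₀)`. -/
def expDenom (μ m : ℝ) (ξ : E3) : ℂ :=
  ((μ ^ 2 - m ^ 2 + ‖ξ‖ ^ 2 : ℝ) : ℂ) - 2 * Complex.I * m * ξ 0

theorem expDenom_re (μ m : ℝ) (ξ : E3) : (expDenom μ m ξ).re = μ ^ 2 - m ^ 2 + ‖ξ‖ ^ 2 := by
  simp [expDenom, -Complex.ofReal_pow]

theorem le_norm_expDenom (μ m : ℝ) (ξ : E3) : μ ^ 2 - m ^ 2 + ‖ξ‖ ^ 2 ≤ ‖expDenom μ m ξ‖ := by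
  rw [← expDenom_re]
  exact (le_abs_self _).trans (Complex.abs_re_le_norm _)

theorem sq_sub_sq_pos {μ m : ℝ} (hm : |m| < μ) : 0 < μ ^ 2 - m ^ 2 := by
  have := sq_lt_sq' (abs_lt.1 hm).1 (abs_lt.1 hm).2
  linarith

theorem expDenom_ne_zero {μ m : ℝ} (hm : |m| < μ) (ξ : E3) : expDenom μ m ξ ≠ 0 := by
  have h1 := le_norm_expDenom μ m ξ
  have h2 := sq_sub_sq_pos hm
  rw [← norm_pos_iff]
  nlinarith [sq_nonneg ‖ξ‖]

/-- The exponential `exp (-μ ‖x‖ + m x₀)`. -/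
def expField (μ m : ℝ) (x : E3) : ℝ := Real.exp (-μ * ‖x‖ + m * x 0)

theorem expField_pos (μ m : ℝ) (x : E3) : 0 < expField μ m x := Real.exp_pos _

theorem continuous_expField (μ m : ℝ) : Continuous (expField μ m) := by
  unfold expField
  fun_prop

theorem integral_mixDensity_mul {μ m s : ℝ} (hμ : 0 < μ) (hs : 0 < s) (ξ : E3) :
    Integrable (fun x : E3 => phase x ξ * (Real.exp (m * x 0) : ℂ) *
      (mixDensity (μ * ‖x‖) s : ℂ)) volume ∧
      ∫ x : E3, phase x ξ * (Real.exp (m * x 0) : ℂ) * (mixDensity (μ * ‖x‖) s : ℂ) =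
        ((8 * Real.pi / μ ^ 3 : ℝ) : ℂ) *
          ((s : ℂ) ^ 1 * Complex.exp (-(expDenom μ m ξ / (μ ^ 2 : ℝ)) * s)) := by
  have hpi := Real.pi_pos
  have hμc : (μ : ℂ) ≠ 0 := by exact_mod_cast hμ.ne'
  let z : Fin 3 → ℂ := fun i => Complex.I * ξ i + if i = 0 then (m : ℂ) else 0
  let A : ℂ := (((√(Real.pi * s))⁻¹ * Real.exp (-s) : ℝ) : ℂ)
  have hb : 0 < μ ^ 2 / (4 * s) := by positivity
  obtain ⟨hi, he⟩ := integral_gaussian_E3 hb z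
  have e : ∀ x : E3, phase x ξ * (Real.exp (m * x 0) : ℂ) * (mixDensity (μ * ‖x‖) s : ℂ) =
      A * Complex.exp (-((μ ^ 2 / (4 * s) : ℝ) : ℂ) * ((‖x‖ ^ 2 : ℝ) : ℂ) +
        ∑ i, z i * (x i : ℂ)) := fun x => by
    simp only [A, z, phase, mixDensity, Complex.ofReal_mul, Complex.ofReal_exp]
    rw [show Complex.exp (Complex.I * (inner ℝ x ξ : ℝ)) * Complex.exp ((m : ℂ) * (x 0 : ℂ)) *
      ((((√(Real.pi * s))⁻¹ : ℝ) : ℂ) *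
        Complex.exp ((-s - (μ * ‖x‖) ^ 2 / (4 * s) : ℝ) : ℂ)) =
      (((√(Real.pi * s))⁻¹ : ℝ) : ℂ) * (Complex.exp (Complex.I * (inner ℝ x ξ : ℝ)) *
        Complex.exp ((m : ℂ) * (x 0 : ℂ)) *
        Complex.exp ((-s - (μ * ‖x‖) ^ 2 / (4 * s) : ℝ) : ℂ)) by ring,
      mul_assoc, ← Complex.exp_add, ← Complex.exp_add, mul_assoc (((√(Real.pi * s))⁻¹ : ℝ) : ℂ),
      ← Complex.exp_add]
    congr 2
    simp only [PiLp.inner_apply, Fin.sum_univ_three, RCLike.inner_apply, conj_trivial]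
    push_cast
    simp
    ring
  have hz : (∑ i, z i ^ 2) = m ^ 2 + 2 * Complex.I * m * ξ 0 - ((‖ξ‖ ^ 2 : ℝ) : ℂ) := by
    rw [← sum_ofReal_sq]
    simp only [z, Fin.sum_univ_three]
    simp [mul_pow, add_sq]
    ring
  simp_rw [e]
  refine ⟨hi.const_mul A, ?_⟩
  rw [integral_const_mul, he, hz]
  have hq : Real.pi / (μ ^ 2 / (4 * s)) = (2 / μ) ^ 2 * (Real.pi * s) := by
    field_simp
    norm_num
  have hsq : √(Real.pi / (μ ^ 2 / (4 * s))) = 2 / μ * √(Real.pi * s) := by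
    rw [hq, Real.sqrt_mul (by positivity), Real.sqrt_sq (by positivity)]
  have h0 : 0 < √(Real.pi * s) := Real.sqrt_pos.2 (by positivity)
  rw [hsq, hq]
  have e2 : A * (((2 / μ) ^ 2 * (Real.pi * s) * (2 / μ * √(Real.pi * s)) : ℝ) : ℂ) =
      ((8 * Real.pi / μ ^ 3 : ℝ) : ℂ) * (s : ℂ) * Complex.exp (-s) := by
    rw [← Complex.ofReal_mul, ← Complex.ofReal_neg, ← Complex.ofReal_exp, ← Complex.ofReal_mul,
      ← Complex.ofReal_mul]
    congr 1
    field_simp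
    norm_num
  rw [← mul_assoc, e2, pow_one, mul_assoc, mul_assoc, ← Complex.exp_add]
  congr 3
  rw [expDenom]
  have hsc : (s : ℂ) ≠ 0 := by exact_mod_cast hs.ne'
  push_cast
  field_simp
  ring

theorem continuous_phase_left (ξ : E3) : Continuous fun x : E3 => phase x ξ := by
  unfold phase
  fun_prop

theorem expDenom_div_re_pos {μ m : ℝ} (hm : |m| < μ) (ξ : E3) :
    0 < (expDenom μ m ξ / (μ ^ 2 : ℝ)).re := by
  have hμ : 0 < μ := (abs_nonneg m).trans_lt hm
  rw [Complex.div_ofReal_re, expDenom_re]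
  have := sq_sub_sq_pos hm
  positivity

/-- The exponential is a mixture of Gaussians, whose transforms are known. -/
theorem integral_phase_mul_expField {μ m : ℝ} (hm : |m| < μ) (ξ : E3) :
    ∫ x : E3, phase x ξ * (expField μ m x : ℂ) = 8 * Real.pi * μ / expDenom μ m ξ ^ 2 := by
  have hμ : 0 < μ := (abs_nonneg m).trans_lt hm
  have hpi := Real.pi_pos
  let h : ℝ → E3 → E3 → ℂ := fun s ξ x =>
    phase x ξ * (Real.exp (m * x 0) : ℂ) * (mixDensity (μ * ‖x‖) s : ℂ)
  have hnorm : ∀ s ξ x, ‖h s ξ x‖ = Real.exp (m * x 0) * mixDensity (μ * ‖x‖) s := fun s ξ x => by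
    simp only [h]
    rw [norm_mul, norm_mul, norm_phase, one_mul, Complex.norm_real, Complex.norm_real,
      Real.norm_of_nonneg (Real.exp_pos _).le, Real.norm_of_nonneg (mixDensity_nonneg _ _)]
  have hnormI : ∀ s ∈ Set.Ioi (0 : ℝ), ((∫ x, ‖h s ξ x‖ : ℝ) : ℂ) =
      ((8 * Real.pi / μ ^ 3 : ℝ) : ℂ) *
        ((s : ℂ) ^ 1 * Complex.exp (-(expDenom μ m 0 / (μ ^ 2 : ℝ)) * s)) := fun s hs => by
    rw [← (integral_mixDensity_mul (m := m) hμ hs 0).2, ← integral_complex_ofReal]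
    congr 1
    ext x
    rw [hnorm]
    simp [phase]
  have hmeas : AEStronglyMeasurable (fun p : ℝ × E3 => h p.1 ξ p.2)
      ((volume.restrict (Set.Ioi 0)).prod volume) := by
    have h1 : Measurable fun p : ℝ × E3 => mixDensity (μ * ‖p.2‖) p.1 :=
      measurable_mixDensity.comp (by fun_prop : Measurable fun p : ℝ × E3 => (μ * ‖p.2‖, p.1))
    have h2 : Measurable fun p : ℝ × E3 => phase p.2 ξ :=
      (continuous_phase_left ξ).measurable.comp measurable_snd
    have h3 : Measurable fun p : ℝ × E3 => (Real.exp (m * p.2 0) : ℂ) := by fun_prop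
    exact ((h2.mul h3).mul (Complex.measurable_ofReal.comp h1)).aestronglyMeasurable
  have hint : Integrable (Function.uncurry fun s x => h s ξ x)
      ((volume.restrict (Set.Ioi 0)).prod volume) := by
    refine (integrable_prod_iff hmeas).2 ⟨?_, ?_⟩
    · filter_upwards [ae_restrict_mem measurableSet_Ioi] with s hs
      exact (integral_mixDensity_mul hμ hs ξ).1
    · have h1 := (integral_pow_mul_cexp_neg (expDenom_div_re_pos hm 0) 1).1.const_mul
        ((8 * Real.pi / μ ^ 3 : ℝ) : ℂ)
      refine h1.re.congr ?_
      filter_upwards [ae_restrict_mem measurableSet_Ioi] with s hs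
      rw [← hnormI s hs]
      exact Complex.ofReal_re _
  have hswap := integral_integral_swap hint
  have hlhs : ∫ s in Set.Ioi (0 : ℝ), ∫ x, h s ξ x =
      ((8 * Real.pi / μ ^ 3 : ℝ) : ℂ) * (1 / (expDenom μ m ξ / (μ ^ 2 : ℝ)) ^ 2) := by
    rw [setIntegral_congr_fun measurableSet_Ioi
      fun s hs => (integral_mixDensity_mul (m := m) hμ hs ξ).2, integral_const_mul,
      (integral_pow_mul_cexp_neg (expDenom_div_re_pos hm ξ) 1).2]
    simp
  rw [hlhs] at hswap
  have hne := expDenom_ne_zero hm ξ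
  have hμc : (μ : ℂ) ≠ 0 := by exact_mod_cast hμ.ne'
  have hfin : ∫ x, ∫ s in Set.Ioi (0 : ℝ), h s ξ x =
      ∫ x : E3, phase x ξ * (expField μ m x : ℂ) := by
    refine integral_congr_ae ?_
    filter_upwards [ae_ne_zero] with x hx
    have hr : 0 < μ * ‖x‖ := mul_pos hμ (norm_pos_iff.2 hx)
    simp only [h]
    rw [integral_const_mul, integral_complex_ofReal, (integral_mixDensity hr).2, mul_assoc,
      ← Complex.ofReal_mul, ← Real.exp_add, expField]
    ring_nf
  rw [← hfin, ← hswap]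
  push_cast
  field_simp

/-! ### Exponential modes of the Slezkin–Landau field -/

/-- The unit vectors of `ℝ³`. -/
abbrev unitVec (l : Fin 3) : E3 := EuclideanSpace.single l (1 : ℝ)

theorem inner_unitVec (x : E3) (l : Fin 3) : inner ℝ x (unitVec l) = x l := by
  simp [EuclideanSpace.inner_single_right]

theorem norm_unitVec (l : Fin 3) : ‖unitVec l‖ = 1 := by
  simp

theorem hasDerivAt_apply_line (x : E3) (l j : Fin 3) (t : ℝ) :
    HasDerivAt (fun t : ℝ => (x + t • unitVec l) j) (if j = l then 1 else 0) t := by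
  have h := ((hasDerivAt_id t).mul_const (if j = l then (1 : ℝ) else 0)).const_add (x j)
  rw [one_mul] at h
  refine h.congr_of_eventuallyEq (Filter.Eventually.of_forall fun s => ?_)
  simp

theorem hasDerivAt_norm_line {x : E3} (hx : x ≠ 0) (l : Fin 3) :
    HasDerivAt (fun t : ℝ => ‖x + t • unitVec l‖) (x l / ‖x‖) 0 := by
  have hr : 0 < ‖x‖ := norm_pos_iff.2 hx
  have e : (fun t : ℝ => ‖x + t • unitVec l‖) = fun t : ℝ => √(‖x‖ ^ 2 + 2 * t * x l + t ^ 2) := by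
    ext t
    rw [← Real.sqrt_sq (norm_nonneg (x + t • unitVec l)), norm_add_sq_real, norm_smul,
      inner_smul_right, inner_unitVec, norm_unitVec, mul_one, Real.norm_eq_abs, sq_abs]
    ring_nf
  rw [e]
  have h1 : HasDerivAt (fun t : ℝ => ‖x‖ ^ 2 + 2 * t * x l + t ^ 2) (2 * x l) 0 := by
    have := ((((hasDerivAt_id (0 : ℝ)).const_mul 2).mul_const (x l)).const_add (‖x‖ ^ 2)).add
      ((hasDerivAt_id (0 : ℝ)).pow 2)
    simpa using! this
  have h2 := h1.sqrt (by simpa using hr.ne')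
  refine h2.congr_deriv ?_
  simp [Real.sqrt_sq hr.le]
  field_simp

theorem integrable_pow_mul_exp_neg_norm {a : ℝ} (ha : 0 < a) (n : ℕ) :
    Integrable (fun x : E3 => ‖x‖ ^ n * Real.exp (-a * ‖x‖)) volume := by
  rw [integrable_fun_norm_addHaar (μ := (volume : Measure E3))
    (f := fun y => y ^ n * Real.exp (-a * y)), finrank_E3]
  have h := integrableOn_rpow_mul_exp_neg_mul_rpow (p := 1) (s := (n + 2 : ℕ)) (b := a)
    (by have : (0 : ℝ) ≤ (n + 2 : ℕ) := Nat.cast_nonneg _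
        linarith) one_pos ha
  refine h.congr_fun (fun y hy => ?_) measurableSet_Ioi
  have hy' : (0 : ℝ) < y := hy
  simp only [Real.rpow_one, Real.rpow_natCast, smul_eq_mul]
  rw [pow_add]
  ring

theorem expField_le (μ m : ℝ) (x : E3) : expField μ m x ≤ Real.exp (-(μ - |m|) * ‖x‖) := by
  refine Real.exp_le_exp.2 ?_
  have h1 : m * x 0 ≤ |m| * ‖x‖ := by
    refine (le_abs_self _).trans ?_
    rw [abs_mul]
    gcongr
    exact abs_apply_le x 0
  linarith

theorem integrable_of_le_expField {E : Type*} [NormedAddCommGroup E] {μ m : ℝ} (hm : |m| < μ)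
    {g : E3 → E} (hg : AEStronglyMeasurable g volume) {A B : ℝ} (hA : 0 ≤ A) (hB : 0 ≤ B)
    (h : ∀ x, ‖g x‖ ≤ (A + B * ‖x‖) * expField μ m x) : Integrable g volume := by
  have ha : 0 < μ - |m| := by linarith
  have h0 := (integrable_pow_mul_exp_neg_norm ha 0).const_mul A
  have h1 := (integrable_pow_mul_exp_neg_norm ha 1).const_mul B
  refine (h0.add h1).mono' hg (Filter.Eventually.of_forall fun x => (h x).trans ?_)
  have := expField_le μ m x
  simp only [Pi.add_apply, pow_zero, pow_one, one_mul]
  calc _ ≤ (A + B * ‖x‖) * Real.exp (-(μ - |m|) * ‖x‖) := by gcongr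
    _ = _ := by ring

theorem norm_phase_mul_ofReal (x ξ : E3) (r : ℝ) : ‖phase x ξ * (r : ℂ)‖ = |r| := by
  rw [norm_mul, norm_phase, one_mul, Complex.norm_real, Real.norm_eq_abs]

theorem phase_comm (x ξ : E3) : phase x ξ = phase ξ x := by
  rw [phase, phase, real_inner_comm]

theorem hasDerivAt_phase_line (x ξ : E3) (l : Fin 3) (t : ℝ) :
    HasDerivAt (fun t : ℝ => phase x (ξ + t • unitVec l))
      (Complex.I * x l * phase x (ξ + t • unitVec l)) t := by
  unfold phase
  have h1 : HasDerivAt (fun t : ℝ => inner ℝ x (ξ + t • unitVec l)) (x l) t := by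
    have := ((hasDerivAt_id t).mul_const (x l)).const_add (inner ℝ x ξ)
    rw [one_mul] at this
    refine this.congr_of_eventuallyEq (Filter.Eventually.of_forall fun s => ?_)
    simp only [inner_add_right, inner_smul_right, inner_unitVec, id]
  have h2 := ((h1.ofReal_comp).const_mul Complex.I).cexp
  refine h2.congr_deriv ?_
  ring

theorem hasDerivAt_expDenom_line (μ m : ℝ) (ξ : E3) (l : Fin 3) :
    HasDerivAt (fun t : ℝ => expDenom μ m (ξ + t • unitVec l))
      (2 * (ξ l - Complex.I * m * if l = 0 then 1 else 0)) 0 := by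
  have e : (fun t : ℝ => expDenom μ m (ξ + t • unitVec l)) = fun t : ℝ =>
      ((μ ^ 2 - m ^ 2 + (‖ξ‖ ^ 2 + 2 * t * ξ l + t ^ 2) : ℝ) : ℂ) -
        2 * Complex.I * m * ((ξ 0 + t * if l = 0 then 1 else 0 : ℝ) : ℂ) := by
    ext t
    rw [expDenom, norm_add_sq_real, norm_smul, inner_smul_right, inner_unitVec, norm_unitVec,
      mul_one, Real.norm_eq_abs, sq_abs]
    have : (ξ + t • unitVec l) 0 = ξ 0 + t * if l = 0 then 1 else 0 := by
      simp [eq_comm]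
    rw [this]
    ring_nf
  rw [e]
  have h1 : HasDerivAt (fun t : ℝ => μ ^ 2 - m ^ 2 + (‖ξ‖ ^ 2 + 2 * t * ξ l + t ^ 2))
      (2 * ξ l) 0 := by
    have := (((((hasDerivAt_id (0 : ℝ)).const_mul 2).mul_const (ξ l)).const_add (‖ξ‖ ^ 2)).add
      ((hasDerivAt_id (0 : ℝ)).pow 2)).const_add (μ ^ 2 - m ^ 2)
    simpa using! this
  have h2 : HasDerivAt (fun t : ℝ => ξ 0 + t * if l = 0 then 1 else 0)
      (if l = 0 then 1 else 0) (0 : ℝ) := by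
    simpa using ((hasDerivAt_id (0 : ℝ)).mul_const (if l = 0 then (1 : ℝ) else 0)).const_add (ξ 0)
  have h3 := h1.ofReal_comp.sub (h2.ofReal_comp.const_mul (2 * Complex.I * m))
  refine h3.congr_deriv ?_
  split_ifs <;> push_cast <;> ring

theorem measurable_phase_left (ξ : E3) : Measurable fun x : E3 => phase x ξ :=
  (continuous_phase_left ξ).measurable

theorem integral_phase_mul_coord_mul_expField {μ m : ℝ} (hm : |m| < μ) (ξ : E3) (j : Fin 3) :
    ∫ x : E3, phase x ξ * ((x j * expField μ m x : ℝ) : ℂ) =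
      32 * Real.pi * μ * Complex.I * (ξ j - Complex.I * m * if j = 0 then 1 else 0) /
        expDenom μ m ξ ^ 3 := by
  have hcE := continuous_expField μ m
  have hmeas : ∀ η, AEStronglyMeasurable (fun x : E3 => phase x η * (expField μ m x : ℂ)) volume :=
    fun η => ((continuous_phase_left η).mul (by fun_prop)).aestronglyMeasurable
  have hI : ∀ η, Integrable (fun x : E3 => phase x η * (expField μ m x : ℂ)) volume := fun η =>
    integrable_of_le_expField hm (hmeas η) zero_le_one le_rfl fun x => by
      rw [norm_phase_mul_ofReal, abs_of_pos (expField_pos μ m x)]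
      linarith
  have hb : Integrable (fun x : E3 => ‖x‖ * expField μ m x) volume :=
    integrable_of_le_expField hm (by fun_prop) le_rfl zero_le_one fun x => by
      rw [Real.norm_of_nonneg (mul_nonneg (norm_nonneg x) (expField_pos μ m x).le)]
      linarith
  have h := (hasDerivAt_integral_of_dominated_loc_of_deriv_le (μ := (volume : Measure E3))
    (F := fun (t : ℝ) (x : E3) => phase x (ξ + t • unitVec j) * (expField μ m x : ℂ))
    (F' := fun (t : ℝ) (x : E3) =>
      Complex.I * x j * phase x (ξ + t • unitVec j) * (expField μ m x : ℂ))
    (x₀ := 0) (bound := fun x => ‖x‖ * expField μ m x) (Metric.ball_mem_nhds 0 one_pos)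
    (Filter.Eventually.of_forall fun t => hmeas _) (hI _) ?_ ?_ hb ?_).2
  · have h1 : HasDerivAt (fun t : ℝ => 8 * Real.pi * μ / expDenom μ m (ξ + t • unitVec j) ^ 2)
        (-(32 * Real.pi * μ) * (ξ j - Complex.I * m * if j = 0 then 1 else 0) /
          expDenom μ m ξ ^ 3) 0 := by
      have hd := hasDerivAt_expDenom_line μ m ξ j
      have hne := expDenom_ne_zero hm ξ
      have h2 := (hasDerivAt_const (0 : ℝ) (8 * Real.pi * μ : ℂ)).div (hd.pow 2)
        (by simpa using hne)
      refine h2.congr_deriv ?_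
      simp only [zero_smul, add_zero]
      field_simp
      simp
      ring
    have e : (fun t : ℝ => ∫ x : E3, phase x (ξ + t • unitVec j) * (expField μ m x : ℂ)) =
        fun t : ℝ => 8 * Real.pi * μ / expDenom μ m (ξ + t • unitVec j) ^ 2 :=
      funext fun t => integral_phase_mul_expField hm _
    rw [e] at h
    have h3 := h.unique h1
    have h4 : ∫ x : E3, Complex.I * x j * phase x (ξ + (0 : ℝ) • unitVec j) *
        (expField μ m x : ℂ) =
        Complex.I * ∫ x : E3, phase x ξ * ((x j * expField μ m x : ℝ) : ℂ) := by
      rw [← integral_const_mul]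
      congr 1
      ext x
      rw [zero_smul, add_zero]
      push_cast
      ring
    rw [h4] at h3
    have h5 := congrArg (fun z => -Complex.I * z) h3
    simp only [← mul_assoc, neg_mul, Complex.I_mul_I, neg_neg, one_mul] at h5
    rw [h5]
    ring
  · exact (by
      have := continuous_phase_left (ξ + (0 : ℝ) • unitVec j)
      fun_prop : Continuous fun x : E3 => Complex.I * x j * phase x (ξ + (0 : ℝ) • unitVec j) *
        (expField μ m x : ℂ)).aestronglyMeasurable
  · refine Filter.Eventually.of_forall fun x t _ => ?_
    rw [norm_mul, norm_mul, norm_mul, Complex.norm_I, one_mul, norm_phase, mul_one,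
      Complex.norm_real, Complex.norm_real, Real.norm_of_nonneg (expField_pos μ m x).le]
    exact mul_le_mul_of_nonneg_right (abs_apply_le x j) (expField_pos μ m x).le
  · exact Filter.Eventually.of_forall fun x t _ => (hasDerivAt_phase_line x ξ j t).mul_const _

/-- The derivative of `x_j exp (-μ ‖x‖ + m x₀)` in the direction `e_l`. -/
def coordExpDeriv (μ m : ℝ) (l j : Fin 3) (x : E3) : ℝ :=
  ((if j = l then 1 else 0) + x j * (-μ * (x l / ‖x‖) + m * if l = 0 then 1 else 0)) *
    expField μ m x

theorem abs_div_norm_le (x : E3) (l : Fin 3) : |x l / ‖x‖| ≤ 1 := by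
  rw [abs_div, abs_norm]
  exact div_le_one_of_le₀ (abs_apply_le x l) (norm_nonneg x)

theorem hasLineDerivAt_coord_mul_expField (μ m : ℝ) (l j : Fin 3) (x : E3) :
    HasLineDerivAt ℝ (fun x : E3 => x j * expField μ m x) (coordExpDeriv μ m l j x) x
      (unitVec l) := by
  rw [HasLineDerivAt]
  have hc := hasDerivAt_apply_line x l j 0
  have h0 := hasDerivAt_apply_line x l 0 0
  rcases eq_or_ne x 0 with rfl | hx
  · -- at the origin `‖x‖` is not differentiable, but the factor `x_j` vanishes
    have hcont : Continuous fun t : ℝ => expField μ m ((0 : E3) + t • unitVec l) :=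
      (continuous_expField μ m).comp (by fun_prop)
    rw [hasDerivAt_iff_tendsto_slope]
    have h1 : Filter.Tendsto (fun t : ℝ => (if j = l then 1 else 0) *
        expField μ m ((0 : E3) + t • unitVec l)) (nhdsWithin 0 {0}ᶜ)
        (nhds (coordExpDeriv μ m l j 0)) := by
      have := (hcont.tendsto 0).const_mul (if j = l then (1 : ℝ) else 0)
      convert this.mono_left nhdsWithin_le_nhds using 2
      simp [coordExpDeriv]
    refine h1.congr' ?_
    filter_upwards [self_mem_nhdsWithin] with t ht
    have ht' : t ≠ 0 := ht
    simp only [slope, vsub_eq_sub, sub_zero, smul_eq_mul]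
    by_cases hjl : j = l
    · subst hjl
      simp
      field_simp
    · simp [hjl]
  · have hn := hasDerivAt_norm_line hx l
    have he : HasDerivAt (fun t : ℝ => expField μ m (x + t • unitVec l))
        (expField μ m x * (-μ * (x l / ‖x‖) + m * if (0 : Fin 3) = l then 1 else 0)) 0 := by
      have := ((hn.const_mul (-μ)).add (h0.const_mul m)).exp
      simpa [expField] using this
    have := hc.mul he
    refine this.congr_deriv ?_
    simp only [coordExpDeriv, zero_smul, add_zero, eq_comm (a := (0 : Fin 3))]
    ring

theorem measurable_coordExpDeriv (μ m : ℝ) (l j : Fin 3) : Measurable (coordExpDeriv μ m l j) := by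
  have := (continuous_expField μ m).measurable
  unfold coordExpDeriv
  fun_prop

theorem abs_coordExpDeriv_le (μ m : ℝ) (l j : Fin 3) (x : E3) :
    |coordExpDeriv μ m l j x| ≤ (1 + (|μ| + |m|) * ‖x‖) * expField μ m x := by
  rw [coordExpDeriv, abs_mul, abs_of_pos (expField_pos μ m x)]
  refine mul_le_mul_of_nonneg_right ?_ (expField_pos μ m x).le
  have h1 : |if j = l then (1 : ℝ) else 0| ≤ 1 := by split_ifs <;> simp
  have h2 : |m * if l = 0 then (1 : ℝ) else 0| ≤ |m| := by split_ifs <;> simp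
  have h3 : |-μ * (x l / ‖x‖)| ≤ |μ| := by
    rw [abs_mul, abs_neg]
    exact mul_le_of_le_one_right (abs_nonneg _) (abs_div_norm_le x l)
  calc _ ≤ 1 + ‖x‖ * (|μ| + |m|) := by
        refine (abs_add_le _ _).trans (add_le_add h1 ?_)
        rw [abs_mul]
        exact mul_le_mul (abs_apply_le x j) ((abs_add_le _ _).trans (add_le_add h3 h2))
          (abs_nonneg _) (norm_nonneg x)
    _ = _ := by ring

theorem integrable_phase_mul_ofReal {μ m : ℝ} (hm : |m| < μ) {g : E3 → ℝ} (hg : Measurable g)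
    {A B : ℝ} (hA : 0 ≤ A) (hB : 0 ≤ B) (h : ∀ x, |g x| ≤ (A + B * ‖x‖) * expField μ m x) (ξ : E3) :
    Integrable (fun x : E3 => phase x ξ * (g x : ℂ)) volume :=
  integrable_of_le_expField hm
    ((measurable_phase_left ξ).mul (Complex.measurable_ofReal.comp hg)).aestronglyMeasurable hA hB
    fun x => by rw [norm_phase_mul_ofReal]; exact h x

theorem integral_phase_mul_coordExpDeriv {μ m : ℝ} (hm : |m| < μ) (ξ : E3) (l j : Fin 3) :
    ∫ x : E3, phase x ξ * (coordExpDeriv μ m l j x : ℂ) =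
      32 * Real.pi * μ * ξ l * (ξ j - Complex.I * m * if j = 0 then 1 else 0) /
        expDenom μ m ξ ^ 3 := by
  have hcm : Measurable fun x : E3 => x j * expField μ m x := by
    have := (continuous_expField μ m).measurable
    fun_prop
  have hb1 : ∀ x : E3, |x j * expField μ m x| ≤ (0 + 1 * ‖x‖) * expField μ m x := fun x => by
    rw [abs_mul, abs_of_pos (expField_pos μ m x), zero_add, one_mul]
    exact mul_le_mul_of_nonneg_right (abs_apply_le x j) (expField_pos μ m x).le
  have hi1 := integrable_phase_mul_ofReal hm hcm le_rfl zero_le_one hb1 ξ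
  have hi2 := integrable_phase_mul_ofReal hm (measurable_coordExpDeriv μ m l j) zero_le_one
    (by positivity) (abs_coordExpDeriv_le μ m l j) ξ
  have hg : ∀ x : E3, HasLineDerivAt ℝ (fun x => phase x ξ) (Complex.I * ξ l * phase x ξ) x
      (unitVec l) := fun x => by
    have := hasDerivAt_phase_line ξ x l 0
    rw [zero_smul, add_zero, phase_comm] at this
    rw [HasLineDerivAt]
    simpa only [phase_comm ξ] using this
  have h := integral_bilinear_hasLineDerivAt_right_eq_neg_left_of_integrable
    (μ := (volume : Measure E3)) (B := ContinuousLinearMap.mul ℝ ℂ)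
    (f := fun x => phase x ξ) (f' := fun x => Complex.I * ξ l * phase x ξ)
    (g := fun x : E3 => ((x j * expField μ m x : ℝ) : ℂ))
    (g' := fun x => (coordExpDeriv μ m l j x : ℂ)) (v := unitVec l)
    (by
      have := hi1.const_mul (Complex.I * ξ l)
      refine this.congr (Filter.Eventually.of_forall fun x => ?_)
      simp only [ContinuousLinearMap.mul_apply']
      ring) (by simpa using hi2) (by simpa using hi1) (fun x _ => hg x)
    (fun x _ => (hasLineDerivAt_coord_mul_expField μ m l j x).ofReal_comp)
  simp only [ContinuousLinearMap.mul_apply'] at h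
  rw [h]
  simp_rw [mul_assoc (Complex.I * (ξ l : ℂ))]
  rw [integral_const_mul, integral_phase_mul_coord_mul_expField hm]
  linear_combination (-32 * Real.pi * μ * ξ l * (ξ j - Complex.I * m * if j = 0 then 1 else 0) /
        expDenom μ m ξ ^ 3) * Complex.I_mul_I

/-- The divergence free field `2 curl (e₀ × x f)` for the function `f = exp (-μ ‖x‖ + m x₀)`: its
components are `2 (δ_{j0} div (x f) - ∂₀ (x_j f))`. -/
def expMode (μ m : ℝ) (j : Fin 3) (x : E3) : ℝ :=
  2 * ((if j = 0 then ∑ l, coordExpDeriv μ m l l x else 0) - coordExpDeriv μ m 0 j x)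

theorem measurable_expMode (μ m : ℝ) (j : Fin 3) : Measurable (expMode μ m j) := by
  have := fun l j => measurable_coordExpDeriv μ m l j
  unfold expMode
  split_ifs <;> fun_prop

theorem expMode_eq (μ m : ℝ) (j : Fin 3) {x : E3} (hx : x ≠ 0) :
    expMode μ m j x = 2 * ((if j = 0 then 2 - μ * ‖x‖ + m * x 0 else 0) +
      x j * (μ * (x 0 / ‖x‖) - m)) * expField μ m x := by
  have hr : ‖x‖ ≠ 0 := norm_ne_zero_iff.2 hx
  have h : x 0 * (x 0 / ‖x‖) + x 1 * (x 1 / ‖x‖) + x 2 * (x 2 / ‖x‖) = ‖x‖ := by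
    have := EuclideanSpace.real_norm_sq_eq x
    rw [Fin.sum_univ_three] at this
    field_simp
    linarith
  by_cases h0 : j = 0
  · subst h0
    simp [expMode, coordExpDeriv, Fin.sum_univ_three]
    linear_combination (-2 * μ * expField μ m x) * h
  · simp [expMode, coordExpDeriv, h0]
    ring

theorem abs_expMode_le (μ m : ℝ) (j : Fin 3) (x : E3) :
    |expMode μ m j x| ≤ (8 + 8 * (|μ| + |m|) * ‖x‖) * expField μ m x := by
  have h := fun l j => abs_coordExpDeriv_le μ m l j x
  have h0 : 0 ≤ (1 + (|μ| + |m|) * ‖x‖) * expField μ m x :=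
    mul_nonneg (by positivity) (expField_pos μ m x).le
  have h1 : |if j = 0 then ∑ l, coordExpDeriv μ m l l x else 0| ≤
      3 * ((1 + (|μ| + |m|) * ‖x‖) * expField μ m x) := by
    split_ifs
    · rw [Fin.sum_univ_three]
      refine (abs_add_le _ _).trans ?_
      linarith [abs_add_le (coordExpDeriv μ m 0 0 x) (coordExpDeriv μ m 1 1 x), h 0 0, h 1 1, h 2 2]
    · simpa using h0
  rw [expMode, abs_mul, abs_two]
  linarith [abs_sub (if j = 0 then ∑ l, coordExpDeriv μ m l l x else 0) (coordExpDeriv μ m 0 j x),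
    h 0 j]

theorem continuousAt_expMode (μ m : ℝ) (j : Fin 3) {x : E3} (hx : x ≠ 0) :
    ContinuousAt (expMode μ m j) x := by
  have hr : ‖x‖ ≠ 0 := norm_ne_zero_iff.2 hx
  have hE := (continuous_expField μ m).continuousAt (x := x)
  unfold expMode coordExpDeriv
  split_ifs <;> fun_prop (disch := assumption)

/-- The numerator `δ_{j0} ‖ξ‖² - ξ₀ ξ_j` of the symbol of the Leray projector. -/
def lerayNum (ξ : E3) (j : Fin 3) : ℝ := (if j = 0 then ‖ξ‖ ^ 2 else 0) - ξ 0 * ξ j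

theorem integral_phase_mul_expMode {μ m : ℝ} (hm : |m| < μ) (ξ : E3) (j : Fin 3) :
    ∫ x : E3, phase x ξ * (expMode μ m j x : ℂ) =
      64 * Real.pi * μ * lerayNum ξ j / expDenom μ m ξ ^ 3 := by
  have hi := fun l j =>
    integrable_phase_mul_ofReal hm (measurable_coordExpDeriv μ m l j) zero_le_one
    (by positivity) (abs_coordExpDeriv_le μ m l j) ξ
  have hI := fun l j => integral_phase_mul_coordExpDeriv hm ξ l j
  have hsq : ((‖ξ‖ ^ 2 : ℝ) : ℂ) = ξ 0 * ξ 0 + ξ 1 * ξ 1 + ξ 2 * ξ 2 := by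
    rw [← sum_ofReal_sq, Fin.sum_univ_three]
    ring
  by_cases h0 : j = 0
  · subst h0
    have e : (fun x : E3 => phase x ξ * (expMode μ m 0 x : ℂ)) = fun x =>
        2 * (phase x ξ * (coordExpDeriv μ m 1 1 x : ℂ) +
          phase x ξ * (coordExpDeriv μ m 2 2 x : ℂ)) := by
      ext x
      simp only [expMode, Fin.sum_univ_three]
      simp
      ring
    rw [e, integral_const_mul, integral_add (hi 1 1) (hi 2 2), hI, hI]
    simp only [lerayNum, if_true, Complex.ofReal_sub, Complex.ofReal_mul, hsq]
    simp
    ring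
  · have e : (fun x : E3 => phase x ξ * (expMode μ m j x : ℂ)) = fun x =>
        -2 * (phase x ξ * (coordExpDeriv μ m 0 j x : ℂ)) := by
      ext x
      simp only [expMode, if_neg h0]
      push_cast
      ring
    rw [e, integral_const_mul, hI]
    simp only [lerayNum, if_neg h0]
    push_cast
    ring

/-! ### The Slezkin–Landau field as a superposition of exponential modes -/

theorem integral_pow_mul_exp_neg {p : ℝ} (hp : 0 < p) (n : ℕ) :
    IntegrableOn (fun t : ℝ => t ^ n * Real.exp (-p * t)) (Set.Ioi 0) ∧
      ∫ t in Set.Ioi (0 : ℝ), t ^ n * Real.exp (-p * t) = n.factorial / p ^ (n + 1) := by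
  have e : (fun t : ℝ => (t : ℂ) ^ n * Complex.exp (-(p : ℂ) * t)) =
      fun t : ℝ => ((t ^ n * Real.exp (-p * t) : ℝ) : ℂ) := by
    ext t
    push_cast
    rfl
  obtain ⟨h1, h2⟩ := integral_pow_mul_cexp_neg (w := (p : ℂ)) hp n
  rw [e] at h1 h2
  refine ⟨h1.re, ?_⟩
  rw [integral_complex_ofReal] at h2
  exact_mod_cast h2

/-- The sign of `c` as a real number. -/
def signR (c : ℝ) : ℝ := SignType.sign c

theorem signR_mul_abs (c : ℝ) : signR c * |c| = c := sign_mul_abs c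

theorem signR_mul_self {c : ℝ} (hc : c ≠ 0) : signR c * signR c = 1 := by
  rcases lt_or_gt_of_ne hc with h | h <;> simp [signR, h]

theorem abs_signR {c : ℝ} (hc : c ≠ 0) : |signR c| = 1 := by
  rcases lt_or_gt_of_ne hc with h | h <;> simp [signR, h]

/-- The modes of which the Slezkin–Landau field `V^c` is the superposition over `k > 0`. -/
def landauMode (c k : ℝ) (j : Fin 3) (x : E3) : ℝ :=
  signR c * expMode (k * |c|) (signR c * k) j x

/-- The Fourier transform of `landauMode`. -/
def landauModeHat (c k : ℝ) (j : Fin 3) (ξ : E3) : ℂ :=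
  64 * Real.pi * k * c * lerayNum ξ j / expDenom (k * |c|) (signR c * k) ξ ^ 3

/-- The Fourier transform of the Slezkin–Landau field. -/
def landauHat (c : ℝ) (j : Fin 3) (ξ : E3) : ℂ := ∫ k in Set.Ioi (0 : ℝ), landauModeHat c k j ξ

theorem abs_lerayNum_le (ξ : E3) (j : Fin 3) : |lerayNum ξ j| ≤ 2 * ‖ξ‖ ^ 2 := by
  have h1 : |ξ 0 * ξ j| ≤ ‖ξ‖ ^ 2 := by
    rw [abs_mul, sq]
    exact mul_le_mul (abs_apply_le ξ 0) (abs_apply_le ξ j) (abs_nonneg _) (norm_nonneg ξ)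
  have h2 : |if j = 0 then ‖ξ‖ ^ 2 else 0| ≤ ‖ξ‖ ^ 2 := by
    split_ifs
    · rw [abs_of_nonneg (by positivity)]
    · rw [abs_zero]; positivity
  rw [lerayNum]
  linarith [abs_sub (if j = 0 then ‖ξ‖ ^ 2 else 0) (ξ 0 * ξ j)]

theorem abs_signR_mul_lt {c k : ℝ} (hc : 1 < |c|) (hk : 0 < k) : |signR c * k| < k * |c| := by
  have hc0 : c ≠ 0 := fun h => by simp [h] at hc; linarith
  rw [abs_mul, abs_signR hc0, one_mul, abs_of_pos hk]
  nlinarith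

theorem measurable_expField_uncurry {a b : ℝ} :
    Measurable fun p : ℝ × E3 => expField (p.1 * a) (b * p.1) p.2 := by
  unfold expField
  fun_prop

theorem measurable_landauMode_uncurry (c : ℝ) (j : Fin 3) :
    Measurable fun p : ℝ × E3 => landauMode c p.1 j p.2 := by
  have := measurable_expField_uncurry (a := |c|) (b := signR c)
  unfold landauMode expMode coordExpDeriv
  split_ifs <;> fun_prop

theorem measurable_lerayNum (j : Fin 3) : Measurable fun ξ : E3 => lerayNum ξ j := by
  unfold lerayNum
  split_ifs <;> fun_prop

theorem measurable_landauModeHat_uncurry (c : ℝ) (j : Fin 3) :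
    Measurable fun p : ℝ × E3 => landauModeHat c p.1 j p.2 := by
  have := measurable_lerayNum j
  unfold landauModeHat expDenom
  fun_prop

theorem measurable_landauHat (c : ℝ) (j : Fin 3) : Measurable (landauHat c j) := by
  have h := ((measurable_landauModeHat_uncurry c j).comp
    measurable_swap).stronglyMeasurable.integral_prod_right' (ν := volume.restrict (Set.Ioi 0))
  exact h.measurable

theorem integrable_phase_mul_landauMode {c k : ℝ} (hc : 1 < |c|) (hk : 0 < k) (j : Fin 3) (ξ : E3) :
    Integrable (fun x : E3 => phase x ξ * (landauMode c k j x : ℂ)) volume := by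
  have h := (integrable_phase_mul_ofReal (abs_signR_mul_lt hc hk) (measurable_expMode _ _ j)
    (by norm_num : (0 : ℝ) ≤ 8) (by positivity) (abs_expMode_le _ _ j) ξ).const_mul (signR c : ℂ)
  refine h.congr (Filter.Eventually.of_forall fun x => ?_)
  simp only [landauMode]
  push_cast
  ring

theorem integral_phase_mul_landauMode {c k : ℝ} (hc : 1 < |c|) (hk : 0 < k) (j : Fin 3) (ξ : E3) :
    ∫ x : E3, phase x ξ * (landauMode c k j x : ℂ) = landauModeHat c k j ξ := by
  have e : ∀ x : E3, phase x ξ * (landauMode c k j x : ℂ) =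
      (signR c : ℂ) * (phase x ξ * (expMode (k * |c|) (signR c * k) j x : ℂ)) := fun x => by
    simp only [landauMode]
    push_cast
    ring
  simp_rw [e]
  rw [integral_const_mul, integral_phase_mul_expMode (abs_signR_mul_lt hc hk), landauModeHat]
  have : (c : ℂ) = (signR c : ℂ) * (|c| : ℝ) := by
    rw [← Complex.ofReal_mul, signR_mul_abs]
  rw [this]
  push_cast
  ring

theorem expField_landau_le {c k : ℝ} (hc : 1 < |c|) (hk : 0 ≤ k) (x : E3) :
    expField (k * |c|) (signR c * k) x ≤ Real.exp (-((|c| - 1) * ‖x‖) * k) := by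
  have hc0 : c ≠ 0 := fun h => by simp [h] at hc; linarith
  refine (expField_le _ _ x).trans (Real.exp_le_exp.2 ?_)
  rw [abs_mul, abs_signR hc0, one_mul, abs_of_nonneg hk]
  linarith

/-- A majorant of the modes which depends on the distance to the origin only. -/
def landauModeBound (c k r : ℝ) : ℝ :=
  8 * (k ^ 0 * Real.exp (-((|c| - 1) * r) * k)) +
    8 * (|c| + 1) * r * (k ^ 1 * Real.exp (-((|c| - 1) * r) * k))

theorem abs_landauMode_le {c k : ℝ} (hc : 1 < |c|) (hk : 0 ≤ k) (j : Fin 3) (x : E3) :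
    |landauMode c k j x| ≤ landauModeBound c k ‖x‖ := by
  have hc0 : c ≠ 0 := fun h => by simp [h] at hc; linarith
  rw [landauMode, abs_mul, abs_signR hc0, one_mul]
  refine (abs_expMode_le _ _ j x).trans ?_
  rw [abs_mul, abs_abs, abs_mul, abs_signR hc0, one_mul, abs_of_nonneg hk]
  calc _ ≤ (8 + 8 * (k * |c| + k) * ‖x‖) * Real.exp (-((|c| - 1) * ‖x‖) * k) := by
        gcongr
        exact expField_landau_le hc hk x
    _ = _ := by rw [landauModeBound]; ring

/-- The constant in the bound `C / r` for the superposition of the modes. -/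
def landauModeConst (c : ℝ) : ℝ := 8 / (|c| - 1) + 8 * (|c| + 1) / (|c| - 1) ^ 2

theorem integral_landauModeBound {c r : ℝ} (hc : 1 < |c|) (hr : 0 < r) :
    IntegrableOn (fun k => landauModeBound c k r) (Set.Ioi 0) ∧
      ∫ k in Set.Ioi (0 : ℝ), landauModeBound c k r = landauModeConst c * r⁻¹ := by
  have ha : 0 < |c| - 1 := by linarith
  have hp : 0 < (|c| - 1) * r := by positivity
  obtain ⟨i0, e0⟩ := integral_pow_mul_exp_neg hp 0
  obtain ⟨i1, e1⟩ := integral_pow_mul_exp_neg hp 1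
  refine ⟨(i0.const_mul _).add (i1.const_mul _), ?_⟩
  simp only [landauModeBound]
  rw [integral_add (i0.const_mul _) (i1.const_mul _), integral_const_mul, integral_const_mul,
    e0, e1, landauModeConst]
  simp
  field_simp

theorem integral_landauMode {c : ℝ} (hc : 1 < |c|) (j : Fin 3) {x : E3} (hx : x ≠ 0) :
    ∫ k in Set.Ioi (0 : ℝ), landauMode c k j x = landauField c x j := by
  have hc0 : c ≠ 0 := fun h => by simp [h] at hc; linarith
  have hr : 0 < ‖x‖ := norm_pos_iff.2 hx
  set σ := signR c with hσ
  have hσσ : σ * σ = 1 := signR_mul_self hc0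
  have hσc : σ * |c| = c := signR_mul_abs c
  have hσc' : |c| = σ * c := by
    calc |c| = σ * (σ * |c|) := by rw [← mul_assoc, hσσ, one_mul]
      _ = σ * c := by rw [hσc]
  set q := c * ‖x‖ - x 0 with hq
  have hp : 0 < σ * q := by
    have h1 : σ * q = |c| * ‖x‖ - σ * x 0 := by rw [hq, hσc']; ring
    have h2 : |σ * x 0| ≤ ‖x‖ := by
      rw [abs_mul, abs_signR hc0, one_mul]
      exact abs_apply_le x 0
    have := (abs_le.1 h2).2
    rw [h1]
    nlinarith
  have hq0 : q ≠ 0 := fun h => by simp [h] at hp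
  obtain ⟨i0, e0⟩ := integral_pow_mul_exp_neg hp 0
  obtain ⟨i1, e1⟩ := integral_pow_mul_exp_neg hp 1
  set A : ℝ := if j = 0 then 4 * σ else 0
  set B : ℝ := (if j = 0 then -2 * q else 0) + 2 * x j * (c * (x 0 / ‖x‖) - 1)
  have e : ∀ k : ℝ, landauMode c k j x =
      A * (k ^ 0 * Real.exp (-(σ * q) * k)) + B * (k ^ 1 * Real.exp (-(σ * q) * k)) := fun k => by
    have h1 : -(k * |c|) * ‖x‖ + σ * k * x 0 = -(σ * q) * k := by rw [hq, hσc']; ring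
    rw [landauMode, expMode_eq _ _ _ hx, expField, ← hσ, h1]
    simp only [A, B]
    split_ifs
    · rw [hq, hσc']
      linear_combination (-2 * k * c * ‖x‖ + 2 * k * x 0 +
        2 * x j * k * (c * (x 0 / ‖x‖) - 1)) * Real.exp (-(σ * (c * ‖x‖ - x 0)) * k) * hσσ
    · rw [hσc']
      linear_combination 2 * x j * k * (c * (x 0 / ‖x‖) - 1) * Real.exp (-(σ * q) * k) * hσσ
  simp_rw [e]
  rw [integral_add (i0.const_mul _) (i1.const_mul _), integral_const_mul, integral_const_mul,
    e0, e1]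
  have hσ0 : σ ≠ 0 := fun h => by simp [h] at hσσ
  have hσi : (σ * q) ^ 2 = q ^ 2 := by rw [mul_pow, sq σ, hσσ, one_mul]
  have hσj : σ / (σ * q) = 1 / q := by field_simp
  have h4 : A * (((0 : ℕ).factorial : ℝ) / (σ * q) ^ (0 + 1)) =
      if j = 0 then 4 * (1 / q) else 0 := by
    simp only [A]
    split_ifs
    · rw [← hσj]
      simp
      field_simp
    · simp
  rw [h4, hσi]
  simp only [B]
  fin_cases j <;> simp [landauField, ← hq] <;> field_simp
  rw [hq]
  ring

theorem sq_sub_one_pos {c : ℝ} (hc : 1 < |c|) : 0 < c ^ 2 - 1 := by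
  have := (one_lt_sq_iff_one_lt_abs c).2 hc
  linarith

/-- The constant in the bound of the Fourier transform of the Slezkin–Landau field. -/
def landauHatConst (c : ℝ) : ℝ := 32 * Real.pi * |c| / (c ^ 2 - 1)

theorem landauHatConst_nonneg {c : ℝ} (hc : 1 < |c|) : 0 ≤ landauHatConst c := by
  have := sq_sub_one_pos hc
  have := Real.pi_pos
  unfold landauHatConst
  positivity

theorem integral_div_quadratic_pow_three {a b : ℝ} (ha : 0 < a) (hb : 0 < b) :
    IntegrableOn (fun k : ℝ => k / (k ^ 2 * a + b) ^ 3) (Set.Ioi 0) ∧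
      ∫ k in Set.Ioi (0 : ℝ), k / (k ^ 2 * a + b) ^ 3 = 1 / (4 * a * b ^ 2) := by
  have hpos : ∀ k : ℝ, 0 < k ^ 2 * a + b := fun k => by positivity
  have hd : ∀ k : ℝ, HasDerivAt (fun k : ℝ => -(1 / (4 * a)) * ((k ^ 2 * a + b) ^ 2)⁻¹)
      (k / (k ^ 2 * a + b) ^ 3) k := fun k => by
    have h1 := (((((hasDerivAt_id k).pow 2).mul_const a).add_const b).pow 2).inv
      (by simpa using (hpos k).ne')
    have h2 := h1.const_mul (-(1 / (4 * a)))
    refine h2.congr_deriv ?_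
    have := (hpos k).ne'
    simp
    field_simp
    norm_num
  have ht : Filter.Tendsto (fun k : ℝ => -(1 / (4 * a)) * ((k ^ 2 * a + b) ^ 2)⁻¹) Filter.atTop
      (nhds 0) := by
    rw [← mul_zero (-(1 / (4 * a)))]
    refine Filter.Tendsto.const_mul _ (Filter.Tendsto.inv_tendsto_atTop ?_)
    refine (Filter.tendsto_pow_atTop two_ne_zero).comp ?_
    exact Filter.tendsto_atTop_add_const_right _ _
      ((Filter.tendsto_pow_atTop two_ne_zero).atTop_mul_const ha)
  have hcont := (hd 0).continuousAt.continuousWithinAt (s := Set.Ici 0)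
  have hnn : ∀ k ∈ Set.Ioi (0 : ℝ), 0 ≤ k / (k ^ 2 * a + b) ^ 3 := fun k hk =>
    div_nonneg (le_of_lt hk) (pow_nonneg (hpos k).le 3)
  refine ⟨integrableOn_Ioi_deriv_of_nonneg hcont (fun k _ => hd k) hnn ht, ?_⟩
  rw [integral_Ioi_of_hasDerivAt_of_nonneg hcont (fun k _ => hd k) hnn ht]
  simp
  field_simp

/-- A majorant of the Fourier transforms of the modes. -/
def landauModeHatBound (c k r : ℝ) : ℝ :=
  128 * Real.pi * |c| * r ^ 2 * (k / (k ^ 2 * (c ^ 2 - 1) + r ^ 2) ^ 3)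

theorem norm_landauModeHat_le {c k : ℝ} (hc : 1 < |c|) (hk : 0 < k) (j : Fin 3) (ξ : E3) :
    ‖landauModeHat c k j ξ‖ ≤ landauModeHatBound c k ‖ξ‖ := by
  have hc0 : c ≠ 0 := fun h => by simp [h] at hc; linarith
  have hpi := Real.pi_pos
  have hD := le_norm_expDenom (k * |c|) (signR c * k) ξ
  have ha := sq_sub_one_pos hc
  have e : (k * |c|) ^ 2 - (signR c * k) ^ 2 = k ^ 2 * (c ^ 2 - 1) := by
    rw [mul_pow, mul_pow, sq_abs, sq (signR c), signR_mul_self hc0]; ring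
  rw [e] at hD
  rw [landauModeHat, norm_div, norm_pow, landauModeHatBound]
  have hn : ‖(64 * Real.pi * k * c * lerayNum ξ j : ℂ)‖ ≤ 128 * Real.pi * |c| * ‖ξ‖ ^ 2 * k := by
    rw [show (64 * Real.pi * k * c * lerayNum ξ j : ℂ) =
      ((64 * Real.pi * k * c * lerayNum ξ j : ℝ) : ℂ) by push_cast; ring, Complex.norm_real,
      Real.norm_eq_abs, abs_mul, abs_mul, abs_of_pos (by positivity : 0 < 64 * Real.pi * k)]
    calc _ ≤ 64 * Real.pi * k * |c| * (2 * ‖ξ‖ ^ 2) := by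
          gcongr
          exact abs_lerayNum_le ξ j
      _ = _ := by ring
  have hpos : 0 < k ^ 2 * (c ^ 2 - 1) + ‖ξ‖ ^ 2 := by positivity
  rw [← mul_div_assoc]
  gcongr

theorem integral_landauModeHatBound {c r : ℝ} (hc : 1 < |c|) (hr : 0 < r) :
    IntegrableOn (fun k => landauModeHatBound c k r) (Set.Ioi 0) ∧
      ∫ k in Set.Ioi (0 : ℝ), landauModeHatBound c k r = landauHatConst c * (r ^ 2)⁻¹ := by
  have ha := sq_sub_one_pos hc
  obtain ⟨h1, h2⟩ := integral_div_quadratic_pow_three ha (by positivity : 0 < r ^ 2)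
  refine ⟨h1.const_mul _, ?_⟩
  simp only [landauModeHatBound]
  rw [integral_const_mul, h2, landauHatConst]
  field_simp
  norm_num

theorem norm_landauHat_le {c : ℝ} (hc : 1 < |c|) (j : Fin 3) (ξ : E3) :
    ‖landauHat c j ξ‖ ≤ landauHatConst c * (‖ξ‖ ^ 2)⁻¹ := by
  rcases eq_or_ne ξ 0 with rfl | hξ
  · simp [landauHat, landauModeHat, lerayNum]
  · have hr : 0 < ‖ξ‖ := norm_pos_iff.2 hξ
    obtain ⟨h1, h2⟩ := integral_landauModeHatBound hc hr
    rw [← h2]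
    refine norm_integral_le_of_norm_le h1 ?_
    filter_upwards [ae_restrict_mem measurableSet_Ioi] with k hk
    exact norm_landauModeHat_le hc hk j ξ

attribute [irreducible] landauMode landauModeHat landauModeBound landauModeHatBound landauModeConst
  landauHatConst

/-! ### Fourier transforms of the Slezkin–Landau field and of products of its components -/

theorem integrable_prod_of_le {X Y : Type*} [MeasurableSpace X] [MeasurableSpace Y]
    {μ : Measure X} {ν : Measure Y} [SFinite μ] [SFinite ν] {F : X × Y → ℂ}
    (hF : AEStronglyMeasurable F (μ.prod ν)) {B : X → Y → ℝ} {C : Y → ℝ} (hC : Integrable C ν)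
    (hB : ∀ᵐ y ∂ν, Integrable (fun x => B x y) μ ∧ ∫ x, B x y ∂μ ≤ C y ∧
      ∀ᵐ x ∂μ, ‖F (x, y)‖ ≤ B x y) : Integrable F (μ.prod ν) := by
  refine (integrable_prod_iff' hF).2 ⟨?_, ?_⟩
  · filter_upwards [hB, hF.prod_swap.prodMk_left] with y ⟨h1, _, h3⟩ hm
    exact h1.mono' hm h3
  · refine hC.mono' ?_ ?_
    · exact hF.norm.prod_swap.integral_prod_right'
    · filter_upwards [hB] with y ⟨h1, h2, h3⟩
      rw [Real.norm_of_nonneg (integral_nonneg fun _ => norm_nonneg _)]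
      exact (integral_mono_of_nonneg (Filter.Eventually.of_forall fun _ => norm_nonneg _)
        h1 h3).trans h2

/-- Two families of integrals that agree for almost every parameter have superpositions that
agree. -/
theorem integral_superposition {X Y Z : Type*} [MeasurableSpace X] [MeasurableSpace Y]
    [MeasurableSpace Z] {μ : Measure X} {ν : Measure Y} {ρ : Measure Z} [SFinite μ] [SFinite ν]
    [SFinite ρ] {F : X × Y → ℂ} {G : X × Z → ℂ} (hF : Integrable F (μ.prod ν))
    (hG : Integrable G (μ.prod ρ))
    (h : ∀ᵐ x ∂μ, Integrable (fun z => G (x, z)) ρ → ∫ y, F (x, y) ∂ν = ∫ z, G (x, z) ∂ρ) :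
    ∫ y, ∫ x, F (x, y) ∂μ ∂ν = ∫ z, ∫ x, G (x, z) ∂μ ∂ρ := by
  rw [← integral_integral_swap (f := fun x y => F (x, y)) hF,
    ← integral_integral_swap (f := fun x z => G (x, z)) hG]
  refine integral_congr_ae ?_
  filter_upwards [h, hG.prod_right_ae] with x hx hGx
  exact hx hGx

theorem hatSchwartz_eq_phase (φ : 𝓢(E3, ℂ)) (x : E3) :
    hatSchwartz φ x = ∫ y, phase y x * φ y := hatSchwartz_apply φ x

theorem continuous_phase : Continuous fun p : E3 × E3 => phase p.1 p.2 := by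
  unfold phase
  fun_prop

theorem phase_add_left (a b ξ : E3) : phase (a + b) ξ = phase a ξ * phase b ξ := by
  rw [phase, phase, phase, ← Complex.exp_add, inner_add_left]
  congr 1
  push_cast
  ring

theorem phase_add_right (a ξ η : E3) : phase a (ξ + η) = phase a ξ * phase a η := by
  rw [phase_comm, phase_add_left, phase_comm ξ, phase_comm η]

theorem integrable_mul_prod_of_norm_le_one {f g : E3 → ℂ} (hf : Integrable f volume)
    (hg : Integrable g volume) {p : E3 × E3 → ℂ} (hp : Continuous p) (hp1 : ∀ z, ‖p z‖ ≤ 1) :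
    Integrable (fun z : E3 × E3 => p z * (f z.1 * g z.2)) (volume.prod volume) :=
  (hf.mul_prod hg).bdd_mul (c := 1) hp.aestronglyMeasurable (Filter.Eventually.of_forall hp1)

theorem integral_hatSchwartz_mul (φ : 𝓢(E3, ℂ)) {f : E3 → ℂ} (hf : Integrable f volume) :
    ∫ x, hatSchwartz φ x * f x = ∫ y, φ y * ∫ x, phase x y * f x := by
  have hi := integrable_mul_prod_of_norm_le_one hf φ.integrable
    (p := fun z => phase z.2 z.1) (continuous_phase.comp continuous_swap)
    fun z => (norm_phase _ _).le
  have hsw := integral_integral_swap (f := fun x y => phase y x * (f x * φ y)) hi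
  calc ∫ x, hatSchwartz φ x * f x = ∫ x, ∫ y, phase y x * (f x * φ y) := by
        congr 1
        ext x
        rw [hatSchwartz_eq_phase, ← integral_mul_const]
        congr 1
        ext y
        ring
    _ = _ := by
        rw [hsw]
        congr 1
        ext y
        rw [← integral_const_mul]
        congr 1
        ext x
        rw [phase_comm]
        ring

theorem integrable_landauMode {c k : ℝ} (hc : 1 < |c|) (hk : 0 < k) (j : Fin 3) :
    Integrable (fun x : E3 => (landauMode c k j x : ℂ)) volume := by
  simpa [phase] using integrable_phase_mul_landauMode hc hk j 0

theorem measurable_landauField (c : ℝ) (j : Fin 3) :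
    Measurable fun x : E3 => landauField c x j := by
  fin_cases j <;> simp [landauField] <;> fun_prop

theorem integral_hatSchwartz_mul_landauMode {c k : ℝ} (hc : 1 < |c|) (hk : 0 < k) (j : Fin 3)
    (a : E3) (φ : 𝓢(E3, ℂ)) :
    ∫ x, hatSchwartz φ x * (landauMode c k j (x - a) : ℂ) =
      ∫ ξ, φ ξ * (phase a ξ * landauModeHat c k j ξ) := by
  rw [integral_hatSchwartz_mul φ ((integrable_landauMode hc hk j).comp_sub_right a)]
  congr 1
  ext ξ
  congr 1
  rw [← integral_phase_mul_landauMode hc hk, ← integral_const_mul,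
    ← integral_add_right_eq_self _ a]
  congr 1
  ext x
  rw [add_sub_cancel_right, phase_add_left]
  ring

theorem integrable_inv_mul_norm_schwartz_sub (φ : 𝓢(E3, ℂ)) (a : E3) :
    Integrable (fun x => ‖x - a‖⁻¹ * ‖φ x‖) volume := by
  have h := (integrable_inv_mul_norm_schwartz (φ.compSubConstCLM ℂ (-a))).comp_sub_right a
  refine h.congr (Filter.Eventually.of_forall fun x => ?_)
  simp

theorem ae_ne (a : E3) : ∀ᵐ x : E3, x ≠ a := by
  simp [ae_iff]

theorem integrable_schwartz_mul_landauMode {c : ℝ} (hc : 1 < |c|) (j : Fin 3) (a : E3)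
    {f : E3 → ℂ} (hf : AEStronglyMeasurable f volume)
    (hfi : Integrable (fun x => ‖x - a‖⁻¹ * ‖f x‖) volume) :
    Integrable (fun p : ℝ × E3 => f p.2 * (landauMode c p.1 j (p.2 - a) : ℂ))
      ((volume.restrict (Set.Ioi 0)).prod volume) := by
  have hs : Measurable fun p : ℝ × E3 => (p.1, p.2 - a) := by fun_prop
  have hm0 : Measurable fun p : ℝ × E3 => landauMode c p.1 j (p.2 - a) :=
    (measurable_landauMode_uncurry c j).comp hs
  have hm : Measurable fun p : ℝ × E3 => (landauMode c p.1 j (p.2 - a) : ℂ) :=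
    Complex.measurable_ofReal.comp hm0
  have hFm : AEStronglyMeasurable
      (fun p : ℝ × E3 => f p.2 * (landauMode c p.1 j (p.2 - a) : ℂ))
      ((volume.restrict (Set.Ioi 0)).prod volume) := hf.comp_snd.mul hm.aestronglyMeasurable
  refine integrable_prod_of_le (B := fun k x => ‖f x‖ * landauModeBound c k ‖x - a‖)
    hFm (hfi.const_mul (landauModeConst c)) ?_
  filter_upwards [ae_ne a] with x hx
  obtain ⟨h1, h2⟩ := integral_landauModeBound hc (norm_pos_iff.2 (sub_ne_zero.2 hx))
  refine ⟨h1.const_mul _, ?_, ?_⟩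
  · rw [integral_const_mul, h2]
    exact le_of_eq (by ring)
  · filter_upwards [ae_restrict_mem measurableSet_Ioi] with k hk
    rw [norm_mul, Complex.norm_real]
    exact mul_le_mul_of_nonneg_left (abs_landauMode_le hc (le_of_lt hk) j _) (norm_nonneg _)

/-- The Fourier transform of the field is found mode by mode. -/
theorem isFun_hat_landau {c : ℝ} (hc : 1 < |c|) (a : E3) (j : Fin 3) :
    IsFun (hat (landau c a j)) fun ξ => phase a ξ * landauHat c j ξ := by
  have hpm : Measurable fun ξ => phase a ξ :=
    (continuous_phase.comp (by fun_prop : Continuous fun ξ : E3 => (a, ξ))).measurable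
  have hb : ∀ ξ, ‖phase a ξ * landauHat c j ξ‖ ≤ landauHatConst c * (‖ξ‖ ^ 2)⁻¹ := fun ξ => by
    rw [norm_mul, norm_phase, one_mul]
    exact norm_landauHat_le hc j ξ
  obtain ⟨T, hT⟩ := exists_isFun_of_le_inv_sq
    (hpm.mul (measurable_landauHat c j)).aestronglyMeasurable (Filter.Eventually.of_forall hb)
  suffices h : hat (landau c a j) = T by rwa [h]
  ext φ
  rw [hat_apply, ((isFun_landau hc a j).2 _).2, (hT.2 φ).2]
  have hF := integrable_schwartz_mul_landauMode hc j a
    (hatSchwartz φ).continuous.aestronglyMeasurable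
    (integrable_inv_mul_norm_schwartz_sub (hatSchwartz φ) a)
  have hGm : Measurable fun p : ℝ × E3 => φ p.2 * (phase a p.2 * landauModeHat c p.1 j p.2) := by
    have := measurable_landauModeHat_uncurry c j
    have h2 : Measurable fun p : ℝ × E3 => phase a p.2 := hpm.comp measurable_snd
    have h3 : Measurable fun p : ℝ × E3 => φ p.2 := φ.continuous.measurable.comp measurable_snd
    exact h3.mul (h2.mul this)
  have hG : Integrable (fun p : ℝ × E3 => φ p.2 * (phase a p.2 * landauModeHat c p.1 j p.2))
      ((volume.restrict (Set.Ioi 0)).prod volume) := by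
    refine integrable_prod_of_le (B := fun k ξ => ‖φ ξ‖ * landauModeHatBound c k ‖ξ‖)
      hGm.aestronglyMeasurable
      ((integrable_inv_sq_mul_norm_schwartz φ).const_mul (landauHatConst c)) ?_
    filter_upwards [ae_ne_zero] with ξ hξ
    obtain ⟨h1, h2⟩ := integral_landauModeHatBound hc (norm_pos_iff.2 hξ)
    refine ⟨h1.const_mul _, ?_, ?_⟩
    · rw [integral_const_mul, h2]
      exact le_of_eq (by ring)
    · filter_upwards [ae_restrict_mem measurableSet_Ioi] with k hk
      rw [norm_mul, norm_mul, norm_phase, one_mul]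
      exact mul_le_mul_of_nonneg_left (norm_landauModeHat_le hc hk j _) (norm_nonneg _)
  have h := integral_superposition hF hG (by
    filter_upwards [ae_restrict_mem measurableSet_Ioi] with k hk _
    exact integral_hatSchwartz_mul_landauMode hc hk j a φ)
  simp only [integral_const_mul] at h
  refine Eq.trans (integral_congr_ae ?_) h
  filter_upwards [ae_ne a] with x hx
  rw [integral_complex_ofReal, integral_landauMode hc j (sub_ne_zero.2 hx)]

theorem fourier_inversion_phase {f g : E3 → ℂ} (hf : Integrable f volume) (hg : Integrable g volume)
    (h : ∀ ξ, ∫ x, phase x ξ * f x = g ξ) {x : E3} (hx : ContinuousAt f x) :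
    (((2 * Real.pi) ^ 3 : ℝ)⁻¹ : ℂ) * ∫ η, phase x (-η) * g η = f x := by
  have hpi := Real.pi_pos
  set R : ℝ := -(2 * Real.pi)
  have hR : R ≠ 0 := by simp [R, hpi.ne']
  have e : 𝓕 f = fun w => g (R • w) := by
    ext w
    rw [Real.fourier_eq', ← h]
    congr 1
    ext v
    rw [smul_eq_mul, phase, inner_smul_right]
    congr 2
    simp only [R]
    push_cast
    ring
  have hi : Integrable (𝓕 f) volume := by
    rw [e]
    exact hg.comp_smul hR
  rw [← hf.fourierInv_fourier_eq hi hx, Real.fourierInv_eq', e]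
  have e2 : ∀ v : E3, Complex.exp ((↑(2 * Real.pi * inner ℝ v x) * Complex.I)) • g (R • v) =
      (fun η => phase x (-η) * g η) (R • v) := fun v => by
    simp only [smul_eq_mul, phase, inner_neg_right, inner_smul_right, real_inner_comm x v]
    congr 2
    simp only [R]
    push_cast
    ring
  refine Eq.trans ?_ (integral_congr_ae (Filter.Eventually.of_forall fun v => (e2 v).symm))
  rw [Measure.integral_comp_smul volume (fun η => phase x (-η) * g η) R, finrank_E3,
    abs_inv, abs_pow, abs_neg, abs_of_pos (by positivity), Complex.real_smul, Complex.ofReal_inv]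

theorem integrable_landauModeHat {c k : ℝ} (hc : 1 < |c|) (hk : 0 < k) (j : Fin 3) :
    Integrable (landauModeHat c k j) volume := by
  have hpi := Real.pi_pos
  have ha := sq_sub_one_pos hc
  set δ := min (k ^ 2 * (c ^ 2 - 1)) 1 with hδ
  have hδ0 : 0 < δ := lt_min (by positivity) one_pos
  have hm : Measurable (landauModeHat c k j) :=
    (measurable_landauModeHat_uncurry c j).comp (measurable_prodMk_left (x := k))
  have hi := (integrable_rpow_neg_one_add_norm_sq (E := E3) (μ := volume) (r := 4)
    (by rw [finrank_E3]; norm_num)).const_mul (128 * Real.pi * |c| * k * (δ ^ 2)⁻¹)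
  refine hi.mono' hm.aestronglyMeasurable (Filter.Eventually.of_forall fun ξ => ?_)
  refine (norm_landauModeHat_le hc hk j ξ).trans ?_
  have hr := sq_nonneg ‖ξ‖
  have h1 : δ * (1 + ‖ξ‖ ^ 2) ≤ k ^ 2 * (c ^ 2 - 1) + ‖ξ‖ ^ 2 := by
    nlinarith [min_le_left (k ^ 2 * (c ^ 2 - 1)) 1, min_le_right (k ^ 2 * (c ^ 2 - 1)) 1]
  have hq : 0 < k ^ 2 * (c ^ 2 - 1) + ‖ξ‖ ^ 2 := by positivity
  have h2 : ‖ξ‖ ^ 2 ≤ k ^ 2 * (c ^ 2 - 1) + ‖ξ‖ ^ 2 := by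
    have : 0 ≤ k ^ 2 * (c ^ 2 - 1) := by positivity
    linarith
  rw [show (-(4 : ℝ) / 2) = -(2 : ℕ) by norm_num, Real.rpow_neg (by positivity), Real.rpow_natCast,
    landauModeHatBound]
  generalize k ^ 2 * (c ^ 2 - 1) + ‖ξ‖ ^ 2 = q at h1 hq h2
  calc 128 * Real.pi * |c| * ‖ξ‖ ^ 2 * (k / q ^ 3)
      ≤ 128 * Real.pi * |c| * q * (k / q ^ 3) := by gcongr
    _ = 128 * Real.pi * |c| * k * (q ^ 2)⁻¹ := by field_simp
    _ ≤ 128 * Real.pi * |c| * k * ((δ * (1 + ‖ξ‖ ^ 2)) ^ 2)⁻¹ := by gcongr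
    _ = _ := by rw [mul_pow, mul_inv]; ring

/-- The modes are continuous off the origin only, which is enough for the inversion formula. -/
theorem landauMode_eq_integral {c k : ℝ} (hc : 1 < |c|) (hk : 0 < k) (j : Fin 3) {x : E3}
    (hx : x ≠ 0) : (((2 * Real.pi) ^ 3 : ℝ)⁻¹ : ℂ) * ∫ η, phase x (-η) * landauModeHat c k j η =
      (landauMode c k j x : ℂ) := by
  refine fourier_inversion_phase (integrable_landauMode hc hk j) (integrable_landauModeHat hc hk j)
    (integral_phase_mul_landauMode hc hk j) ?_
  have := continuousAt_expMode (k * |c|) (signR c * k) j hx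
  unfold landauMode
  fun_prop

/-- Modulation of `φ̂` is translation of `φ`. -/
theorem phase_neg_mul_hatSchwartz (φ : 𝓢(E3, ℂ)) (x η : E3) :
    phase x (-η) * hatSchwartz φ x = hatSchwartz (φ.compSubConstCLM ℂ (-η)) x := by
  rw [hatSchwartz_eq_phase, hatSchwartz_eq_phase, ← integral_const_mul,
    ← integral_add_right_eq_self (fun y => phase x (-η) * (phase y x * φ y)) η]
  congr 1
  ext y
  rw [SchwartzMap.compSubConstCLM_apply, sub_neg_eq_add, phase_add_left, phase_comm η x,
    ← mul_assoc, mul_left_comm (phase x (-η)), ← phase_add_right, neg_add_cancel]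
  simp [phase]

theorem integral_hatSchwartz_shift_mul_landauField {c : ℝ} (hc : 1 < |c|) (l : Fin 3)
    (φ : 𝓢(E3, ℂ)) (η : E3) :
    ∫ x, phase x (-η) * hatSchwartz φ x * (landauField c x l : ℂ) =
      ∫ ξ, φ ξ * landauHat c l (ξ - η) := by
  have h := isFun_hat_landau hc 0 l
  have h1 := (h.2 (φ.compSubConstCLM ℂ (-η))).2
  rw [hat_apply, ((isFun_landau hc 0 l).2 _).2] at h1
  simp_rw [phase_neg_mul_hatSchwartz]
  rw [← integral_add_right_eq_self (fun ξ => φ ξ * landauHat c l (ξ - η)) η]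
  simpa [phase] using h1

theorem integrable_schwartz_mul_conv_kernel (φ : 𝓢(E3, ℂ)) :
    Integrable (fun p : E3 × E3 => ‖φ p.1‖ * ((‖p.1 - p.2‖ ^ 2)⁻¹ * (‖p.2‖ ^ 2)⁻¹))
      (volume.prod volume) := by
  have hm : Measurable fun p : E3 × E3 => ‖φ p.1‖ * ((‖p.1 - p.2‖ ^ 2)⁻¹ * (‖p.2‖ ^ 2)⁻¹) := by
    have : Measurable fun p : E3 × E3 => φ p.1 := φ.continuous.measurable.comp measurable_fst
    fun_prop
  have hnn : ∀ p : E3 × E3, 0 ≤ ‖φ p.1‖ * ((‖p.1 - p.2‖ ^ 2)⁻¹ * (‖p.2‖ ^ 2)⁻¹) := fun p => by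
    positivity
  refine (integrable_prod_iff hm.aestronglyMeasurable).2 ⟨?_, ?_⟩
  · filter_upwards [ae_ne_zero] with ξ hξ
    exact (integrable_conv_inv_sq hξ).1.const_mul _
  · refine ((integrable_inv_mul_norm_schwartz φ).const_mul convConst).mono'
      hm.aestronglyMeasurable.norm.integral_prod_right' ?_
    filter_upwards [ae_ne_zero] with ξ hξ
    have e : ∀ η, ‖‖φ ξ‖ * ((‖ξ - η‖ ^ 2)⁻¹ * (‖η‖ ^ 2)⁻¹)‖ =
        ‖φ ξ‖ * ((‖ξ - η‖ ^ 2)⁻¹ * (‖η‖ ^ 2)⁻¹) := fun η => Real.norm_of_nonneg (hnn (ξ, η))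
    simp only [e]
    rw [Real.norm_of_nonneg (integral_nonneg fun η => hnn (ξ, η))]
    simp only [integral_const_mul]
    calc _ ≤ ‖φ ξ‖ * (convConst * ‖ξ‖⁻¹) := by
          gcongr
          exact (integrable_conv_inv_sq hξ).2
      _ = _ := by ring

theorem integrable_schwartz_mul_landauField {c : ℝ} (hc : 1 < |c|) (l : Fin 3) (φ : 𝓢(E3, ℂ)) :
    Integrable (fun x => φ x * (landauField c x l : ℂ)) volume := by
  simpa using ((isFun_landau hc 0 l).2 φ).1

theorem integral_hatSchwartz_mul_landauField_mul_landauMode {c k : ℝ} (hc : 1 < |c|) (hk : 0 < k)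
    (l m : Fin 3) (φ : 𝓢(E3, ℂ)) :
    ∫ x, hatSchwartz φ x * (landauField c x l : ℂ) * (landauMode c k m x : ℂ) =
      (((2 * Real.pi) ^ 3 : ℝ)⁻¹ : ℂ) * ∫ η, ∫ ξ, φ ξ * landauHat c l (ξ - η) *
        landauModeHat c k m η := by
  have hi := integrable_mul_prod_of_norm_le_one
    (integrable_schwartz_mul_landauField hc l (hatSchwartz φ)) (integrable_landauModeHat hc hk m)
    (p := fun z => phase z.1 (-z.2))
    (continuous_phase.comp (by fun_prop : Continuous fun z : E3 × E3 => (z.1, -z.2)))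
    fun z => (norm_phase _ _).le
  have hsw := integral_integral_swap (f := fun x η => phase x (-η) *
    (hatSchwartz φ x * (landauField c x l : ℂ) * landauModeHat c k m η)) hi
  have e1 : ∫ x, hatSchwartz φ x * (landauField c x l : ℂ) * (landauMode c k m x : ℂ) =
      (((2 * Real.pi) ^ 3 : ℝ)⁻¹ : ℂ) * ∫ x, ∫ η, phase x (-η) *
        (hatSchwartz φ x * (landauField c x l : ℂ) * landauModeHat c k m η) := by
    rw [← integral_const_mul]
    refine integral_congr_ae ?_
    filter_upwards [ae_ne_zero] with x hx
    rw [← landauMode_eq_integral hc hk m hx, mul_left_comm, ← integral_const_mul]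
    congr 2
    ext η
    ring
  rw [e1, hsw]
  congr 2
  ext η
  rw [integral_mul_const, ← integral_hatSchwartz_shift_mul_landauField hc l φ η,
    ← integral_mul_const]
  congr 1
  ext x
  ring

/-- The convolution theorem for the products `V_l V_m` of components of the Slezkin–Landau field.
It is obtained mode by mode in the second factor, since the modes have integrable Fourier
transforms. -/
theorem integral_hatSchwartz_mul_landauField_mul_landauField {c : ℝ} (hc : 1 < |c|) (l m : Fin 3)
    (φ : 𝓢(E3, ℂ)) :
    ∫ x, hatSchwartz φ x * (landauField c x l * landauField c x m : ℝ) =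
      ∫ ξ, φ ξ * convHat (landauHat c) (landauHat c) l m ξ := by
  obtain ⟨C, hC⟩ := landauField_bound hc
  have hVm := measurable_landauField c l
  have hf0 : AEStronglyMeasurable (fun x => hatSchwartz φ x * (landauField c x l : ℂ)) volume :=
    (integrable_schwartz_mul_landauField hc l _).aestronglyMeasurable
  have hfi : Integrable (fun x : E3 => ‖x - 0‖⁻¹ * ‖hatSchwartz φ x * (landauField c x l : ℂ)‖)
      volume := by
    refine ((integrable_inv_sq_mul_norm_schwartz (hatSchwartz φ)).const_mul C).mono'
      (AEStronglyMeasurable.mul (by fun_prop) hf0.norm) (Filter.Eventually.of_forall fun x => ?_)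
    rw [sub_zero, norm_mul, norm_norm, norm_inv, norm_norm, norm_mul, Complex.norm_real]
    calc _ ≤ ‖x‖⁻¹ * (‖hatSchwartz φ x‖ * (C * ‖x‖⁻¹)) := by
          gcongr
          exact hC x l
      _ = _ := by rw [← inv_pow]; ring
  have hF := integrable_schwartz_mul_landauMode hc m 0 hf0 hfi
  have hGm : Measurable fun p : ℝ × (E3 × E3) =>
      φ p.2.1 * landauHat c l (p.2.1 - p.2.2) * landauModeHat c p.1 m p.2.2 := by
    have h1 : Measurable fun p : ℝ × (E3 × E3) => (p.1, p.2.2) := by fun_prop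
    have h2 : Measurable fun p : ℝ × (E3 × E3) => landauModeHat c p.1 m p.2.2 :=
      (measurable_landauModeHat_uncurry c m).comp h1
    have h3 : Measurable fun p : ℝ × (E3 × E3) => φ p.2.1 :=
      φ.continuous.measurable.comp (measurable_fst.comp measurable_snd)
    have h4 := measurable_landauHat c l
    fun_prop
  have hM := landauHatConst_nonneg hc
  have hG : Integrable (fun p : ℝ × (E3 × E3) =>
      φ p.2.1 * landauHat c l (p.2.1 - p.2.2) * landauModeHat c p.1 m p.2.2)
      ((volume.restrict (Set.Ioi 0)).prod (volume.prod volume)) := by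
    refine integrable_prod_of_le
      (B := fun k p => ‖φ p.1 * landauHat c l (p.1 - p.2)‖ * landauModeHatBound c k ‖p.2‖)
      hGm.aestronglyMeasurable
      ((integrable_schwartz_mul_conv_kernel φ).const_mul (landauHatConst c * landauHatConst c)) ?_
    have h0 : ∀ᵐ p : E3 × E3 ∂(volume.prod volume), p.2 ≠ 0 :=
      Measure.quasiMeasurePreserving_snd.ae ae_ne_zero
    filter_upwards [h0] with p hp
    obtain ⟨h1, h2⟩ := integral_landauModeHatBound hc (norm_pos_iff.2 hp)
    refine ⟨h1.const_mul _, ?_, ?_⟩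
    · rw [integral_const_mul, h2, norm_mul]
      calc _ ≤ ‖φ p.1‖ * (landauHatConst c * (‖p.1 - p.2‖ ^ 2)⁻¹) *
            (landauHatConst c * (‖p.2‖ ^ 2)⁻¹) := by
            gcongr
            exact norm_landauHat_le hc l _
        _ = _ := by ring
    · filter_upwards [ae_restrict_mem measurableSet_Ioi] with k hk
      rw [norm_mul]
      exact mul_le_mul_of_nonneg_left (norm_landauModeHat_le hc hk m _) (norm_nonneg _)
  have h := integral_superposition (hF.const_mul (((2 * Real.pi) ^ 3 : ℝ) : ℂ)) hG (by
    filter_upwards [ae_restrict_mem measurableSet_Ioi] with k hk hk2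
    rw [integral_const_mul, integral_prod_symm _ hk2]
    simp only [sub_zero]
    rw [integral_hatSchwartz_mul_landauField_mul_landauMode hc hk, ← mul_assoc,
      mul_inv_cancel₀ (by have := Real.pi_pos; norm_cast; positivity), one_mul])
  have hGi : Integrable (fun p : E3 × E3 => φ p.1 * landauHat c l (p.1 - p.2) * landauHat c m p.2)
      (volume.prod volume) := by
    refine hG.integral_prod_right.congr (Filter.Eventually.of_forall fun p => ?_)
    simp only [integral_const_mul]
    rfl
  have e1 : ∀ p : E3 × E3, ∫ k in Set.Ioi (0 : ℝ), φ p.1 * landauHat c l (p.1 - p.2) *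
      landauModeHat c k m p.2 = φ p.1 * landauHat c l (p.1 - p.2) * landauHat c m p.2 := fun p => by
    rw [integral_const_mul, landauHat.eq_def c m]
  simp only [e1, integral_const_mul] at h
  rw [integral_prod _ hGi] at h
  have h5 : ∫ x, hatSchwartz φ x * (landauField c x l * landauField c x m : ℝ) =
      ∫ x, hatSchwartz φ x * (landauField c x l : ℂ) *
        ∫ k in Set.Ioi (0 : ℝ), (landauMode c k m (x - 0) : ℂ) := by
    refine integral_congr_ae ?_
    filter_upwards [ae_ne_zero] with x hx
    rw [sub_zero, integral_complex_ofReal, integral_landauMode hc m hx]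
    push_cast
    ring
  rw [h5, ← mul_right_inj' (a := (((2 * Real.pi) ^ 3 : ℝ) : ℂ))
    (by have := Real.pi_pos; norm_cast; positivity), h, ← integral_const_mul]
  congr 1
  ext ξ
  rw [convHat, mul_left_comm, ← mul_assoc (((2 * Real.pi) ^ 3 : ℝ) : ℂ), Complex.ofReal_inv,
    mul_inv_cancel₀ (by have := Real.pi_pos; norm_cast; positivity), one_mul, ← integral_const_mul]
  congr 1
  ext η
  ring

/-! ### The stress tensor of the Slezkin–Landau flow away from the origin -/

/-- The Kronecker symbol. -/
def kron (k l : Fin 3) : ℝ := if k = l then 1 else 0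

theorem kron_self (k : Fin 3) : kron k k = 1 := if_pos rfl

section LandauPoly

/- The field, its pressure and their derivatives are polynomials in `x`, `ρ = ‖x‖⁻¹` and
`g = (c ‖x‖ - x₀)⁻¹`; differentiation in the direction `e_l` acts by `∂_l ρ = -x_l ρ³` and
`∂_l g = -g² (c x_l ρ - δ_{l0})`. -/

variable (c ρ g : ℝ) (x : Fin 3 → ℝ) (l k : Fin 3)

/-- The derivative `c x_l / ‖x‖ - δ_{l0}` of `c ‖x‖ - x₀`. -/
def slope : ℝ := c * x l * ρ - kron l 0

/-- The derivative of `slope` in its own direction. -/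
def slopeDeriv : ℝ := c * (ρ - x l ^ 2 * ρ ^ 3)

/-- The factor `c x₀ / ‖x‖ - 1`. -/
def axial : ℝ := c * x 0 * ρ - 1

/-- The derivative of `axial`. -/
def axialDeriv : ℝ := c * (kron l 0 * ρ - x 0 * x l * ρ ^ 3)

/-- The second derivative of `axial`. -/
def axialDeriv₂ : ℝ :=
  c * (-2 * kron l 0 * x l * ρ ^ 3 - x 0 * ρ ^ 3 + 3 * x 0 * x l ^ 2 * ρ ^ 5)

/-- The velocity `V_k`. -/
def velPoly : ℝ := 2 * kron k 0 * g + 2 * x k * g ^ 2 * axial c ρ x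

/-- The pressure. -/
def pressurePoly : ℝ := 4 * g ^ 2 * axial c ρ x

/-- The derivative `∂_l` of the pressure. -/
def pressureDerivPoly : ℝ :=
  4 * g ^ 2 * axialDeriv c ρ x l - 8 * g ^ 3 * slope c ρ x l * axial c ρ x

/-- The derivative `∂_l V_k`. -/
def gradPoly : ℝ :=
  -2 * kron k 0 * g ^ 2 * slope c ρ x l + 2 * kron l k * g ^ 2 * axial c ρ x -
    4 * x k * g ^ 3 * slope c ρ x l * axial c ρ x + 2 * x k * g ^ 2 * axialDeriv c ρ x l

/-- The second derivative `∂_l ∂_l V_k`. -/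
def hessPoly : ℝ :=
  4 * kron k 0 * g ^ 3 * slope c ρ x l ^ 2 - 2 * kron k 0 * g ^ 2 * slopeDeriv c ρ x l +
    kron l k * (4 * g ^ 2 * axialDeriv c ρ x l - 8 * g ^ 3 * slope c ρ x l * axial c ρ x) +
    12 * x k * g ^ 4 * slope c ρ x l ^ 2 * axial c ρ x -
    4 * x k * g ^ 3 * slopeDeriv c ρ x l * axial c ρ x -
    8 * x k * g ^ 3 * slope c ρ x l * axialDeriv c ρ x l +
    2 * x k * g ^ 2 * axialDeriv₂ c ρ x l

/-- The stress tensor `V_l V_k + p δ_{lk} - ∂_l V_k`. -/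
def stressPoly : ℝ :=
  velPoly c ρ g x l * velPoly c ρ g x k + kron l k * pressurePoly c ρ g x - gradPoly c ρ g x l k

/-- The derivative `∂_l` of `stressPoly` in its first index. -/
def stressDerivPoly : ℝ :=
  gradPoly c ρ g x l l * velPoly c ρ g x k + velPoly c ρ g x l * gradPoly c ρ g x l k +
    kron l k * pressureDerivPoly c ρ g x l - hessPoly c ρ g x l k

end LandauPoly

section Algebra

variable {c ρ g : ℝ} {x : Fin 3 → ℝ}

theorem denom_identity (hρ : (x 0 ^ 2 + x 1 ^ 2 + x 2 ^ 2) * ρ ^ 2 = 1)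
    (hg : g * (c - x 0 * ρ) = ρ) :
    g * (c * (x 0 ^ 2 + x 1 ^ 2 + x 2 ^ 2) * ρ - x 0) = 1 := by
  have hρ0 : ρ ≠ 0 := fun h => by simp [h] at hρ
  have : ρ * (g * (c * (x 0 ^ 2 + x 1 ^ 2 + x 2 ^ 2) * ρ - x 0)) = ρ * 1 := by
    linear_combination c * g * hρ + hg
  exact mul_left_cancel₀ hρ0 this

/-- The Slezkin–Landau field solves the stationary Navier–Stokes system away from the origin. -/
theorem sum_stressDerivPoly (hg0 : g ≠ 0) (hρ : (x 0 ^ 2 + x 1 ^ 2 + x 2 ^ 2) * ρ ^ 2 = 1)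
    (hg : g * (c - x 0 * ρ) = ρ) (k : Fin 3) : ∑ l, stressDerivPoly c ρ g x l k = 0 := by
  have h0 := denom_identity hρ hg
  have h1 : slope c ρ x 0 ^ 2 + slope c ρ x 1 ^ 2 + slope c ρ x 2 ^ 2 =
      c ^ 2 - 2 * c * x 0 * ρ + 1 := by
    simp [slope, kron]
    linear_combination c ^ 2 * hρ
  have h2 : slopeDeriv c ρ x 0 + slopeDeriv c ρ x 1 + slopeDeriv c ρ x 2 = 2 * c * ρ := by
    simp [slopeDeriv]
    linear_combination - c * ρ * hρ
  have h3 : slope c ρ x 0 * axialDeriv c ρ x 0 + slope c ρ x 1 * axialDeriv c ρ x 1 +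
      slope c ρ x 2 * axialDeriv c ρ x 2 = - c * (ρ - x 0 ^ 2 * ρ ^ 3) := by
    simp [slope, axialDeriv, kron]
    linear_combination (- c ^ 2 * x 0 * ρ ^ 2) * hρ
  have h4 : axialDeriv₂ c ρ x 0 + axialDeriv₂ c ρ x 1 + axialDeriv₂ c ρ x 2 =
      -2 * c * x 0 * ρ ^ 3 := by
    simp [axialDeriv₂, kron]
    linear_combination (3 * c * x 0 * ρ ^ 3) * hρ
  have h5 : velPoly c ρ g x 0 * slope c ρ x 0 + velPoly c ρ g x 1 * slope c ρ x 1 +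
      velPoly c ρ g x 2 * slope c ρ x 2 = 4 * g * axial c ρ x := by
    simp [velPoly, slope, kron, axial]
    linear_combination 2 * g * (c * x 0 * ρ - 1) * h0
  have h6 : velPoly c ρ g x 0 * axialDeriv c ρ x 0 + velPoly c ρ g x 1 * axialDeriv c ρ x 1 +
      velPoly c ρ g x 2 * axialDeriv c ρ x 2 = 2 * g * c * (ρ - x 0 ^ 2 * ρ ^ 3) := by
    simp [velPoly, axialDeriv, kron, axial]
    linear_combination (- 2 * g ^ 2 * (c * x 0 * ρ - 1) * c * x 0 * ρ) * hρ
  have h7 : gradPoly c ρ g x 0 0 + gradPoly c ρ g x 1 1 + gradPoly c ρ g x 2 2 = 0 := by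
    simp [gradPoly, slope, kron, axial, axialDeriv]
    linear_combination (- 4 * g ^ 2 * (c * x 0 * ρ - 1)) * h0 - 2 * g ^ 2 * c * x 0 * ρ * hρ
  have h8 : kron 0 k * velPoly c ρ g x 0 + kron 1 k * velPoly c ρ g x 1 +
      kron 2 k * velPoly c ρ g x 2 = velPoly c ρ g x k := by
    fin_cases k <;> simp [kron]
  have hfin : -8 * kron k 0 * g ^ 3 * axial c ρ x + 2 * g ^ 2 * axial c ρ x * velPoly c ρ g x k -
      16 * x k * g ^ 4 * axial c ρ x ^ 2 - 4 * x k * g ^ 3 * c * (ρ - x 0 ^ 2 * ρ ^ 3) -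
      4 * kron k 0 * g ^ 3 * (c ^ 2 - 2 * c * x 0 * ρ + 1) + 4 * kron k 0 * g ^ 2 * c * ρ -
      12 * x k * g ^ 4 * axial c ρ x * (c ^ 2 - 2 * c * x 0 * ρ + 1) +
      8 * x k * g ^ 3 * axial c ρ x * c * ρ + 4 * x k * g ^ 2 * c * x 0 * ρ ^ 3 = 0 := by
    have hc : c = x 0 * ρ + ρ / g := by
      field_simp
      linear_combination hg
    simp only [velPoly, axial]
    generalize kron k 0 = d
    subst hc
    field_simp
    ring
  simp only [Fin.sum_univ_three, stressDerivPoly, pressureDerivPoly, gradPoly, hessPoly] at h7 ⊢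
  linear_combination hfin + velPoly c ρ g x k * h7 +
    (-2 * kron k 0 * g ^ 2 - 4 * x k * g ^ 3 * axial c ρ x) * h5 + 2 * x k * g ^ 2 * h6 +
    2 * g ^ 2 * axial c ρ x * h8 -
    (4 * kron k 0 * g ^ 3 + 12 * x k * g ^ 4 * axial c ρ x) * h1 +
    (2 * kron k 0 * g ^ 2 + 4 * x k * g ^ 3 * axial c ρ x) * h2 + 8 * x k * g ^ 3 * h3 -
    2 * x k * g ^ 2 * h4

/-- The stress in the radial direction, up to the factor `‖x‖`. -/
theorem sum_mul_stressPoly (hρ : (x 0 ^ 2 + x 1 ^ 2 + x 2 ^ 2) * ρ ^ 2 = 1)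
    (hg : g * (c - x 0 * ρ) = ρ) (k : Fin 3) :
    ∑ l, x l * stressPoly c ρ g x l k =
      (2 * (c ^ 2 - 1) * (g / ρ) ^ 2 - 1) * velPoly c ρ g x k + x k * pressurePoly c ρ g x := by
  have hρ0 : ρ ≠ 0 := fun h => by simp [h] at hρ
  have h0 := denom_identity hρ hg
  have h1 : x 0 * slope c ρ x 0 + x 1 * slope c ρ x 1 + x 2 * slope c ρ x 2 =
      c * (x 0 ^ 2 + x 1 ^ 2 + x 2 ^ 2) * ρ - x 0 := by
    simp [slope, kron]
    ring
  have h2 : x 0 * axialDeriv c ρ x 0 + x 1 * axialDeriv c ρ x 1 + x 2 * axialDeriv c ρ x 2 = 0 := by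
    simp [axialDeriv, kron]
    linear_combination (- c * x 0 * ρ) * hρ
  have h3 : kron 0 k * x 0 + kron 1 k * x 1 + kron 2 k * x 2 = x k := by
    fin_cases k <;> simp [kron]
  -- Euler's identity for the homogeneous function `V_k`
  have h4 : x 0 * gradPoly c ρ g x 0 k + x 1 * gradPoly c ρ g x 1 k + x 2 * gradPoly c ρ g x 2 k =
      -velPoly c ρ g x k := by
    simp only [gradPoly, velPoly]
    linear_combination (-2 * kron k 0 * g ^ 2 - 4 * x k * g ^ 3 * axial c ρ x) * h1 +
      2 * x k * g ^ 2 * h2 + 2 * g ^ 2 * axial c ρ x * h3 +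
      (-2 * kron k 0 * g - 4 * x k * g ^ 2 * axial c ρ x) * h0
  have h5 : x 0 * velPoly c ρ g x 0 + x 1 * velPoly c ρ g x 1 + x 2 * velPoly c ρ g x 2 =
      2 * (c ^ 2 - 1) * (g / ρ) ^ 2 - 2 := by
    have hr : x 0 ^ 2 + x 1 ^ 2 + x 2 ^ 2 = 1 / ρ ^ 2 := by
      field_simp
      linear_combination hρ
    have e : x 0 * velPoly c ρ g x 0 + x 1 * velPoly c ρ g x 1 + x 2 * velPoly c ρ g x 2 =
        2 * x 0 * g + 2 * (x 0 ^ 2 + x 1 ^ 2 + x 2 ^ 2) * g ^ 2 * axial c ρ x := by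
      simp [velPoly, kron]
      ring
    rw [e, hr, axial]
    field_simp
    linear_combination (-g * c - ρ) * hg
  simp only [Fin.sum_univ_three, stressPoly]
  linear_combination velPoly c ρ g x k * h5 + pressurePoly c ρ g x * h3 - h4

end Algebra

section Derivatives

variable {c : ℝ} {R G : ℝ → ℝ} {X : ℝ → Fin 3 → ℝ} {l : Fin 3}

theorem hasDerivAt_axial (hR : HasDerivAt R (-X 0 l * R 0 ^ 3) 0)
    (hX : ∀ i, HasDerivAt (fun t => X t i) (kron l i) 0) :
    HasDerivAt (fun t => axial c (R t) (X t)) (axialDeriv c (R 0) (X 0) l) 0 := by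
  refine ((((hX 0).const_mul c).fun_mul hR).sub_const 1).congr_deriv ?_
  simp only [axialDeriv]
  ring

theorem hasDerivAt_slope (hR : HasDerivAt R (-X 0 l * R 0 ^ 3) 0)
    (hX : ∀ i, HasDerivAt (fun t => X t i) (kron l i) 0) :
    HasDerivAt (fun t => slope c (R t) (X t) l) (slopeDeriv c (R 0) (X 0) l) 0 := by
  refine ((((hX l).const_mul c).fun_mul hR).sub_const _).congr_deriv ?_
  simp only [slopeDeriv, kron_self]
  ring

theorem hasDerivAt_axialDeriv (hR : HasDerivAt R (-X 0 l * R 0 ^ 3) 0)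
    (hX : ∀ i, HasDerivAt (fun t => X t i) (kron l i) 0) :
    HasDerivAt (fun t => axialDeriv c (R t) (X t) l) (axialDeriv₂ c (R 0) (X 0) l) 0 := by
  refine (((hR.const_mul (kron l 0)).fun_sub (((hX 0).fun_mul (hX l)).fun_mul
    (hR.fun_pow 3))).const_mul c).congr_deriv ?_
  simp only [axialDeriv₂, kron_self]
  push_cast
  ring

theorem hasDerivAt_velPoly (hR : HasDerivAt R (-X 0 l * R 0 ^ 3) 0)
    (hG : HasDerivAt G (-G 0 ^ 2 * slope c (R 0) (X 0) l) 0)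
    (hX : ∀ i, HasDerivAt (fun t => X t i) (kron l i) 0) (k : Fin 3) :
    HasDerivAt (fun t => velPoly c (R t) (G t) (X t) k) (gradPoly c (R 0) (G 0) (X 0) l k) 0 := by
  refine ((hG.const_mul (2 * kron k 0)).fun_add ((((hX k).const_mul 2).fun_mul
    (hG.fun_pow 2)).fun_mul (hasDerivAt_axial hR hX))).congr_deriv ?_
  simp only [gradPoly]
  push_cast
  ring

theorem hasDerivAt_pressurePoly (hR : HasDerivAt R (-X 0 l * R 0 ^ 3) 0)
    (hG : HasDerivAt G (-G 0 ^ 2 * slope c (R 0) (X 0) l) 0)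
    (hX : ∀ i, HasDerivAt (fun t => X t i) (kron l i) 0) :
    HasDerivAt (fun t => pressurePoly c (R t) (G t) (X t))
      (pressureDerivPoly c (R 0) (G 0) (X 0) l) 0 := by
  refine (((hG.fun_pow 2).const_mul 4).fun_mul (hasDerivAt_axial hR hX)).congr_deriv ?_
  simp only [pressureDerivPoly]
  push_cast
  ring

theorem hasDerivAt_gradPoly (hR : HasDerivAt R (-X 0 l * R 0 ^ 3) 0)
    (hG : HasDerivAt G (-G 0 ^ 2 * slope c (R 0) (X 0) l) 0)
    (hX : ∀ i, HasDerivAt (fun t => X t i) (kron l i) 0) (k : Fin 3) :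
    HasDerivAt (fun t => gradPoly c (R t) (G t) (X t) l k) (hessPoly c (R 0) (G 0) (X 0) l k)
      0 := by
  have ha := hasDerivAt_axial (c := c) hR hX
  have hs := hasDerivAt_slope (c := c) hR hX
  have hd := hasDerivAt_axialDeriv (c := c) hR hX
  refine ((((((hG.fun_pow 2).const_mul (-2 * kron k 0)).fun_mul hs).fun_add
    (((hG.fun_pow 2).const_mul (2 * kron l k)).fun_mul ha)).fun_sub
    (((((hX k).const_mul 4).fun_mul (hG.fun_pow 3)).fun_mul hs).fun_mul ha)).fun_add
    ((((hX k).const_mul 2).fun_mul (hG.fun_pow 2)).fun_mul hd)).congr_deriv ?_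
  simp only [hessPoly]
  push_cast
  ring

theorem hasDerivAt_stressPoly (hR : HasDerivAt R (-X 0 l * R 0 ^ 3) 0)
    (hG : HasDerivAt G (-G 0 ^ 2 * slope c (R 0) (X 0) l) 0)
    (hX : ∀ i, HasDerivAt (fun t => X t i) (kron l i) 0) (k : Fin 3) :
    HasDerivAt (fun t => stressPoly c (R t) (G t) (X t) l k)
      (stressDerivPoly c (R 0) (G 0) (X 0) l k) 0 :=
  (((hasDerivAt_velPoly hR hG hX l).fun_mul (hasDerivAt_velPoly hR hG hX k)).fun_add
    ((hasDerivAt_pressurePoly hR hG hX).const_mul (kron l k))).fun_sub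
    (hasDerivAt_gradPoly hR hG hX k)

end Derivatives

/-! ### Integration by parts for fields that are singular at the origin -/

/-- A cutoff function which vanishes to fourth order at the origin and tends to `1` as `ε → 0`. -/
def cutoff (ε : ℝ) (x : E3) : ℝ := (‖x‖ ^ 2 / (‖x‖ ^ 2 + ε ^ 2)) ^ 2

/-- The derivative `∂_l` of `cutoff`. -/
def cutoffDeriv (ε : ℝ) (l : Fin 3) (x : E3) : ℝ :=
  4 * ε ^ 2 * ‖x‖ ^ 2 * x l / (‖x‖ ^ 2 + ε ^ 2) ^ 3

theorem hasLineDerivAt_cutoff {ε : ℝ} (hε : 0 < ε) (l : Fin 3) (x : E3) :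
    HasLineDerivAt ℝ (cutoff ε) (cutoffDeriv ε l x) x (unitVec l) := by
  have e : (fun t : ℝ => cutoff ε (x + t • unitVec l)) = fun t : ℝ =>
      ((‖x‖ ^ 2 + 2 * t * x l + t ^ 2) / ((‖x‖ ^ 2 + 2 * t * x l + t ^ 2) + ε ^ 2)) ^ 2 := by
    ext t
    have : ‖x + t • unitVec l‖ ^ 2 = ‖x‖ ^ 2 + 2 * t * x l + t ^ 2 := by
      rw [norm_add_sq_real, norm_smul, inner_smul_right, inner_unitVec, norm_unitVec, mul_one,
        Real.norm_eq_abs, sq_abs]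
      ring
    rw [cutoff, this]
  rw [HasLineDerivAt, e]
  have h1 : HasDerivAt (fun t : ℝ => ‖x‖ ^ 2 + 2 * t * x l + t ^ 2) (2 * x l) 0 := by
    have := ((((hasDerivAt_id (0 : ℝ)).const_mul 2).mul_const (x l)).const_add (‖x‖ ^ 2)).add
      ((hasDerivAt_id (0 : ℝ)).pow 2)
    simpa using! this
  have hpos : 0 < ‖x‖ ^ 2 + ε ^ 2 := by positivity
  have h2 := (h1.fun_div (h1.add_const (ε ^ 2)) (by simpa using hpos.ne')).fun_pow 2
  refine h2.congr_deriv ?_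
  rw [cutoffDeriv]
  simp
  field_simp
  ring

theorem cutoff_le_one {ε : ℝ} (hε : 0 < ε) (x : E3) : cutoff ε x ≤ 1 := by
  have hpos : 0 < ‖x‖ ^ 2 + ε ^ 2 := by positivity
  refine pow_le_one₀ (by positivity) ((div_le_one hpos).2 ?_)
  nlinarith [sq_nonneg ε]

theorem cutoff_le_sq {ε : ℝ} (hε : 0 < ε) (x : E3) : cutoff ε x ≤ ‖x‖ ^ 2 / (4 * ε ^ 2) := by
  have hpos : 0 < ‖x‖ ^ 2 + ε ^ 2 := by positivity
  rw [cutoff, div_pow, div_le_div_iff₀ (by positivity) (by positivity)]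
  have h : (2 * ‖x‖ * ε) ^ 2 ≤ (‖x‖ ^ 2 + ε ^ 2) ^ 2 := by
    have := two_mul_le_add_sq ‖x‖ ε
    gcongr
  nlinarith [mul_le_mul_of_nonneg_left h (sq_nonneg ‖x‖)]

theorem cutoff_le_pow {ε : ℝ} (hε : 0 < ε) (x : E3) : cutoff ε x ≤ ‖x‖ ^ 4 / ε ^ 4 := by
  have hpos : 0 < ‖x‖ ^ 2 + ε ^ 2 := by positivity
  rw [cutoff, div_pow, show ‖x‖ ^ 4 / ε ^ 4 = (‖x‖ ^ 2) ^ 2 / (ε ^ 2) ^ 2 by ring]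
  have : ε ^ 2 ≤ ‖x‖ ^ 2 + ε ^ 2 := by nlinarith [sq_nonneg ‖x‖]
  gcongr

theorem abs_cutoffDeriv_le {ε : ℝ} (hε : 0 < ε) (l : Fin 3) (x : E3) :
    |cutoffDeriv ε l x| ≤ 4 * ‖x‖ / (‖x‖ ^ 2 + ε ^ 2) := by
  have hpos : 0 < ‖x‖ ^ 2 + ε ^ 2 := by positivity
  rw [cutoffDeriv, abs_div, abs_mul, abs_of_nonneg (by positivity : 0 ≤ 4 * ε ^ 2 * ‖x‖ ^ 2),
    abs_of_pos (by positivity : 0 < (‖x‖ ^ 2 + ε ^ 2) ^ 3)]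
  have h1 : ε ^ 2 ≤ ‖x‖ ^ 2 + ε ^ 2 := by nlinarith [sq_nonneg ‖x‖]
  have h2 : ‖x‖ ^ 2 ≤ ‖x‖ ^ 2 + ε ^ 2 := by nlinarith [sq_nonneg ε]
  calc _ ≤ 4 * (‖x‖ ^ 2 + ε ^ 2) * (‖x‖ ^ 2 + ε ^ 2) * ‖x‖ / (‖x‖ ^ 2 + ε ^ 2) ^ 3 := by
        gcongr
        exact abs_apply_le x l
    _ = _ := by field_simp

theorem abs_cutoffDeriv_le_inv {ε : ℝ} (hε : 0 < ε) (l : Fin 3) (x : E3) :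
    |cutoffDeriv ε l x| ≤ 4 * ‖x‖⁻¹ := by
  refine (abs_cutoffDeriv_le hε l x).trans ?_
  rcases eq_or_ne x 0 with rfl | hx
  · simp
  have hr : 0 < ‖x‖ := norm_pos_iff.2 hx
  rw [← div_eq_mul_inv, div_le_div_iff₀ (by positivity) hr]
  nlinarith [sq_nonneg ε]

theorem abs_cutoffDeriv_le_mul {ε : ℝ} (hε : 0 < ε) (l : Fin 3) (x : E3) :
    |cutoffDeriv ε l x| ≤ 4 * ‖x‖ / ε ^ 2 := by
  refine (abs_cutoffDeriv_le hε l x).trans ?_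
  have h1 : ε ^ 2 ≤ ‖x‖ ^ 2 + ε ^ 2 := by nlinarith [sq_nonneg ‖x‖]
  gcongr

theorem cutoff_nonneg (ε : ℝ) (x : E3) : 0 ≤ cutoff ε x := sq_nonneg _

theorem measurable_cutoff (ε : ℝ) : Measurable (cutoff ε) := by
  unfold cutoff
  fun_prop

theorem measurable_cutoffDeriv (ε : ℝ) (l : Fin 3) : Measurable (cutoffDeriv ε l) := by
  unfold cutoffDeriv
  fun_prop

theorem tendsto_cutoff {x : E3} (hx : x ≠ 0) :
    Filter.Tendsto (fun ε => cutoff ε x) (nhds 0) (nhds 1) := by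
  have hr : ‖x‖ ^ 2 ≠ 0 := pow_ne_zero _ (norm_ne_zero_iff.2 hx)
  have h : ContinuousAt (fun ε => cutoff ε x) 0 := by
    unfold cutoff
    exact ContinuousAt.pow (ContinuousAt.div (by fun_prop) (by fun_prop) (by simpa using hx)) 2
  have := h.tendsto
  simpa [cutoff, hr, hx] using this

theorem tendsto_cutoffDeriv (l : Fin 3) {x : E3} (hx : x ≠ 0) :
    Filter.Tendsto (fun ε => cutoffDeriv ε l x) (nhds 0) (nhds 0) := by
  have h : ContinuousAt (fun ε => cutoffDeriv ε l x) 0 := by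
    unfold cutoffDeriv
    exact ContinuousAt.div (by fun_prop) (by fun_prop) (by simpa using hx)
  have := h.tendsto
  simpa [cutoffDeriv] using this

/-- `F` is differentiable in the direction `e_l` off the origin with derivative `F'`, and
`F = O(‖x‖⁻¹ + ‖x‖⁻²)`, `F' = O(‖x‖⁻² + ‖x‖⁻³)`. -/
structure HasSingularDeriv (l : Fin 3) (C : ℝ) (F F' : E3 → ℝ) : Prop where
  measurable : Measurable F
  measurable' : Measurable F'
  nonneg : 0 ≤ C
  bound : ∀ x, |F x| ≤ C * (‖x‖⁻¹ + (‖x‖ ^ 2)⁻¹)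
  bound' : ∀ x, |F' x| ≤ C * ((‖x‖ ^ 2)⁻¹ + (‖x‖ ^ 3)⁻¹)
  hasLineDerivAt : ∀ x ≠ 0, HasLineDerivAt ℝ F (F' x) x (unitVec l)

theorem integrable_of_le_singular (φ : 𝓢(E3, ℂ)) {F : E3 → ℝ} (hF : Measurable F) {A B : ℝ}
    (h : ∀ x, |F x| ≤ A * ‖x‖⁻¹ + B * (‖x‖ ^ 2)⁻¹) :
    Integrable (fun x => (F x : ℂ) * φ x) volume := by
  refine (((integrable_inv_mul_norm_schwartz φ).const_mul A).add
    ((integrable_inv_sq_mul_norm_schwartz φ).const_mul B)).mono'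
    ((Complex.measurable_ofReal.comp hF).aestronglyMeasurable.mul
      φ.continuous.aestronglyMeasurable) (Filter.Eventually.of_forall fun x => ?_)
  rw [norm_mul, Complex.norm_real]
  calc |F x| * ‖φ x‖ ≤ (A * ‖x‖⁻¹ + B * (‖x‖ ^ 2)⁻¹) * ‖φ x‖ := by
        gcongr
        exact h x
    _ = _ := by simp only [Pi.add_apply]; ring

namespace HasSingularDeriv

variable {l : Fin 3} {C ε : ℝ} {F F' : E3 → ℝ}

theorem abs_mul_cutoff_le (h : HasSingularDeriv l C F F') (hε : 0 < ε) (x : E3) :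
    |F' x * cutoff ε x| ≤ C / (4 * ε ^ 2) * ‖x‖⁻¹ + C * (‖x‖ ^ 2)⁻¹ := by
  have hC := h.nonneg
  rcases eq_or_ne x 0 with rfl | hx
  · simp [cutoff]
  have hr : 0 < ‖x‖ := norm_pos_iff.2 hx
  rw [abs_mul, abs_of_nonneg (cutoff_nonneg ε x)]
  calc _ ≤ C * ((‖x‖ ^ 2)⁻¹ + (‖x‖ ^ 3)⁻¹) * cutoff ε x := by
        gcongr
        · exact cutoff_nonneg ε x
        · exact h.bound' x
    _ = C * (‖x‖ ^ 2)⁻¹ * cutoff ε x + C * (‖x‖ ^ 3)⁻¹ * cutoff ε x := by ring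
    _ ≤ C * (‖x‖ ^ 2)⁻¹ * 1 + C * (‖x‖ ^ 3)⁻¹ * (‖x‖ ^ 2 / (4 * ε ^ 2)) := by
        gcongr
        · exact cutoff_le_one hε x
        · exact cutoff_le_sq hε x
    _ = _ := by field_simp; ring

theorem abs_mul_cutoffDeriv_le (h : HasSingularDeriv l C F F') (hε : 0 < ε) (x : E3) :
    |F x * cutoffDeriv ε l x| ≤ 4 * C / ε ^ 2 * ‖x‖⁻¹ + 4 * C * (‖x‖ ^ 2)⁻¹ := by
  have hC := h.nonneg
  rcases eq_or_ne x 0 with rfl | hx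
  · simp [cutoffDeriv]
  have hr : 0 < ‖x‖ := norm_pos_iff.2 hx
  rw [abs_mul]
  calc _ ≤ C * (‖x‖⁻¹ + (‖x‖ ^ 2)⁻¹) * |cutoffDeriv ε l x| := by
        gcongr
        exact h.bound x
    _ = C * ‖x‖⁻¹ * |cutoffDeriv ε l x| + C * (‖x‖ ^ 2)⁻¹ * |cutoffDeriv ε l x| := by ring
    _ ≤ C * ‖x‖⁻¹ * (4 * ‖x‖⁻¹) + C * (‖x‖ ^ 2)⁻¹ * (4 * ‖x‖ / ε ^ 2) := by
        gcongr
        · exact abs_cutoffDeriv_le_inv hε l x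
        · exact abs_cutoffDeriv_le_mul hε l x
    _ = _ := by field_simp; ring

theorem abs_mul_le (h : HasSingularDeriv l C F F') (hε : 0 < ε) (x : E3) :
    |F x * cutoff ε x| ≤ C * ‖x‖⁻¹ + C * (‖x‖ ^ 2)⁻¹ := by
  rw [abs_mul, abs_of_nonneg (cutoff_nonneg ε x), ← mul_add]
  exact (mul_le_of_le_one_right (abs_nonneg _) (cutoff_le_one hε x)).trans (h.bound x)

theorem hasLineDerivAt_mul_cutoff (h : HasSingularDeriv l C F F') (hε : 0 < ε) (x : E3) :
    HasLineDerivAt ℝ (fun x => F x * cutoff ε x) (F' x * cutoff ε x + F x * cutoffDeriv ε l x) x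
      (unitVec l) := by
  rcases eq_or_ne x 0 with rfl | hx
  · have hz : F' 0 * cutoff ε 0 + F 0 * cutoffDeriv ε l 0 = 0 := by simp [cutoff, cutoffDeriv]
    rw [hz, HasLineDerivAt]
    have hO : (fun t : ℝ => F (0 + t • unitVec l) * cutoff ε (0 + t • unitVec l)) =O[nhds 0]
        fun t => ‖t - 0‖ ^ 2 := by
      refine Asymptotics.IsBigO.of_bound (C * 2 / ε ^ 4) ?_
      filter_upwards [Metric.ball_mem_nhds (0 : ℝ) one_pos] with t ht
      have ht1 : |t| ≤ 1 := by simpa using (Metric.mem_ball.1 ht).le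
      have hC := h.nonneg
      rw [zero_add, sub_zero, Real.norm_eq_abs, Real.norm_eq_abs t, norm_pow, Real.norm_eq_abs,
        abs_abs]
      have hn : ‖t • unitVec l‖ = |t| := by rw [norm_smul, norm_unitVec, mul_one, Real.norm_eq_abs]
      have hc := cutoff_le_pow hε (t • unitVec l)
      have hb := h.bound (t • unitVec l)
      rw [hn] at hc hb
      rw [abs_mul, abs_of_nonneg (cutoff_nonneg ε _)]
      rcases eq_or_ne t 0 with rfl | ht0
      · simp [cutoff]
      have hta : 0 < |t| := abs_pos.2 ht0
      calc _ ≤ C * (|t|⁻¹ + (|t| ^ 2)⁻¹) * (|t| ^ 4 / ε ^ 4) := by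
            gcongr
            exact cutoff_nonneg ε _
        _ = C * (|t| + 1) / ε ^ 4 * |t| ^ 2 := by field_simp
        _ ≤ C * 2 / ε ^ 4 * |t| ^ 2 := by
            gcongr
            linarith
    have := (Asymptotics.IsBigO.hasFDerivAt (𝕜 := ℝ) hO one_lt_two).hasDerivAt
    simpa using this
  · have h1 := h.hasLineDerivAt x hx
    have h2 := hasLineDerivAt_cutoff hε l x
    rw [HasLineDerivAt] at h1 h2 ⊢
    simpa using h1.fun_mul h2

theorem integral_cutoff (h : HasSingularDeriv l C F F') (hε : 0 < ε) {ψ ψ' : 𝓢(E3, ℂ)}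
    (hψ : ∀ x, HasLineDerivAt ℝ ψ (ψ' x) x (unitVec l)) :
    ∫ x, ((F x * cutoff ε x : ℝ) : ℂ) * ψ' x =
      -((∫ x, ((F' x * cutoff ε x : ℝ) : ℂ) * ψ x) +
        ∫ x, ((F x * cutoffDeriv ε l x : ℝ) : ℂ) * ψ x) := by
  have i1 := integrable_of_le_singular ψ (h.measurable'.mul (measurable_cutoff ε))
    (h.abs_mul_cutoff_le hε)
  have i2 := integrable_of_le_singular ψ (h.measurable.mul (measurable_cutoffDeriv ε l))
    (h.abs_mul_cutoffDeriv_le hε)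
  have i3 := integrable_of_le_singular ψ (h.measurable.mul (measurable_cutoff ε))
    (h.abs_mul_le hε)
  have i4 := integrable_of_le_singular ψ' (h.measurable.mul (measurable_cutoff ε))
    (h.abs_mul_le hε)
  simp only [Pi.mul_apply] at i1 i2 i3 i4
  have e : ∀ x, ((F' x * cutoff ε x : ℝ) : ℂ) * ψ x + ((F x * cutoffDeriv ε l x : ℝ) : ℂ) * ψ x =
      ((F' x * cutoff ε x + F x * cutoffDeriv ε l x : ℝ) : ℂ) * ψ x := fun x => by
    push_cast
    ring
  rw [← integral_add i1 i2]
  have h5 := integral_bilinear_hasLineDerivAt_right_eq_neg_left_of_integrable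
    (μ := (volume : Measure E3)) (B := ContinuousLinearMap.mul ℝ ℂ)
    (f := fun x => ((F x * cutoff ε x : ℝ) : ℂ))
    (f' := fun x => ((F' x * cutoff ε x + F x * cutoffDeriv ε l x : ℝ) : ℂ))
    (g := ψ) (g' := ψ') (v := unitVec l)
    ((i1.add i2).congr (Filter.Eventually.of_forall e)) i4 i3
    (fun x _ => (h.hasLineDerivAt_mul_cutoff hε x).ofReal_comp) (fun x _ => hψ x)
  simp only [ContinuousLinearMap.mul_apply'] at h5
  simp only [e]
  exact h5

end HasSingularDeriv

theorem tendsto_inv_succ : Filter.Tendsto (fun n : ℕ => ((n : ℝ) + 1)⁻¹) Filter.atTop (nhds 0) := by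
  simpa [one_div] using tendsto_one_div_add_atTop_nhds_zero_nat (𝕜 := ℝ)

theorem tendsto_integral_mul_cutoff (φ : 𝓢(E3, ℂ)) {F : E3 → ℝ} (hF : Measurable F) {A B : ℝ}
    (h : ∀ x, |F x| ≤ A * ‖x‖⁻¹ + B * (‖x‖ ^ 2)⁻¹) :
    Filter.Tendsto (fun n : ℕ => ∫ x, ((F x * cutoff ((n : ℝ) + 1)⁻¹ x : ℝ) : ℂ) * φ x)
      Filter.atTop (nhds (∫ x, (F x : ℂ) * φ x)) := by
  refine tendsto_integral_of_dominated_convergence (fun x => ‖(F x : ℂ) * φ x‖) (fun n => ?_)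
    (integrable_of_le_singular φ hF h).norm (fun n => Filter.Eventually.of_forall fun x => ?_) ?_
  · exact (Complex.measurable_ofReal.comp
      (hF.mul (measurable_cutoff _))).aestronglyMeasurable.mul φ.continuous.aestronglyMeasurable
  · rw [norm_mul, norm_mul, Complex.norm_real, Complex.norm_real, Real.norm_eq_abs, abs_mul,
      abs_of_nonneg (cutoff_nonneg _ x), Real.norm_eq_abs]
    gcongr
    exact mul_le_of_le_one_right (abs_nonneg _) (cutoff_le_one (by positivity) x)
  · filter_upwards [ae_ne_zero] with x hx
    have h1 := ((tendsto_cutoff hx).comp tendsto_inv_succ).const_mul (F x)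
    rw [mul_one] at h1
    exact ((Complex.continuous_ofReal.tendsto _).comp h1).mul_const (φ x)

/-- Integration by parts when the singularity at the origin is too weak to contribute. -/
theorem HasSingularDeriv.integral_eq {l : Fin 3} {C A B : ℝ} {F F' : E3 → ℝ}
    (h : HasSingularDeriv l C F F') (hF : ∀ x, |F x| ≤ A * ‖x‖⁻¹)
    (hF' : ∀ x, |F' x| ≤ B * (‖x‖ ^ 2)⁻¹) {ψ ψ' : 𝓢(E3, ℂ)}
    (hψ : ∀ x, HasLineDerivAt ℝ ψ (ψ' x) x (unitVec l)) :
    ∫ x, (F x : ℂ) * ψ' x = -∫ x, (F' x : ℂ) * ψ x := by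
  have t1 := tendsto_integral_mul_cutoff ψ' h.measurable (A := A) (B := 0)
    fun x => by simpa using hF x
  have t2 := tendsto_integral_mul_cutoff ψ h.measurable' (A := 0) (B := B)
    fun x => by simpa using hF' x
  have t3 : Filter.Tendsto
      (fun n : ℕ => ∫ x, ((F x * cutoffDeriv ((n : ℝ) + 1)⁻¹ l x : ℝ) : ℂ) * ψ x)
      Filter.atTop (nhds 0) := by
    have : (0 : ℂ) = ∫ _ : E3, (0 : ℂ) := by simp
    rw [this]
    refine tendsto_integral_of_dominated_convergence
      (fun x => 4 * A * ((‖x‖ ^ 2)⁻¹ * ‖ψ x‖)) (fun n => ?_)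
      ((integrable_inv_sq_mul_norm_schwartz ψ).const_mul _)
      (fun n => Filter.Eventually.of_forall fun x => ?_) ?_
    · exact (Complex.measurable_ofReal.comp (h.measurable.mul
        (measurable_cutoffDeriv _ l))).aestronglyMeasurable.mul ψ.continuous.aestronglyMeasurable
    · rw [norm_mul, Complex.norm_real, Real.norm_eq_abs, abs_mul]
      calc _ ≤ A * ‖x‖⁻¹ * (4 * ‖x‖⁻¹) * ‖ψ x‖ := by
            have := hF x
            have := abs_cutoffDeriv_le_inv (ε := ((n : ℝ) + 1)⁻¹) (by positivity) l x
            have : 0 ≤ A * ‖x‖⁻¹ := (abs_nonneg _).trans (hF x)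
            gcongr
        _ = _ := by rw [← inv_pow]; ring
    · filter_upwards [ae_ne_zero] with x hx
      have h1 := ((tendsto_cutoffDeriv l hx).comp tendsto_inv_succ).const_mul (F x)
      rw [mul_zero] at h1
      have h2 := ((Complex.continuous_ofReal.tendsto _).comp h1).mul_const (ψ x)
      rw [Complex.ofReal_zero, zero_mul] at h2
      exact h2
  refine tendsto_nhds_unique t1 ?_
  have t4 := (t2.add t3).neg
  rw [add_zero] at t4
  refine t4.congr fun n => ?_
  rw [h.integral_cutoff (by positivity) hψ]

/-- The weight that represents the flux through the level sets of `cutoff`. -/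
def fluxWeight (r : ℝ) : ℝ := 4 * r ^ 2 / (r ^ 2 + 1) ^ 3

/-- The flux out of the origin of a field of homogeneity `-2` without divergence off the origin. It
is written as an average over all spheres, with a weight adapted to `cutoff`; as the flux through each
of them is the same, only the total mass of the weight matters. -/
def originFlux (S : Fin 3 → E3 → ℝ) : ℝ := ∫ x : E3, fluxWeight ‖x‖ * ∑ l, x l * S l x

theorem fluxWeight_nonneg (r : ℝ) : 0 ≤ fluxWeight r := by
  unfold fluxWeight
  positivity

theorem abs_fluxWeight_mul_le {C : ℝ} (hC : 0 ≤ C) {S : Fin 3 → E3 → ℝ}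
    (hS : ∀ l x, |S l x| ≤ C * (‖x‖ ^ 2)⁻¹) (x : E3) :
    |fluxWeight ‖x‖ * ∑ l, x l * S l x| ≤ 12 * C * (1 + ‖x‖ ^ 2) ^ (-(4 : ℝ) / 2) := by
  rcases eq_or_ne x 0 with rfl | hx
  · simp [fluxWeight]
    positivity
  have hr : 0 < ‖x‖ := norm_pos_iff.2 hx
  have h1 : |∑ l, x l * S l x| ≤ 3 * (C * ‖x‖⁻¹) := by
    have : ∀ l, |x l * S l x| ≤ C * ‖x‖⁻¹ := fun l => by
      rw [abs_mul]
      calc _ ≤ ‖x‖ * (C * (‖x‖ ^ 2)⁻¹) :=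
            mul_le_mul (abs_apply_le x l) (hS l x) (abs_nonneg _) hr.le
        _ = _ := by field_simp
    refine (Finset.abs_sum_le_sum_abs _ _).trans ((Finset.sum_le_sum fun l _ => this l).trans ?_)
    simp
  rw [show (-(4 : ℝ) / 2) = -(2 : ℕ) by norm_num, Real.rpow_neg (by positivity), Real.rpow_natCast,
    abs_mul, abs_of_nonneg (fluxWeight_nonneg _)]
  calc _ ≤ fluxWeight ‖x‖ * (3 * (C * ‖x‖⁻¹)) :=
        mul_le_mul_of_nonneg_left h1 (fluxWeight_nonneg _)
    _ = 12 * C * ‖x‖ / (1 + ‖x‖ ^ 2) ^ 3 := by rw [fluxWeight]; field_simp; ring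
    _ ≤ 12 * C * (1 + ‖x‖ ^ 2) / (1 + ‖x‖ ^ 2) ^ 3 := by
        gcongr
        nlinarith [sq_nonneg (‖x‖ - 1)]
    _ = _ := by field_simp

theorem integral_mul_cutoffDeriv {ε : ℝ} (hε : 0 < ε) {S : Fin 3 → E3 → ℝ}
    (hhom : ∀ l, ∀ a > 0, ∀ x, S l (a • x) = (a ^ 2)⁻¹ * S l x) (ψ : E3 → ℂ) :
    ∫ x, ∑ l, ((S l x * cutoffDeriv ε l x : ℝ) : ℂ) * ψ x =
      ∫ x, ((fluxWeight ‖x‖ * ∑ l, x l * S l x : ℝ) : ℂ) * ψ (ε • x) := by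
  have h := Measure.integral_comp_smul (volume : Measure E3)
    (fun x => ∑ l, ((S l x * cutoffDeriv ε l x : ℝ) : ℂ) * ψ x) ε
  have h3 : 0 < ε ^ 3 := by positivity
  rw [finrank_E3, abs_of_pos (by positivity)] at h
  have h' : ∫ x, ∑ l, ((S l x * cutoffDeriv ε l x : ℝ) : ℂ) * ψ x = (ε ^ 3 : ℝ) •
      ∫ x, ∑ l, ((S l (ε • x) * cutoffDeriv ε l (ε • x) : ℝ) : ℂ) * ψ (ε • x) := by
    rw [h, smul_smul, mul_inv_cancel₀ h3.ne', one_smul]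
  rw [h', ← integral_smul]
  congr 1
  ext x
  rw [← Finset.sum_mul, ← Complex.ofReal_sum, Complex.real_smul, ← mul_assoc, ← Complex.ofReal_mul]
  congr 2
  rw [Finset.mul_sum, Finset.mul_sum]
  refine Finset.sum_congr rfl fun l _ => ?_
  rw [hhom l ε hε, cutoffDeriv, fluxWeight, norm_smul, Real.norm_of_nonneg hε.le]
  have e : (ε * ‖x‖) ^ 2 + ε ^ 2 = ε ^ 2 * (‖x‖ ^ 2 + 1) := by ring
  have : 0 < ‖x‖ ^ 2 + 1 := by positivity
  rw [e]
  simp only [PiLp.smul_apply, smul_eq_mul]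
  field_simp

/-- A field of homogeneity `-2` whose divergence vanishes off the origin has the divergence
`originFlux S • δ₀` in the sense of distributions. -/
theorem sum_integral_mul_lineDeriv {C : ℝ} {S S' : Fin 3 → E3 → ℝ}
    (h : ∀ l, HasSingularDeriv l C (S l) (S' l)) (hS : ∀ l x, |S l x| ≤ C * (‖x‖ ^ 2)⁻¹)
    (hdiv : ∀ x ≠ 0, ∑ l, S' l x = 0) (hhom : ∀ l, ∀ a > 0, ∀ x, S l (a • x) = (a ^ 2)⁻¹ * S l x)
    {ψ : 𝓢(E3, ℂ)} {ψ' : Fin 3 → 𝓢(E3, ℂ)}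
    (hψ : ∀ l x, HasLineDerivAt ℝ ψ (ψ' l x) x (unitVec l)) :
    ∑ l, ∫ x, (S l x : ℂ) * ψ' l x = -((originFlux S : ℝ) * ψ 0) := by
  have hC := (h 0).nonneg
  have t1 : Filter.Tendsto (fun n : ℕ => ∑ l, ∫ x,
      ((S l x * cutoff ((n : ℝ) + 1)⁻¹ x : ℝ) : ℂ) * ψ' l x) Filter.atTop
      (nhds (∑ l, ∫ x, (S l x : ℂ) * ψ' l x)) :=
    tendsto_finsetSum _ fun l _ => tendsto_integral_mul_cutoff (ψ' l) (h l).measurable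
      (A := 0) (B := C) fun x => by simpa using hS l x
  refine tendsto_nhds_unique t1 ?_
  -- integrate by parts with the cutoff; by homogeneity the dilation `x ↦ ε x` moves `ε` into `ψ`
  have key : ∀ ε : ℝ, 0 < ε → ∑ l, ∫ x, ((S l x * cutoff ε x : ℝ) : ℂ) * ψ' l x =
      -∫ x, ((fluxWeight ‖x‖ * ∑ l, x l * S l x : ℝ) : ℂ) * ψ (ε • x) := fun ε hε => by
    have i1 : ∀ l, Integrable (fun x => ((S' l x * cutoff ε x : ℝ) : ℂ) * ψ x) volume := fun l =>
      integrable_of_le_singular ψ ((h l).measurable'.mul (measurable_cutoff ε))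
        ((h l).abs_mul_cutoff_le hε)
    have i2 : ∀ l, Integrable (fun x => ((S l x * cutoffDeriv ε l x : ℝ) : ℂ) * ψ x) volume :=
      fun l => integrable_of_le_singular ψ ((h l).measurable.mul (measurable_cutoffDeriv ε l))
        ((h l).abs_mul_cutoffDeriv_le hε)
    have hz : ∑ l, ∫ x, ((S' l x * cutoff ε x : ℝ) : ℂ) * ψ x = 0 := by
      rw [← integral_finsetSum _ fun l _ => i1 l]
      refine integral_eq_zero_of_ae ?_
      filter_upwards [ae_ne_zero] with x hx
      rw [← Finset.sum_mul, ← Complex.ofReal_sum, ← Finset.sum_mul, hdiv x hx]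
      simp
    rw [Finset.sum_congr rfl fun l _ => (h l).integral_cutoff hε (hψ l), Finset.sum_neg_distrib,
      Finset.sum_add_distrib, hz, zero_add, ← integral_finsetSum _ fun l _ => i2 l,
      integral_mul_cutoffDeriv hε hhom]
  simp only [fun n : ℕ => key ((n : ℝ) + 1)⁻¹ (by positivity)]
  refine Filter.Tendsto.neg ?_
  have hm : Measurable fun x : E3 => fluxWeight ‖x‖ * ∑ l, x l * S l x := by
    have := fun l => (h l).measurable
    unfold fluxWeight
    fun_prop
  have hlim : ((originFlux S : ℝ) : ℂ) * ψ 0 =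
      ∫ x, ((fluxWeight ‖x‖ * ∑ l, x l * S l x : ℝ) : ℂ) * ψ 0 := by
    rw [integral_mul_const, integral_complex_ofReal, originFlux]
  rw [hlim]
  have hi := (integrable_rpow_neg_one_add_norm_sq (E := E3) (μ := volume) (r := 4)
    (by rw [finrank_E3]; norm_num)).const_mul (12 * C)
  refine tendsto_integral_of_dominated_convergence
    (fun x => 12 * C * (1 + ‖x‖ ^ 2) ^ (-(4 : ℝ) / 2) * SchwartzMap.seminorm ℝ 0 0 ψ) (fun n => ?_)
    (hi.mul_const _) (fun n => Filter.Eventually.of_forall fun x => ?_)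
    (Filter.Eventually.of_forall fun x => ?_)
  · exact (Complex.measurable_ofReal.comp hm).aestronglyMeasurable.mul
      (ψ.continuous.comp (continuous_const_smul _)).aestronglyMeasurable
  · rw [norm_mul, Complex.norm_real]
    exact mul_le_mul (abs_fluxWeight_mul_le hC hS x) (SchwartzMap.norm_le_seminorm ℝ ψ _)
      (norm_nonneg _) (by positivity)
  · have h1 : Filter.Tendsto (fun n : ℕ => ((n : ℝ) + 1)⁻¹ • x) Filter.atTop (nhds (0 : E3)) := by
      simpa using tendsto_inv_succ.smul_const x
    exact ((ψ.continuous.tendsto 0).comp h1).const_mul _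

/-! ### The Slezkin–Landau stress as a singular field -/

theorem exists_bound_of_homogeneous {F : E3 → ℝ} {n : ℕ} (hc : ContinuousOn F {0}ᶜ)
    (hh : ∀ a > 0, ∀ x ≠ 0, F (a • x) = (a ^ n)⁻¹ * F x) (h0 : F 0 = 0) :
    ∃ C, 0 ≤ C ∧ ∀ x, |F x| ≤ C * (‖x‖ ^ n)⁻¹ := by
  obtain ⟨C, hC⟩ := (isCompact_sphere (0 : E3) 1).exists_bound_of_continuousOn
    (hc.mono fun x hx => by
      have : ‖x‖ = 1 := by simpa using hx
      simp [← norm_ne_zero_iff, this])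
  refine ⟨max C 0, le_max_right _ _, fun x => ?_⟩
  rcases eq_or_ne x 0 with rfl | hx
  · rw [h0, abs_zero]
    positivity
  have hr : 0 < ‖x‖ := norm_pos_iff.2 hx
  have hu : ‖x‖⁻¹ • x ≠ 0 := smul_ne_zero (inv_ne_zero hr.ne') hx
  have e : F x = (‖x‖ ^ n)⁻¹ * F (‖x‖⁻¹ • x) := by
    rw [← hh _ hr _ hu, smul_smul, mul_inv_cancel₀ hr.ne', one_smul]
  have h1 := hC (‖x‖⁻¹ • x) (by simp [norm_smul, hr.ne'])
  rw [e, abs_mul, abs_of_pos (by positivity), mul_comm]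
  gcongr
  exact h1.trans (le_max_left _ _)

/-- The reciprocal `(c ‖x‖ - x₀)⁻¹`. -/
def landauRecip (c : ℝ) (x : E3) : ℝ := (c * ‖x‖ - x 0)⁻¹

/-- The derivative `∂_l V_k` of the Slezkin–Landau field. -/
def landauGrad (c : ℝ) (l k : Fin 3) (x : E3) : ℝ := gradPoly c ‖x‖⁻¹ (landauRecip c x) x l k

/-- The stress tensor `V_l V_k + p δ_{lk} - ∂_l V_k` of the Slezkin–Landau flow. -/
def landauStress (c : ℝ) (l k : Fin 3) (x : E3) : ℝ := stressPoly c ‖x‖⁻¹ (landauRecip c x) x l k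

/-- The pressure of the Slezkin–Landau flow. -/
def landauPressure (c : ℝ) (x : E3) : ℝ := pressurePoly c ‖x‖⁻¹ (landauRecip c x) x

/-- The derivative `∂_l` of `landauStress`. -/
def landauStressDeriv (c : ℝ) (l k : Fin 3) (x : E3) : ℝ :=
  stressDerivPoly c ‖x‖⁻¹ (landauRecip c x) x l k

section

variable {c : ℝ}

theorem landau_denom_ne_zero (hc : 1 < |c|) {x : E3} (hx : x ≠ 0) : c * ‖x‖ - x 0 ≠ 0 := by
  intro h
  have hr : 0 < ‖x‖ := norm_pos_iff.2 hx
  have h1 : |c| * ‖x‖ ≤ ‖x‖ := by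
    calc |c| * ‖x‖ = |c * ‖x‖| := by rw [abs_mul, abs_norm]
      _ = |x 0| := by rw [sub_eq_zero.1 h]
      _ ≤ ‖x‖ := abs_apply_le x 0
  nlinarith

theorem landauRecip_smul (c : ℝ) {a : ℝ} (ha : 0 < a) (x : E3) :
    landauRecip c (a • x) = a⁻¹ * landauRecip c x := by
  rw [landauRecip, landauRecip, ← mul_inv, norm_smul, Real.norm_of_nonneg ha.le, PiLp.smul_apply,
    smul_eq_mul]
  ring_nf

theorem continuousOn_landauRecip (hc : 1 < |c|) : ContinuousOn (landauRecip c) {0}ᶜ := by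
  unfold landauRecip
  exact ContinuousOn.inv₀ (by fun_prop) fun x hx => landau_denom_ne_zero hc hx

theorem measurable_landauRecip (c : ℝ) : Measurable (landauRecip c) := by
  unfold landauRecip
  fun_prop

theorem landauField_eq_velPoly (hc : 1 < |c|) (x : E3) (k : Fin 3) :
    landauField c x k = velPoly c ‖x‖⁻¹ (landauRecip c x) x k := by
  rcases eq_or_ne x 0 with rfl | hx
  · fin_cases k <;> simp [landauField, velPoly, landauRecip]
  have hr : 0 < ‖x‖ := norm_pos_iff.2 hx
  have hq := landau_denom_ne_zero hc hx
  fin_cases k <;> simp [landauField, velPoly, landauRecip, axial, kron] <;> field_simp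
  ring

theorem sum_sq_mul_inv_norm {x : E3} (hx : x ≠ 0) :
    (x 0 ^ 2 + x 1 ^ 2 + x 2 ^ 2) * ‖x‖⁻¹ ^ 2 = 1 := by
  have hr : ‖x‖ ≠ 0 := norm_ne_zero_iff.2 hx
  have := EuclideanSpace.real_norm_sq_eq x
  rw [Fin.sum_univ_three] at this
  rw [← this]
  field_simp

theorem landauRecip_mul (hc : 1 < |c|) {x : E3} (hx : x ≠ 0) :
    landauRecip c x * (c - x 0 * ‖x‖⁻¹) = ‖x‖⁻¹ := by
  have hr : ‖x‖ ≠ 0 := norm_ne_zero_iff.2 hx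
  have hq := landau_denom_ne_zero hc hx
  rw [landauRecip]
  field_simp

theorem sum_landauStressDeriv (hc : 1 < |c|) (k : Fin 3) {x : E3} (hx : x ≠ 0) :
    ∑ l, landauStressDeriv c l k x = 0 :=
  sum_stressDerivPoly (inv_ne_zero (landau_denom_ne_zero hc hx)) (sum_sq_mul_inv_norm hx)
    (landauRecip_mul hc hx) k

theorem hasDerivAt_inv_norm_line {x : E3} (hx : x ≠ 0) (l : Fin 3) :
    HasDerivAt (fun t : ℝ => ‖x + t • unitVec l‖⁻¹) (-x l * ‖x‖⁻¹ ^ 3) 0 := by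
  have hr : ‖x‖ ≠ 0 := norm_ne_zero_iff.2 hx
  refine ((hasDerivAt_norm_line hx l).fun_inv (by simpa using hr)).congr_deriv ?_
  simp only [zero_smul, add_zero]
  field_simp

theorem hasDerivAt_coord_line (x : E3) (l i : Fin 3) :
    HasDerivAt (fun t : ℝ => (x + t • unitVec l) i) (kron l i) 0 := by
  refine (hasDerivAt_apply_line x l i 0).congr_deriv ?_
  simp only [kron, eq_comm]

theorem hasDerivAt_landauRecip_line (hc : 1 < |c|) {x : E3} (hx : x ≠ 0) (l : Fin 3) :
    HasDerivAt (fun t : ℝ => landauRecip c (x + t • unitVec l))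
      (-landauRecip c x ^ 2 * slope c ‖x‖⁻¹ x l) 0 := by
  have hq := landau_denom_ne_zero hc hx
  refine ((((hasDerivAt_norm_line hx l).const_mul c).fun_sub
    (hasDerivAt_coord_line x l 0)).fun_inv (by simpa using hq)).congr_deriv ?_
  simp only [zero_smul, add_zero, landauRecip, slope]
  field_simp

theorem hasLineDerivAt_landauField (hc : 1 < |c|) (l k : Fin 3) {x : E3} (hx : x ≠ 0) :
    HasLineDerivAt ℝ (fun x => landauField c x k) (landauGrad c l k x) x (unitVec l) := by
  have h := hasDerivAt_velPoly (c := c) (X := fun t => (x + t • unitVec l : E3)) (l := l)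
    (R := fun t => ‖x + t • unitVec l‖⁻¹) (G := fun t => landauRecip c (x + t • unitVec l))
    (by simpa using! hasDerivAt_inv_norm_line hx l)
    (by simpa using! hasDerivAt_landauRecip_line hc hx l) (fun i => hasDerivAt_coord_line x l i) k
  simp only [zero_smul, add_zero] at h
  rw [HasLineDerivAt]
  simp only [landauField_eq_velPoly hc]
  exact h

theorem hasLineDerivAt_landauStress (hc : 1 < |c|) (l k : Fin 3) {x : E3} (hx : x ≠ 0) :
    HasLineDerivAt ℝ (landauStress c l k) (landauStressDeriv c l k x) x (unitVec l) := by
  have h := hasDerivAt_stressPoly (c := c) (X := fun t => (x + t • unitVec l : E3)) (l := l)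
    (R := fun t => ‖x + t • unitVec l‖⁻¹) (G := fun t => landauRecip c (x + t • unitVec l))
    (by simpa using! hasDerivAt_inv_norm_line hx l)
    (by simpa using! hasDerivAt_landauRecip_line hc hx l) (fun i => hasDerivAt_coord_line x l i) k
  simp only [zero_smul, add_zero] at h
  exact h

theorem measurable_landauGrad (c : ℝ) (l k : Fin 3) : Measurable (landauGrad c l k) := by
  have := measurable_landauRecip c
  unfold landauGrad gradPoly slope axial axialDeriv
  fun_prop

theorem measurable_landauStress (c : ℝ) (l k : Fin 3) : Measurable (landauStress c l k) := by
  have := measurable_landauRecip c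
  unfold landauStress stressPoly velPoly pressurePoly gradPoly slope axial axialDeriv
  fun_prop

theorem measurable_landauStressDeriv (c : ℝ) (l k : Fin 3) :
    Measurable (landauStressDeriv c l k) := by
  have := measurable_landauRecip c
  unfold landauStressDeriv stressDerivPoly velPoly pressureDerivPoly gradPoly hessPoly slope axial
    axialDeriv slopeDeriv axialDeriv₂
  fun_prop

theorem continuousOn_inv_norm : ContinuousOn (fun x : E3 => ‖x‖⁻¹) {0}ᶜ :=
  ContinuousOn.inv₀ (by fun_prop) fun x hx => norm_ne_zero_iff.2 hx

theorem continuousOn_landauGrad (hc : 1 < |c|) (l k : Fin 3) :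
    ContinuousOn (landauGrad c l k) {0}ᶜ := by
  have := continuousOn_landauRecip hc
  have := continuousOn_inv_norm
  unfold landauGrad gradPoly slope axial axialDeriv
  fun_prop

theorem continuousOn_landauStress (hc : 1 < |c|) (l k : Fin 3) :
    ContinuousOn (landauStress c l k) {0}ᶜ := by
  have := continuousOn_landauRecip hc
  have := continuousOn_inv_norm
  unfold landauStress stressPoly velPoly pressurePoly gradPoly slope axial axialDeriv
  fun_prop

theorem continuousOn_landauStressDeriv (hc : 1 < |c|) (l k : Fin 3) :
    ContinuousOn (landauStressDeriv c l k) {0}ᶜ := by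
  have := continuousOn_landauRecip hc
  have := continuousOn_inv_norm
  unfold landauStressDeriv stressDerivPoly velPoly pressureDerivPoly gradPoly hessPoly slope axial
    axialDeriv slopeDeriv axialDeriv₂
  fun_prop

theorem landauGrad_smul (c : ℝ) (l k : Fin 3) {a : ℝ} (ha : 0 < a) (x : E3) :
    landauGrad c l k (a • x) = (a ^ 2)⁻¹ * landauGrad c l k x := by
  rw [landauGrad, landauGrad, landauRecip_smul c ha, norm_smul, Real.norm_of_nonneg ha.le, mul_inv]
  generalize landauRecip c x = g
  generalize ‖x‖⁻¹ = ρ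
  simp only [gradPoly, slope, axial, axialDeriv, PiLp.smul_apply, smul_eq_mul]
  field_simp

theorem landauStress_smul (c : ℝ) (l k : Fin 3) {a : ℝ} (ha : 0 < a) (x : E3) :
    landauStress c l k (a • x) = (a ^ 2)⁻¹ * landauStress c l k x := by
  rw [landauStress, landauStress, landauRecip_smul c ha, norm_smul, Real.norm_of_nonneg ha.le,
    mul_inv]
  generalize landauRecip c x = g
  generalize ‖x‖⁻¹ = ρ
  simp only [stressPoly, velPoly, pressurePoly, gradPoly, slope, axial, axialDeriv, PiLp.smul_apply,
    smul_eq_mul]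
  field_simp

theorem landauStressDeriv_smul (c : ℝ) (l k : Fin 3) {a : ℝ} (ha : 0 < a) (x : E3) :
    landauStressDeriv c l k (a • x) = (a ^ 3)⁻¹ * landauStressDeriv c l k x := by
  rw [landauStressDeriv, landauStressDeriv, landauRecip_smul c ha, norm_smul,
    Real.norm_of_nonneg ha.le, mul_inv]
  generalize landauRecip c x = g
  generalize ‖x‖⁻¹ = ρ
  simp only [stressDerivPoly, velPoly, pressureDerivPoly, gradPoly, hessPoly, slope, axial,
    axialDeriv, slopeDeriv, axialDeriv₂, PiLp.smul_apply, smul_eq_mul]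
  field_simp

end

/-! ### The strength of the point force -/

/-- The cylindrical coordinates `(x₀, √(x₁² + x₂²))`. -/
def cylindrical (x : E3) : ℝ × ℝ := (x 0, √(x 1 ^ 2 + x 2 ^ 2))

theorem measurable_cylindrical : Measurable cylindrical := by
  unfold cylindrical
  fun_prop

theorem lintegral_plane_radial {H : ℝ → ℝ≥0∞} (hH : Measurable H) :
    ∫⁻ w : Fin 2 → ℝ, H √(w 0 ^ 2 + w 1 ^ 2) =
      ∫⁻ ρ, ENNReal.ofReal (2 * Real.pi * ρ) * H ρ := by
  have hpi := Real.pi_pos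
  have h1 := (volume_preserving_finTwoArrow ℝ).lintegral_comp_emb
    (MeasurableEquiv.finTwoArrow (α := ℝ)).measurableEmbedding
    (fun p : ℝ × ℝ => H √(p.1 ^ 2 + p.2 ^ 2))
  refine h1.trans ?_
  rw [← lintegral_comp_polarCoord_symm]
  have e : ∀ p ∈ polarCoord.target, ENNReal.ofReal p.1 •
      H √((polarCoord.symm p).1 ^ 2 + (polarCoord.symm p).2 ^ 2) = ENNReal.ofReal p.1 * H p.1 := by
    intro p hp
    have hp1 : (0 : ℝ) < p.1 := hp.1
    rw [smul_eq_mul, polarCoord_symm_apply]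
    congr 2
    have : (p.1 * Real.cos p.2) ^ 2 + (p.1 * Real.sin p.2) ^ 2 = p.1 ^ 2 := by
      linear_combination p.1 ^ 2 * Real.sin_sq_add_cos_sq p.2
    rw [this, Real.sqrt_sq hp1.le]
  rw [setLIntegral_congr_fun polarCoord.open_target.measurableSet e, polarCoord_target,
    Measure.volume_eq_prod, ← Measure.prod_restrict,
    lintegral_prod _ (Measurable.aemeasurable (by fun_prop))]
  simp only [lintegral_const, Measure.restrict_apply_univ, Real.volume_Ioo]
  rw [← lintegral_indicator measurableSet_Ioi]
  congr 1
  ext ρ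
  by_cases hρ : 0 < ρ
  · rw [Set.indicator_of_mem (Set.mem_Ioi.2 hρ), mul_right_comm, ← ENNReal.ofReal_mul hρ.le]
    congr 2
    ring
  · rw [Set.indicator_of_notMem (by simpa using hρ), ENNReal.ofReal_of_nonpos, zero_mul]
    nlinarith

theorem map_cylindrical : Measure.map cylindrical (volume : Measure E3) =
    (volume : Measure (ℝ × ℝ)).withDensity fun p => ENNReal.ofReal (2 * Real.pi * p.2) := by
  refine Measure.ext_of_lintegral _ fun H hH => ?_
  rw [lintegral_map hH measurable_cylindrical,
    lintegral_withDensity_eq_lintegral_mul _ (by fun_prop) hH]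
  have h1 := (PiLp.volume_preserving_toLp (Fin 3)).lintegral_comp_emb
    (MeasurableEquiv.toLp 2 (Fin 3 → ℝ)).measurableEmbedding (fun x : E3 => H (cylindrical x))
  rw [← h1]
  have h2 := (volume_preserving_piFinSuccAbove (fun _ : Fin 3 => ℝ) 0).lintegral_comp_emb
    (MeasurableEquiv.piFinSuccAbove (fun _ : Fin 3 => ℝ) 0).measurableEmbedding
    (fun p : ℝ × (Fin 2 → ℝ) => H (p.1, √(p.2 0 ^ 2 + p.2 1 ^ 2)))
  refine h2.trans ?_
  rw [Measure.volume_eq_prod, Measure.volume_eq_prod,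
    lintegral_prod _ (Measurable.aemeasurable (by fun_prop)),
    lintegral_prod _ (Measurable.aemeasurable (by fun_prop))]
  congr 1
  ext a
  exact lintegral_plane_radial (hH.comp measurable_prodMk_left)

theorem norm_eq_cylindrical (x : E3) :
    ‖x‖ = √((cylindrical x).1 ^ 2 + (cylindrical x).2 ^ 2) := by
  rw [cylindrical, Real.sq_sqrt (by positivity), ← Real.sqrt_sq (norm_nonneg x),
    EuclideanSpace.real_norm_sq_eq, Fin.sum_univ_three, add_assoc]

/-- Integration in spherical coordinates with the axis `e₀`. -/
theorem integral_radial_mul_axial {h f : ℝ → ℝ} (hh : Measurable h) (hf : Measurable f) :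
    ∫ x : E3, h ‖x‖ * f (x 0 / ‖x‖) =
      2 * Real.pi * (∫ r in Set.Ioi (0 : ℝ), r ^ 2 * h r) *
        ∫ θ in (0 : ℝ)..Real.pi, Real.sin θ * f (Real.cos θ) := by
  have hpi := Real.pi_pos
  let Φ : ℝ × ℝ → ℝ := fun p => h √(p.1 ^ 2 + p.2 ^ 2) * f (p.1 / √(p.1 ^ 2 + p.2 ^ 2))
  have hΦ : Measurable Φ := by fun_prop
  have e1 : ∫ x : E3, h ‖x‖ * f (x 0 / ‖x‖) = ∫ x : E3, Φ (cylindrical x) := by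
    congr 1
    ext x
    rw [norm_eq_cylindrical]
    rfl
  rw [e1, ← integral_map measurable_cylindrical.aemeasurable hΦ.aestronglyMeasurable,
    map_cylindrical, integral_withDensity_eq_integral_toReal_smul (by fun_prop)
      (Filter.Eventually.of_forall fun _ => ENNReal.ofReal_lt_top), ← integral_comp_polarCoord_symm]
  have e2 : ∀ p ∈ polarCoord.target, p.1 • (ENNReal.ofReal
      (2 * Real.pi * (polarCoord.symm p).2)).toReal • Φ (polarCoord.symm p) =
      2 * Real.pi * (p.1 ^ 2 * h p.1) * (max (Real.sin p.2) 0 * f (Real.cos p.2)) := by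
    intro p hp
    have hp1 : (0 : ℝ) < p.1 := hp.1
    have : (p.1 * Real.cos p.2) ^ 2 + (p.1 * Real.sin p.2) ^ 2 = p.1 ^ 2 := by
      linear_combination p.1 ^ 2 * Real.sin_sq_add_cos_sq p.2
    simp only [polarCoord_symm_apply, Φ, this, Real.sqrt_sq hp1.le, smul_eq_mul,
      ENNReal.toReal_ofReal']
    rw [mul_div_cancel_left₀ _ hp1.ne']
    have hmax : max (2 * Real.pi * (p.1 * Real.sin p.2)) 0 =
        2 * Real.pi * p.1 * max (Real.sin p.2) 0 := by
      rw [mul_max_of_nonneg _ _ (by positivity), mul_zero]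
      ring_nf
    rw [hmax]
    ring
  rw [setIntegral_congr_fun polarCoord.open_target.measurableSet e2, polarCoord_target,
    Measure.volume_eq_prod, setIntegral_prod_mul (fun r => 2 * Real.pi * (r ^ 2 * h r))
      (fun θ => max (Real.sin θ) 0 * f (Real.cos θ)), integral_const_mul]
  congr 1
  rw [intervalIntegral.integral_of_le hpi.le, integral_Ioc_eq_integral_Ioo,
    setIntegral_eq_of_subset_of_forall_sdiff_eq_zero (s := Set.Ioo 0 Real.pi) measurableSet_Ioo
      (Set.Ioo_subset_Ioo_left (by linarith)) fun θ hθ => ?_]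
  · refine setIntegral_congr_fun measurableSet_Ioo fun θ hθ => ?_
    rw [max_eq_left (Real.sin_pos_of_mem_Ioo hθ).le]
  · have h0 : θ ≤ 0 := by
      by_contra hcon
      exact hθ.2 ⟨not_le.1 hcon, hθ.1.2⟩
    rw [max_eq_right (Real.sin_nonpos_of_nonpos_of_neg_pi_le h0 hθ.1.1.le), zero_mul]

theorem integral_fluxWeight : ∫ r in Set.Ioi (0 : ℝ), r ^ 2 * (fluxWeight r * r⁻¹) = 1 := by
  have hd : ∀ r : ℝ, HasDerivAt (fun r : ℝ => (r ^ 2 / (r ^ 2 + 1)) ^ 2)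
      (4 * r ^ 3 / (r ^ 2 + 1) ^ 3) r := fun r => by
    have hp : 0 < r ^ 2 + 1 := by positivity
    have h1 : HasDerivAt (fun r : ℝ => r ^ 2) (2 * r) r := by
      simpa using (hasDerivAt_id r).fun_pow 2
    refine ((h1.fun_div (h1.add_const 1) hp.ne').fun_pow 2).congr_deriv ?_
    norm_num
    field_simp
    ring
  have ht : Filter.Tendsto (fun r : ℝ => (r ^ 2 / (r ^ 2 + 1)) ^ 2) Filter.atTop (nhds 1) := by
    have h1 : Filter.Tendsto (fun r : ℝ => (r ^ 2 + 1)⁻¹) Filter.atTop (nhds 0) :=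
      (Filter.tendsto_atTop_add_const_right _ 1
        (Filter.tendsto_pow_atTop two_ne_zero)).inv_tendsto_atTop
    have h2 := ((h1.const_sub 1).pow 2)
    rw [sub_zero, one_pow] at h2
    refine h2.congr fun r => ?_
    have hp : r ^ 2 + 1 ≠ 0 := by positivity
    congr 1
    field_simp
    ring
  have h := integral_Ioi_of_hasDerivAt_of_nonneg (hd 0).continuousAt.continuousWithinAt
    (fun r _ => hd r) (fun r hr => by have : (0 : ℝ) < r := hr; positivity) ht
  rw [show (1 : ℝ) = 1 - ((0 : ℝ) ^ 2 / (0 ^ 2 + 1)) ^ 2 by norm_num, ← h]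
  refine setIntegral_congr_fun measurableSet_Ioi fun r hr => ?_
  have hr' : (0 : ℝ) < r := hr
  simp only [fluxWeight]
  field_simp

/-- The angular profile of the axial momentum flux of the Slezkin–Landau flow. -/
def landauFlux (c s : ℝ) : ℝ :=
  (2 * (c ^ 2 - 1) / (c - s) ^ 2 - 1) * (2 / (c - s) + 2 * s * (c * s - 1) / (c - s) ^ 2) +
    s * (4 * (c * s - 1) / (c - s) ^ 2)

theorem measurable_landauFlux (c : ℝ) : Measurable (landauFlux c) := by
  unfold landauFlux
  fun_prop

section

variable {c : ℝ}

theorem sum_mul_landauStress (hc : 1 < |c|) (k : Fin 3) {x : E3} (hx : x ≠ 0) :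
    ∑ l, x l * landauStress c l k x =
      (2 * (c ^ 2 - 1) * (landauRecip c x / ‖x‖⁻¹) ^ 2 - 1) *
        velPoly c ‖x‖⁻¹ (landauRecip c x) x k + x k * landauPressure c x :=
  sum_mul_stressPoly (sum_sq_mul_inv_norm hx) (landauRecip_mul hc hx) k

theorem sum_mul_landauStress_zero (hc : 1 < |c|) {x : E3} (hx : x ≠ 0) :
    ∑ l, x l * landauStress c l 0 x = ‖x‖⁻¹ * landauFlux c (x 0 / ‖x‖) := by
  have hr : 0 < ‖x‖ := norm_pos_iff.2 hx
  have hq := landau_denom_ne_zero hc hx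
  rw [sum_mul_landauStress hc 0 hx]
  simp only [landauPressure, pressurePoly, velPoly, landauRecip, landauFlux, axial, kron_self]
  have e : c - x 0 / ‖x‖ = (c * ‖x‖ - x 0) / ‖x‖ := by field_simp
  rw [e]
  generalize c * ‖x‖ - x 0 = q at hq
  field_simp

/-- The half turn around the axis `e₀`. -/
def halfTurn : E3 ≃ₗᵢ[ℝ] E3 :=
  LinearIsometryEquiv.piLpCongrRight 2 fun i : Fin 3 =>
    if i = 0 then LinearIsometryEquiv.refl ℝ ℝ else LinearIsometryEquiv.neg ℝ

theorem halfTurn_apply_zero (x : E3) : halfTurn x 0 = x 0 := by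
  simp [halfTurn]

theorem halfTurn_apply_of_ne (x : E3) {k : Fin 3} (hk : k ≠ 0) : halfTurn x k = -x k := by
  simp [halfTurn, hk]

/-- The transversal components of the flux vanish since the field is invariant under half turns. -/
theorem originFlux_landauStress_of_ne (hc : 1 < |c|) {k : Fin 3} (hk : k ≠ 0) :
    originFlux (fun l => landauStress c l k) = 0 := by
  have h := halfTurn.measurePreserving.integral_comp
    halfTurn.toHomeomorph.measurableEmbedding
    (fun x => fluxWeight ‖x‖ * ∑ l, x l * landauStress c l k x)
  have e : ∫ x : E3, fluxWeight ‖halfTurn x‖ *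
      ∑ l, halfTurn x l * landauStress c l k (halfTurn x) =
      -∫ x : E3, fluxWeight ‖x‖ * ∑ l, x l * landauStress c l k x := by
    rw [← integral_neg]
    refine integral_congr_ae ?_
    filter_upwards [ae_ne_zero] with x hx
    have hx' : halfTurn x ≠ 0 := by simpa using hx
    rw [sum_mul_landauStress hc k hx, sum_mul_landauStress hc k hx']
    simp only [landauPressure, pressurePoly, velPoly, landauRecip, axial, halfTurn_apply_zero,
      halfTurn_apply_of_ne x hk, LinearIsometryEquiv.norm_map, kron, if_neg hk]
    ring
  rw [originFlux]
  have h' := e.symm.trans h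
  linarith

theorem sub_ne_zero_of_abs_le_one (hc : 1 < |c|) {s : ℝ} (hs : |s| ≤ 1) : c - s ≠ 0 := by
  intro h
  rw [sub_eq_zero.1 h] at hc
  linarith

theorem integral_landauFlux (hc : 1 < |c|) :
    2 * Real.pi * ∫ θ in (0 : ℝ)..Real.pi, Real.sin θ * landauFlux c (Real.cos θ) =
      landauKappa c := by
  have ha := sq_sub_one_pos hc
  set a := c ^ 2 - 1 with hadef
  let A : ℝ → ℝ := fun s => 4 * a ^ 2 * c / 3 * ((c - s) ^ 3)⁻¹ - 4 * a ^ 2 * ((c - s) ^ 2)⁻¹ +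
    6 * a * c * (c - s)⁻¹ + 4 * c ^ 2 * Real.log (c - s) + 2 * c * s
  have hA : ∀ s, |s| ≤ 1 → HasDerivAt A (landauFlux c s) s := fun s hs => by
    have hu := sub_ne_zero_of_abs_le_one hc hs
    have h1 : HasDerivAt (fun s : ℝ => c - s) (-1) s := (hasDerivAt_id s).const_sub c
    refine ((((((h1.fun_pow 3).fun_inv (pow_ne_zero 3 hu)).const_mul (4 * a ^ 2 * c / 3)).fun_sub
      (((h1.fun_pow 2).fun_inv (pow_ne_zero 2 hu)).const_mul (4 * a ^ 2))).fun_add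
      ((h1.fun_inv hu).const_mul (6 * a * c))).fun_add
      ((h1.log hu).const_mul (4 * c ^ 2))).fun_add ((hasDerivAt_id s).const_mul (2 * c))
      |>.congr_deriv ?_
    rw [landauFlux, hadef]
    field_simp
    norm_num
    ring
  have hd : ∀ θ ∈ Set.uIcc 0 Real.pi, HasDerivAt (fun θ => -A (Real.cos θ))
      (Real.sin θ * landauFlux c (Real.cos θ)) θ := fun θ _ => by
    refine ((hA _ (Real.abs_cos_le_one θ)).comp θ (Real.hasDerivAt_cos θ)).neg.congr_deriv ?_
    ring
  have hcont : Continuous fun θ => Real.sin θ * landauFlux c (Real.cos θ) := by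
    unfold landauFlux
    have hu : ∀ θ, c - Real.cos θ ≠ 0 := fun θ =>
      sub_ne_zero_of_abs_le_one hc (Real.abs_cos_le_one θ)
    have hu2 : ∀ θ, (c - Real.cos θ) ^ 2 ≠ 0 := fun θ => pow_ne_zero 2 (hu θ)
    fun_prop (disch := assumption)
  rw [intervalIntegral.integral_eq_sub_of_hasDerivAt hd (hcont.intervalIntegrable _ _)]
  have hm : c - 1 ≠ 0 := sub_ne_zero_of_abs_le_one hc (by simp)
  have hp : c + 1 ≠ 0 := by
    have := sub_ne_zero_of_abs_le_one hc (s := -1) (by simp)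
    simpa using this
  simp only [A, Real.cos_pi, Real.cos_zero, sub_neg_eq_add]
  rw [landauKappa, Real.log_div hp hm, ← hadef]
  have hfac : a = (c - 1) * (c + 1) := by rw [hadef]; ring
  rw [hfac]
  field_simp
  ring

/-- The axial momentum flux out of the origin is the strength of the point force. -/
theorem originFlux_landauStress_zero (hc : 1 < |c|) :
    originFlux (fun l => landauStress c l 0) = landauKappa c := by
  have e : originFlux (fun l => landauStress c l 0) =
      ∫ x : E3, (fun r => fluxWeight r * r⁻¹) ‖x‖ * landauFlux c (x 0 / ‖x‖) := by
    rw [originFlux]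
    refine integral_congr_ae ?_
    filter_upwards [ae_ne_zero] with x hx
    rw [sum_mul_landauStress_zero hc hx, mul_assoc]
  have hw : Measurable fun r => fluxWeight r * r⁻¹ := by
    unfold fluxWeight
    fun_prop
  rw [e, integral_radial_mul_axial hw (measurable_landauFlux c), integral_fluxWeight, mul_one,
    integral_landauFlux hc]

theorem originFlux_landauStress (hc : 1 < |c|) (k : Fin 3) :
    originFlux (fun l => landauStress c l k) = landauKappa c * kron k 0 := by
  by_cases hk : k = 0
  · subst hk
    rw [originFlux_landauStress_zero hc, kron_self, mul_one]
  · rw [originFlux_landauStress_of_ne hc hk, kron, if_neg hk, mul_zero]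

theorem abs_landauFlux_le (hc : 2 ≤ |c|) {s : ℝ} (hs : |s| ≤ 1) : |landauFlux c s| ≤ 300 / |c| := by
  have hu : |c| / 2 ≤ |c - s| := by
    have := abs_sub_abs_le_abs_sub c s
    linarith
  have hC : 0 < |c| := by linarith
  have hg : |c - s|⁻¹ ≤ 2 / |c| := by
    rw [inv_le_comm₀ (by linarith) (by positivity), inv_div]
    exact hu
  have hu0 : c - s ≠ 0 := abs_pos.1 (by linarith)
  have hg2 : ((c - s) ^ 2)⁻¹ ≤ 4 / |c| ^ 2 := by
    rw [← sq_abs, ← inv_pow]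
    calc _ ≤ (2 / |c|) ^ 2 := by gcongr
      _ = _ := by ring
  have hg2' : 0 ≤ ((c - s) ^ 2)⁻¹ := by positivity
  have h1 : |2 * (c ^ 2 - 1) / (c - s) ^ 2 - 1| ≤ 9 := by
    have e : 2 * (c ^ 2 - 1) * ((c - s) ^ 2)⁻¹ ≤ 8 := by
      calc _ ≤ 2 * (|c| ^ 2) * (4 / |c| ^ 2) := by
            have : c ^ 2 - 1 ≤ |c| ^ 2 := by rw [sq_abs]; linarith
            gcongr
        _ = 8 := by field_simp; norm_num
    have e0 : 0 ≤ 2 * (c ^ 2 - 1) * ((c - s) ^ 2)⁻¹ := by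
      have : 0 < c ^ 2 - 1 := sq_sub_one_pos (by linarith)
      positivity
    rw [div_eq_mul_inv, abs_le]
    constructor <;> linarith
  have hcs : |c * s - 1| ≤ |c| + 1 := by
    refine (abs_sub _ _).trans ?_
    rw [abs_mul, abs_one]
    nlinarith
  have h2 : |2 / (c - s) + 2 * s * (c * s - 1) / (c - s) ^ 2| ≤ 16 / |c| := by
    have e1 : |2 / (c - s)| ≤ 4 / |c| := by
      rw [abs_div, abs_two, div_eq_mul_inv]
      calc _ ≤ 2 * (2 / |c|) := by gcongr
        _ = _ := by ring
    have e2 : |2 * s * (c * s - 1) / (c - s) ^ 2| ≤ 12 / |c| := by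
      rw [div_eq_mul_inv, abs_mul, abs_mul, abs_mul, abs_two, abs_of_nonneg hg2']
      calc _ ≤ 2 * 1 * (|c| + 1) * (4 / |c| ^ 2) := by gcongr
        _ ≤ 2 * 1 * (3 / 2 * |c|) * (4 / |c| ^ 2) := by gcongr; linarith
        _ = _ := by field_simp; norm_num
    calc _ ≤ 4 / |c| + 12 / |c| := (abs_add_le _ _).trans (add_le_add e1 e2)
      _ = _ := by ring
  have h3 : |s * (4 * (c * s - 1) / (c - s) ^ 2)| ≤ 24 / |c| := by
    rw [div_eq_mul_inv, abs_mul, abs_mul, abs_mul, abs_of_nonneg hg2',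
      abs_of_pos (by norm_num : (0 : ℝ) < 4)]
    calc _ ≤ 1 * (4 * (|c| + 1) * (4 / |c| ^ 2)) := by gcongr
      _ ≤ 1 * (4 * (3 / 2 * |c|) * (4 / |c| ^ 2)) := by gcongr; linarith
      _ = _ := by field_simp; norm_num
  rw [landauFlux]
  refine (abs_add_le _ _).trans ?_
  rw [abs_mul]
  calc _ ≤ 9 * (16 / |c|) + 24 / |c| := by gcongr
    _ = 168 / |c| := by ring
    _ ≤ _ := by gcongr; norm_num

theorem abs_landauKappa_le (hc : 2 ≤ |c|) : |landauKappa c| ≤ 600 * Real.pi ^ 2 / |c| := by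
  have hpi := Real.pi_pos
  rw [← integral_landauFlux (by linarith), abs_mul, abs_of_pos (by positivity)]
  have h := intervalIntegral.norm_integral_le_of_norm_le_const (a := 0) (b := Real.pi)
    (f := fun θ => Real.sin θ * landauFlux c (Real.cos θ)) (C := 300 / |c|) fun θ _ => by
      rw [norm_mul, Real.norm_eq_abs, Real.norm_eq_abs]
      calc _ ≤ 1 * (300 / |c|) := by
            gcongr
            · exact Real.abs_sin_le_one θ
            · exact abs_landauFlux_le hc (Real.abs_cos_le_one θ)
        _ = _ := one_mul _
  rw [sub_zero, abs_of_pos hpi, Real.norm_eq_abs] at h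
  calc _ ≤ 2 * Real.pi * (300 / |c| * Real.pi) := by gcongr
    _ = _ := by ring

end

/-! ### The stationary equation for the Slezkin–Landau field -/

/-- Multiplication by `i ξ_l`, which the Fourier transform turns into `∂_l`. -/
def waveMul (l : Fin 3) : 𝓢(E3, ℂ) →L[ℂ] 𝓢(E3, ℂ) :=
  SchwartzMap.smulLeftCLM ℂ fun ξ : E3 => Complex.I * (ξ l : ℂ)

theorem waveMul_apply (l : Fin 3) (φ : 𝓢(E3, ℂ)) (ξ : E3) :
    waveMul l φ ξ = Complex.I * ξ l * φ ξ := by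
  have h : (fun ξ : E3 => Complex.I * (ξ l : ℂ)).HasTemperateGrowth := by
    have h1 : (fun ξ : E3 => (ξ l : ℂ)).HasTemperateGrowth :=
      (Complex.ofRealCLM ∘L (EuclideanSpace.proj l : E3 →L[ℝ] ℝ)).hasTemperateGrowth
    fun_prop
  rw [waveMul, SchwartzMap.smulLeftCLM_apply_apply h, smul_eq_mul]

theorem hasLineDerivAt_hatSchwartz (l : Fin 3) (φ : 𝓢(E3, ℂ)) (x : E3) :
    HasLineDerivAt ℝ (hatSchwartz φ) (hatSchwartz (waveMul l φ) x) x (unitVec l) := by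
  have hF : ∀ ξ, AEStronglyMeasurable (fun y => phase y ξ * φ y) volume := fun ξ =>
    ((continuous_phase.comp (by fun_prop : Continuous fun y : E3 => (y, ξ))).mul
      φ.continuous).aestronglyMeasurable
  have h := (hasDerivAt_integral_of_dominated_loc_of_deriv_le (μ := (volume : Measure E3))
    (F := fun t y => phase y (x + t • unitVec l) * φ y) (x₀ := (0 : ℝ)) (s := Set.univ)
    (F' := fun t y => phase y (x + t • unitVec l) * waveMul l φ y)
    (bound := fun y => ‖waveMul l φ y‖) Filter.univ_mem
    (Filter.Eventually.of_forall fun t => hF _) (φ.integrable.norm.mono' (hF _)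
      (Filter.Eventually.of_forall fun y => by rw [norm_mul, norm_phase, one_mul]))
    ((continuous_phase.comp (by fun_prop : Continuous fun y : E3 =>
      (y, x + (0 : ℝ) • unitVec l))).mul (waveMul l φ).continuous).aestronglyMeasurable
    (Filter.Eventually.of_forall fun y t _ => by rw [norm_mul, norm_phase, one_mul])
    (waveMul l φ).integrable.norm
    (Filter.Eventually.of_forall fun y t _ => by
      refine ((hasDerivAt_phase_line y x l t).mul_const (φ y)).congr_deriv ?_
      rw [waveMul_apply]
      ring)).2
  simp only [← hatSchwartz_eq_phase, zero_smul, add_zero] at h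
  exact h

/-- A function of negative homogeneity vanishes at the origin if it is homogeneous there, too. -/
theorem eq_zero_of_homogeneous {F : E3 → ℝ} {n : ℕ} (hn : n ≠ 0)
    (h : ∀ a > 0, ∀ x, F (a • x) = (a ^ n)⁻¹ * F x) : F 0 = 0 := by
  have h1 := h 2 two_pos 0
  rw [smul_zero] at h1
  have h2 : ((2 : ℝ) ^ n)⁻¹ < 1 := inv_lt_one_of_one_lt₀ (one_lt_pow₀ one_lt_two hn)
  nlinarith [mul_eq_zero.1 (show (1 - ((2 : ℝ) ^ n)⁻¹) * F 0 = 0 by linarith)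
    |>.resolve_left (by linarith)]

section

variable {c : ℝ}

/-- One constant bounds the Slezkin–Landau field, its gradient, its stress tensor and the
derivatives of the latter. -/
theorem exists_landau_bounds (hc : 1 < |c|) : ∃ C, 0 ≤ C ∧
    (∀ k x, |landauField c x k| ≤ C * ‖x‖⁻¹) ∧
    (∀ l k x, |landauGrad c l k x| ≤ C * (‖x‖ ^ 2)⁻¹) ∧
    (∀ l k x, |landauStress c l k x| ≤ C * (‖x‖ ^ 2)⁻¹) ∧
    ∀ l k x, |landauStressDeriv c l k x| ≤ C * (‖x‖ ^ 3)⁻¹ := by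
  obtain ⟨C₀, h₀⟩ := landauField_bound hc
  have h₁ : ∀ p : Fin 3 × Fin 3, ∃ C, 0 ≤ C ∧ ∀ x, |landauGrad c p.1 p.2 x| ≤ C * (‖x‖ ^ 2)⁻¹ :=
    fun p => exists_bound_of_homogeneous (continuousOn_landauGrad hc p.1 p.2)
      (fun a ha x _ => landauGrad_smul c p.1 p.2 ha x)
      (eq_zero_of_homogeneous two_ne_zero fun a ha x => landauGrad_smul c p.1 p.2 ha x)
  have h₂ : ∀ p : Fin 3 × Fin 3, ∃ C, 0 ≤ C ∧ ∀ x, |landauStress c p.1 p.2 x| ≤ C * (‖x‖ ^ 2)⁻¹ :=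
    fun p => exists_bound_of_homogeneous (continuousOn_landauStress hc p.1 p.2)
      (fun a ha x _ => landauStress_smul c p.1 p.2 ha x)
      (eq_zero_of_homogeneous two_ne_zero fun a ha x => landauStress_smul c p.1 p.2 ha x)
  have h₃ : ∀ p : Fin 3 × Fin 3,
      ∃ C, 0 ≤ C ∧ ∀ x, |landauStressDeriv c p.1 p.2 x| ≤ C * (‖x‖ ^ 3)⁻¹ :=
    fun p => exists_bound_of_homogeneous (continuousOn_landauStressDeriv hc p.1 p.2)
      (fun a ha x _ => landauStressDeriv_smul c p.1 p.2 ha x)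
      (eq_zero_of_homogeneous three_ne_zero fun a ha x => landauStressDeriv_smul c p.1 p.2 ha x)
  choose C₁ p₁ h₁ using h₁
  choose C₂ p₂ h₂ using h₂
  choose C₃ p₃ h₃ using h₃
  have s₁ := fun p => Finset.single_le_sum (f := C₁) (fun p _ => p₁ p) (Finset.mem_univ p)
  have s₂ := fun p => Finset.single_le_sum (f := C₂) (fun p _ => p₂ p) (Finset.mem_univ p)
  have s₃ := fun p => Finset.single_le_sum (f := C₃) (fun p _ => p₃ p) (Finset.mem_univ p)
  have q₁ := Finset.sum_nonneg (f := C₁) (s := Finset.univ) fun p _ => p₁ p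
  have q₂ := Finset.sum_nonneg (f := C₂) (s := Finset.univ) fun p _ => p₂ p
  have q₃ := Finset.sum_nonneg (f := C₃) (s := Finset.univ) fun p _ => p₃ p
  refine ⟨|C₀| + ∑ p, C₁ p + ∑ p, C₂ p + ∑ p, C₃ p, by positivity, fun k x => ?_, fun l k x => ?_,
    fun l k x => ?_, fun l k x => ?_⟩
  · refine (h₀ x k).trans (mul_le_mul_of_nonneg_right ?_ (by positivity))
    linarith [le_abs_self C₀]
  · refine (h₁ (l, k) x).trans (mul_le_mul_of_nonneg_right ?_ (by positivity))
    linarith [s₁ (l, k), abs_nonneg C₀]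
  · refine (h₂ (l, k) x).trans (mul_le_mul_of_nonneg_right ?_ (by positivity))
    linarith [s₂ (l, k), abs_nonneg C₀]
  · refine (h₃ (l, k) x).trans (mul_le_mul_of_nonneg_right ?_ (by positivity))
    linarith [s₃ (l, k), abs_nonneg C₀]

theorem landauStress_eq (hc : 1 < |c|) (l k : Fin 3) (x : E3) :
    landauStress c l k x = landauField c x l * landauField c x k + kron l k * landauPressure c x -
      landauGrad c l k x := by
  rw [landauField_eq_velPoly hc, landauField_eq_velPoly hc]
  rfl

theorem integral_landauField_mul_hatSchwartz (hc : 1 < |c|) (k : Fin 3) (φ : 𝓢(E3, ℂ)) :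
    ∫ x, (landauField c x k : ℂ) * hatSchwartz φ x = ∫ ξ, φ ξ * landauHat c k ξ := by
  have h1 := ((isFun_landau hc 0 k).2 (hatSchwartz φ)).2
  have h2 := ((isFun_hat_landau hc 0 k).2 φ).2
  rw [hat_apply, h1] at h2
  simpa [phase, mul_comm] using h2

theorem integral_landauGrad_mul_hatSchwartz (hc : 1 < |c|) (l k : Fin 3) (φ : 𝓢(E3, ℂ)) :
    ∫ x, (landauGrad c l k x : ℂ) * hatSchwartz (waveMul l φ) x =
      ∫ ξ, φ ξ * ((ξ l : ℂ) ^ 2 * landauHat c k ξ) := by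
  obtain ⟨C, hC, h₀, h₁, -, -⟩ := exists_landau_bounds hc
  have h : HasSingularDeriv l C (fun x => landauField c x k) (landauGrad c l k) :=
    { measurable := measurable_landauField c k
      measurable' := measurable_landauGrad c l k
      nonneg := hC
      bound := fun x => (h₀ k x).trans (mul_le_mul_of_nonneg_left
        (le_add_of_nonneg_right (by positivity)) hC)
      bound' := fun x => (h₁ l k x).trans (mul_le_mul_of_nonneg_left
        (le_add_of_nonneg_right (by positivity)) hC)
      hasLineDerivAt := fun x hx => hasLineDerivAt_landauField hc l k hx }
  have h2 := h.integral_eq (h₀ k) (h₁ l k)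
    (hasLineDerivAt_hatSchwartz l (waveMul l φ))
  rw [integral_landauField_mul_hatSchwartz hc, eq_comm, neg_eq_iff_eq_neg] at h2
  rw [h2, ← integral_neg]
  congr 1
  ext ξ
  rw [waveMul_apply, waveMul_apply]
  linear_combination (-(ξ l : ℂ) ^ 2 * φ ξ * landauHat c k ξ) * Complex.I_sq

/-- The divergence of the stress tensor is `κ(c) δ₀ e₀`. -/
theorem sum_integral_landauStress (hc : 1 < |c|) (k : Fin 3) (φ : 𝓢(E3, ℂ)) :
    ∑ l, ∫ x, (landauStress c l k x : ℂ) * hatSchwartz (waveMul l φ) x =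
      -∫ ξ, φ ξ * (landauKappa c * kron k 0 : ℝ) := by
  obtain ⟨C, hC, -, -, h₂, h₃⟩ := exists_landau_bounds hc
  rw [sum_integral_mul_lineDeriv (C := C) (S' := fun l => landauStressDeriv c l k)
    (fun l =>
      { measurable := measurable_landauStress c l k
        measurable' := measurable_landauStressDeriv c l k
        nonneg := hC
        bound := fun x => (h₂ l k x).trans (mul_le_mul_of_nonneg_left
          (le_add_of_nonneg_left (by positivity)) hC)
        bound' := fun x => (h₃ l k x).trans (mul_le_mul_of_nonneg_left
          (le_add_of_nonneg_left (by positivity)) hC)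
        hasLineDerivAt := fun x hx => hasLineDerivAt_landauStress hc l k hx })
    (fun l => h₂ l k) (fun x hx => sum_landauStressDeriv hc k hx)
    (fun l a ha x => landauStress_smul c l k ha x)
    (fun l => hasLineDerivAt_hatSchwartz l φ), originFlux_landauStress hc, integral_mul_const,
    hatSchwartz_eq_phase, mul_comm]
  simp [phase]

/-- The Fourier transform of `-∇·(V ⊗ V) + Δ V + κ δ₀ e₀`, that is, of the pressure gradient. -/
def momentumHat (c : ℝ) (k : Fin 3) (ξ : E3) : ℂ :=
  ∑ l, Complex.I * (ξ l : ℂ) * convHat (landauHat c) (landauHat c) l k ξ -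
    ((‖ξ‖ ^ 2 : ℝ) : ℂ) * landauHat c k ξ + (landauKappa c * kron k 0 : ℝ)

theorem isAdm_landauHat (hc : 1 < |c|) : IsAdm (landauHatConst c) fun _ => landauHat c where
  measurable j := (measurable_landauHat c j).comp measurable_snd
  bound _ j ξ := norm_landauHat_le hc j ξ

theorem measurable_convHat_landauHat (hc : 1 < |c|) (l k : Fin 3) :
    Measurable (convHat (landauHat c) (landauHat c) l k) :=
  ((isAdm_landauHat hc).measurable_convHat (isAdm_landauHat hc) l k).comp
    (by fun_prop : Measurable fun ξ : E3 => ((0 : ℝ), ξ))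

theorem exists_norm_coord_mul_convHat_le (hc : 1 < |c|) : ∃ A, ∀ l k, ∀ᵐ ξ : E3,
    ‖Complex.I * (ξ l : ℂ) * convHat (landauHat c) (landauHat c) l k ξ‖ ≤ A := by
  refine ⟨((2 * Real.pi) ^ 3)⁻¹ * (landauHatConst c * landauHatConst c * convConst), fun l k => ?_⟩
  filter_upwards [ae_ne_zero] with ξ hξ
  have hr : 0 < ‖ξ‖ := norm_pos_iff.2 hξ
  have hb : ∀ l, ∀ᵐ ξ : E3, ‖landauHat c l ξ‖ ≤ landauHatConst c * (‖ξ‖ ^ 2)⁻¹ := fun l =>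
    Filter.Eventually.of_forall (norm_landauHat_le hc l)
  have h := norm_convHat_le (landauHatConst_nonneg hc) (landauHatConst_nonneg hc) hb hb l k hξ
  rw [norm_mul, norm_mul, Complex.norm_I, one_mul, Complex.norm_real, Real.norm_eq_abs]
  calc _ ≤ ‖ξ‖ * (((2 * Real.pi) ^ 3)⁻¹ *
        (landauHatConst c * landauHatConst c * (convConst * ‖ξ‖⁻¹))) :=
        mul_le_mul (abs_apply_le ξ l) h (norm_nonneg _) hr.le
    _ = _ := by field_simp

theorem norm_sq_mul_landauHat_le (hc : 1 < |c|) (k : Fin 3) (ξ : E3) :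
    ‖((‖ξ‖ ^ 2 : ℝ) : ℂ) * landauHat c k ξ‖ ≤ landauHatConst c := by
  rw [norm_mul, Complex.norm_real, Real.norm_of_nonneg (by positivity)]
  rcases eq_or_ne ξ 0 with rfl | hξ
  · simpa using landauHatConst_nonneg hc
  have hr : 0 < ‖ξ‖ := norm_pos_iff.2 hξ
  calc _ ≤ ‖ξ‖ ^ 2 * (landauHatConst c * (‖ξ‖ ^ 2)⁻¹) := by
        gcongr
        exact norm_landauHat_le hc k ξ
    _ = _ := by field_simp

theorem measurable_momentumHat (hc : 1 < |c|) (k : Fin 3) : Measurable (momentumHat c k) := by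
  have h1 := measurable_convHat_landauHat hc
  have h2 := measurable_landauHat c k
  unfold momentumHat
  fun_prop

theorem exists_norm_momentumHat_le (hc : 1 < |c|) (k : Fin 3) :
    ∃ A, ∀ᵐ ξ : E3, ‖momentumHat c k ξ‖ ≤ A := by
  obtain ⟨A, hA⟩ := exists_norm_coord_mul_convHat_le hc
  refine ⟨∑ _l : Fin 3, A + landauHatConst c + ‖((landauKappa c * kron k 0 : ℝ) : ℂ)‖, ?_⟩
  filter_upwards [ae_all_iff.2 fun l => hA l k] with ξ h
  exact norm_add_le_of_le (norm_sub_le_of_le (norm_sum_le_of_le _ fun l _ => h l)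
    (norm_sq_mul_landauHat_le hc k ξ)) le_rfl

theorem integrable_schwartz_mul_of_bdd (φ : 𝓢(E3, ℂ)) {f : E3 → ℂ} (hm : Measurable f) {A : ℝ}
    (h : ∀ᵐ ξ : E3, ‖f ξ‖ ≤ A) : Integrable (fun ξ => φ ξ * f ξ) volume :=
  φ.integrable.mul_bdd hm.aestronglyMeasurable h

theorem integrable_landauPressure_mul (hc : 1 < |c|) (φ : 𝓢(E3, ℂ)) :
    Integrable (fun x => (landauPressure c x : ℂ) * φ x) volume := by
  obtain ⟨C, hC, h₀, h₁, h₂, -⟩ := exists_landau_bounds hc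
  refine integrable_of_le_singular φ (A := 0) (B := C + C + C * C) ?_ fun x => ?_
  · have := measurable_landauRecip c
    unfold landauPressure pressurePoly axial
    fun_prop
  · have e : landauPressure c x = landauStress c 0 0 x + landauGrad c 0 0 x -
        landauField c x 0 * landauField c x 0 := by
      rw [landauStress_eq hc, kron_self]
      ring
    rw [e, zero_mul, zero_add, add_mul, add_mul]
    refine (abs_sub _ _).trans (add_le_add ((abs_add_le _ _).trans (add_le_add (h₂ 0 0 x)
      (h₁ 0 0 x))) ?_)
    rw [abs_mul]
    calc _ ≤ (C * ‖x‖⁻¹) * (C * ‖x‖⁻¹) :=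
          mul_le_mul (h₀ 0 x) (h₀ 0 x) (abs_nonneg _) (by positivity)
      _ = _ := by rw [← inv_pow]; ring

end

section

variable {c : ℝ}

theorem integral_landauStress_mul_hatSchwartz (hc : 1 < |c|) (l k : Fin 3) (φ : 𝓢(E3, ℂ)) :
    ∫ x, (landauStress c l k x : ℂ) * hatSchwartz (waveMul l φ) x =
      (∫ ξ, φ ξ * (Complex.I * (ξ l : ℂ) * convHat (landauHat c) (landauHat c) l k ξ)) +
      kron l k * (∫ x, (landauPressure c x : ℂ) * hatSchwartz (waveMul l φ) x) -
      ∫ ξ, φ ξ * ((ξ l : ℂ) ^ 2 * landauHat c k ξ) := by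
  obtain ⟨C, hC, h₀, h₁, -, -⟩ := exists_landau_bounds hc
  set ψ := hatSchwartz (waveMul l φ) with hψ
  have i1 : Integrable (fun x => ((landauField c x l * landauField c x k : ℝ) : ℂ) * ψ x)
      volume := by
    refine integrable_of_le_singular ψ (A := 0) (B := C * C)
      ((measurable_landauField c l).mul (measurable_landauField c k)) fun x => ?_
    rw [abs_mul, zero_mul, zero_add]
    calc _ ≤ (C * ‖x‖⁻¹) * (C * ‖x‖⁻¹) :=
          mul_le_mul (h₀ l x) (h₀ k x) (abs_nonneg _) (by positivity)
      _ = _ := by rw [← inv_pow]; ring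
  have i2 : Integrable (fun x => (kron l k : ℂ) * ((landauPressure c x : ℂ) * ψ x)) volume :=
    (integrable_landauPressure_mul hc ψ).const_mul _
  have i3 : Integrable (fun x => (landauGrad c l k x : ℂ) * ψ x) volume :=
    integrable_of_le_singular ψ (A := 0) (B := C) (measurable_landauGrad c l k) fun x => by
      simpa using h₁ l k x
  have e : ∀ x, (landauStress c l k x : ℂ) * ψ x =
      ((landauField c x l * landauField c x k : ℝ) : ℂ) * ψ x +
        (kron l k : ℂ) * ((landauPressure c x : ℂ) * ψ x) - (landauGrad c l k x : ℂ) * ψ x := by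
    intro x
    rw [landauStress_eq hc]
    push_cast
    ring
  rw [integral_congr_ae (Filter.Eventually.of_forall e)]
  refine (integral_sub (i1.add i2) i3).trans ?_
  rw [integral_landauGrad_mul_hatSchwartz hc]
  congr 1
  refine (integral_add i1 i2).trans ?_
  rw [integral_const_mul]
  congr 1
  have h := integral_hatSchwartz_mul_landauField_mul_landauField hc l k (waveMul l φ)
  simp only [mul_comm (((landauField c _ l * landauField c _ k : ℝ)) : ℂ)]
  rw [h]
  congr 1
  ext ξ
  rw [waveMul_apply]
  ring

/-- The momentum equation in Fourier variables: `-∇·(V ⊗ V) + Δ V + κ δ₀ e₀ = ∇p`. -/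
theorem integral_schwartz_mul_momentumHat (hc : 1 < |c|) (k : Fin 3) (φ : 𝓢(E3, ℂ)) :
    ∫ ξ, φ ξ * momentumHat c k ξ =
      -∫ x, (landauPressure c x : ℂ) * hatSchwartz (waveMul k φ) x := by
  obtain ⟨A, hA⟩ := exists_norm_coord_mul_convHat_le hc
  have h := sum_integral_landauStress hc k φ
  simp only [integral_landauStress_mul_hatSchwartz hc] at h
  have i1 : ∀ l, Integrable (fun ξ => φ ξ *
      (Complex.I * (ξ l : ℂ) * convHat (landauHat c) (landauHat c) l k ξ)) volume := fun l => by
    have := measurable_convHat_landauHat hc l k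
    exact integrable_schwartz_mul_of_bdd φ (by fun_prop) (hA l k)
  have i2 : ∀ l, Integrable (fun ξ => φ ξ * ((ξ l : ℂ) ^ 2 * landauHat c k ξ)) volume := fun l => by
    have := measurable_landauHat c k
    refine integrable_schwartz_mul_of_bdd φ (by fun_prop) (A := landauHatConst c)
      (Filter.Eventually.of_forall fun ξ => le_trans ?_ (norm_sq_mul_landauHat_le hc k ξ))
    rw [norm_mul, norm_mul, norm_pow, Complex.norm_real, Complex.norm_real, Real.norm_eq_abs,
      Real.norm_of_nonneg (by positivity)]
    gcongr
    exact abs_apply_le ξ l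
  have i3 : Integrable (fun ξ => φ ξ * ((landauKappa c * kron k 0 : ℝ) : ℂ)) volume :=
    φ.integrable.mul_const _
  rw [Finset.sum_sub_distrib, Finset.sum_add_distrib, ← integral_finsetSum _ fun l _ => i1 l,
    ← integral_finsetSum _ fun l _ => i2 l] at h
  have hk : ∑ l, (kron l k : ℂ) * ∫ x, (landauPressure c x : ℂ) * hatSchwartz (waveMul l φ) x =
      ∫ x, (landauPressure c x : ℂ) * hatSchwartz (waveMul k φ) x := by
    simp only [kron, apply_ite Complex.ofReal, Complex.ofReal_one, Complex.ofReal_zero, ite_mul,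
      one_mul, zero_mul, Finset.sum_ite_eq', Finset.mem_univ, if_true]
  rw [hk] at h
  have e : ∀ ξ, φ ξ * momentumHat c k ξ = (∑ l, φ ξ *
      (Complex.I * (ξ l : ℂ) * convHat (landauHat c) (landauHat c) l k ξ)) -
      (∑ l, φ ξ * ((ξ l : ℂ) ^ 2 * landauHat c k ξ)) +
      φ ξ * ((landauKappa c * kron k 0 : ℝ) : ℂ) := fun ξ => by
    rw [momentumHat, ← sum_ofReal_sq, Finset.sum_mul, ← Finset.mul_sum, ← Finset.mul_sum]
    ring
  have s1 := integrable_finsetSum Finset.univ fun l _ => i1 l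
  have s2 := integrable_finsetSum Finset.univ fun l _ => i2 l
  have h4 := integral_add (s1.sub s2) i3
  have h5 := integral_sub s1 s2
  rw [integral_congr_ae (Filter.Eventually.of_forall e)]
  refine h4.trans ?_
  refine (congrArg (· + _) h5).trans ?_
  linear_combination h

/-- Multiplication of a test function by the symbol `δ_{jk} |ξ|² - ξ_j ξ_k`. -/
def solenoidalMul (j k : Fin 3) (φ : 𝓢(E3, ℂ)) : 𝓢(E3, ℂ) :=
  waveMul j (waveMul k φ) - (kron j k : ℂ) • ∑ i, waveMul i (waveMul i φ)

theorem solenoidalMul_apply (j k : Fin 3) (φ : 𝓢(E3, ℂ)) (ξ : E3) :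
    solenoidalMul j k φ ξ = ((kron j k * ‖ξ‖ ^ 2 - ξ j * ξ k : ℝ) : ℂ) * φ ξ := by
  have h := sum_ofReal_sq ξ
  rw [Fin.sum_univ_three] at h
  rw [solenoidalMul, Fin.sum_univ_three]
  simp only [_root_.sub_apply, _root_.smul_apply, _root_.add_apply, waveMul_apply,
    smul_eq_mul]
  push_cast at h ⊢
  linear_combination (kron j k * φ ξ) * h + (ξ j * ξ k * φ ξ - kron j k * φ ξ *
    ((ξ 0 : ℂ) ^ 2 + (ξ 1 : ℂ) ^ 2 + (ξ 2 : ℂ) ^ 2)) * Complex.I_sq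

/-- The test fields are solenoidal, so that the pressure does not see them. -/
theorem sum_waveMul_solenoidalMul (j : Fin 3) (φ : 𝓢(E3, ℂ)) :
    ∑ k, waveMul k (solenoidalMul j k φ) = 0 := by
  ext ξ
  have h := sum_ofReal_sq ξ
  rw [Fin.sum_univ_three] at h ⊢
  simp only [_root_.add_apply, waveMul_apply, solenoidalMul_apply, _root_.zero_apply]
  push_cast at h ⊢
  rw [← h]
  fin_cases j <;> simp [kron] <;> ring

/-- The Leray projector annihilates the momentum balance, which is the pressure gradient. -/
theorem sum_symbol_mul_momentumHat (hc : 1 < |c|) (j : Fin 3) :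
    ∀ᵐ ξ : E3, ∑ k, ((kron j k * ‖ξ‖ ^ 2 - ξ j * ξ k : ℝ) : ℂ) * momentumHat c k ξ = 0 := by
  have hm := measurable_momentumHat hc
  choose A hA using exists_norm_momentumHat_le hc
  have hs : ∀ (φ : 𝓢(E3, ℂ)) ξ, φ ξ * ∑ k, ((kron j k * ‖ξ‖ ^ 2 - ξ j * ξ k : ℝ) : ℂ) *
      momentumHat c k ξ = ∑ k, solenoidalMul j k φ ξ * momentumHat c k ξ := fun φ ξ => by
    rw [Finset.mul_sum]
    refine Finset.sum_congr rfl fun k _ => ?_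
    rw [solenoidalMul_apply]
    ring
  have hi : ∀ (φ : 𝓢(E3, ℂ)) k, Integrable (fun ξ => solenoidalMul j k φ ξ * momentumHat c k ξ)
      volume := fun φ k => integrable_schwartz_mul_of_bdd _ (hm k) (hA k)
  have hl : LocallyIntegrable (fun ξ : E3 => ∑ k, ((kron j k * ‖ξ‖ ^ 2 - ξ j * ξ k : ℝ) : ℂ) *
      momentumHat c k ξ) volume := by
    refine locallyIntegrable_finsetSum _ fun k _ => ?_
    have h1 : LocallyIntegrable (momentumHat c k) volume :=
      (memLp_top_of_bound (hm k).aestronglyMeasurable _ (hA k)).locallyIntegrable le_top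
    rw [← locallyIntegrableOn_univ] at h1 ⊢
    exact h1.continuousOn_mul (by fun_prop) isOpen_univ.isLocallyClosed
  refine IsFun.ae_eq (T := 0) (f := fun ξ : E3 => ∑ k, ((kron j k * ‖ξ‖ ^ 2 - ξ j * ξ k : ℝ) : ℂ) *
      momentumHat c k ξ) (g := 0) ⟨hl, fun φ => ?_⟩ ⟨locallyIntegrable_zero, fun φ => by simp⟩
  simp_rw [hs]
  refine ⟨integrable_finsetSum _ fun k _ => hi φ k, ?_⟩
  rw [integral_finsetSum _ fun k _ => hi φ k]
  simp_rw [integral_schwartz_mul_momentumHat hc]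
  have hp := fun k =>
    integrable_landauPressure_mul hc (hatSchwartz (waveMul k (solenoidalMul j k φ)))
  rw [Finset.sum_neg_distrib, ← integral_finsetSum _ fun k _ => hp k]
  have h0 : ∀ x, ∑ k, (landauPressure c x : ℂ) *
      hatSchwartz (waveMul k (solenoidalMul j k φ)) x = 0 := fun x => by
    have h : hatSchwartz (∑ k, waveMul k (solenoidalMul j k φ)) x = 0 := by
      rw [sum_waveMul_solenoidalMul, map_zero, _root_.zero_apply]
    rw [← Finset.mul_sum, ← _root_.sum_apply, ← map_sum, h, mul_zero]
  simp_rw [h0]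
  simp

/-- The Slezkin–Landau field is divergence free. -/
theorem sum_coord_mul_landauHat (ξ : E3) : ∑ k, (ξ k : ℂ) * landauHat c k ξ = 0 := by
  have h : ∀ k, landauHat c k ξ = lerayNum ξ k * ∫ s in Set.Ioi (0 : ℝ),
      64 * Real.pi * s * c / expDenom (s * |c|) (signR c * s) ξ ^ 3 := fun k => by
    rw [landauHat, ← integral_const_mul]
    congr 1
    ext s
    rw [landauModeHat]
    ring
  have hs := sum_ofReal_sq ξ
  rw [Fin.sum_univ_three] at hs ⊢
  simp only [h, lerayNum]
  push_cast at hs ⊢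
  rw [← hs]
  ring

/-- The Fourier transform of the Slezkin–Landau field solves the stationary Navier–Stokes system
with the force `κ(c) δ₀ e₀`. -/
theorem norm_sq_mul_landauHat (hc : 1 < |c|) (j : Fin 3) :
    ∀ᵐ ξ : E3, ((‖ξ‖ ^ 2 : ℝ) : ℂ) * landauHat c j ξ =
      quadHat (landauHat c) (landauHat c) j ξ + landauKappa c * (leray ξ j 0 : ℂ) := by
  filter_upwards [sum_symbol_mul_momentumHat hc j, ae_ne_zero] with ξ h hξ
  have hr : ‖ξ‖ ≠ 0 := norm_ne_zero_iff.2 hξ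
  have hr2 : ((‖ξ‖ ^ 2 : ℝ) : ℂ) ≠ 0 := by exact_mod_cast pow_ne_zero 2 hr
  have e : ∀ k, kron j k * ‖ξ‖ ^ 2 - ξ j * ξ k = ‖ξ‖ ^ 2 * leray ξ j k := fun k => by
    rw [leray, kron]
    field_simp
  have h1 : ∑ k, (leray ξ j k : ℂ) * momentumHat c k ξ = 0 := by
    simp_rw [e, Complex.ofReal_mul, mul_assoc, ← Finset.mul_sum] at h
    exact (mul_eq_zero.1 h).resolve_left hr2
  have h2 : ∑ k, (leray ξ j k : ℂ) * landauHat c k ξ = landauHat c j ξ := by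
    have : ∀ k, (leray ξ j k : ℂ) * landauHat c k ξ = (if j = k then landauHat c k ξ else 0) -
        ξ j / ((‖ξ‖ ^ 2 : ℝ) : ℂ) * (ξ k * landauHat c k ξ) := fun k => by
      rw [leray]
      split_ifs <;> push_cast <;> ring
    simp_rw [this, Finset.sum_sub_distrib, ← Finset.mul_sum, sum_coord_mul_landauHat]
    simp
  have h3 : ∑ k, (leray ξ j k : ℂ) * (kron k 0 : ℂ) = leray ξ j 0 := by
    simp only [kron, apply_ite Complex.ofReal, Complex.ofReal_one, Complex.ofReal_zero, mul_ite,
      mul_one, mul_zero, Finset.sum_ite_eq', Finset.mem_univ, if_true]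
  have h4 : ∑ k, (leray ξ j k : ℂ) * momentumHat c k ξ = quadHat (landauHat c) (landauHat c) j ξ -
      ((‖ξ‖ ^ 2 : ℝ) : ℂ) * landauHat c j ξ + landauKappa c * (leray ξ j 0 : ℂ) := by
    rw [← h3, ← h2, quadHat, Finset.mul_sum, Finset.mul_sum, ← Finset.sum_sub_distrib,
      ← Finset.sum_add_distrib]
    refine Finset.sum_congr rfl fun k _ => ?_
    rw [momentumHat]
    push_cast
    ring
  linear_combination h4 - h1

theorem isLandauTransform (hc : 1 < |c|) :
    IsLandauTransform c (landauKappa c) (landauHatConst c) (landauHat c) where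
  measurable := measurable_landauHat c
  bound := norm_landauHat_le hc
  isFun := isFun_hat_landau hc
  stationary := norm_sq_mul_landauHat hc

end

/-! ### Smallness of the force and of the Slezkin–Landau field -/

theorem isFun_hat_zero : IsFun (hat 0) 0 := by
  refine ⟨locallyIntegrable_zero, fun φ => ?_⟩
  simp [hat_apply]

theorem vecNorm_zero : vecNorm 2 0 = 0 := by
  refine le_antisymm (vecNorm_le_iff.2 fun j => ?_) bot_le
  rw [Pi.zero_apply, pmNorm_eq isFun_hat_zero, ← ENNReal.ofReal_zero]
  exact (weightedSup_le_iff le_rfl).2 (by simp)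

theorem memCw_zero : MemCw fun _ => 0 :=
  ⟨by simp [vecNorm_zero], fun j φ => by simpa using continuousOn_const⟩

theorem MemCw.add {u v : ℝ → VecDist} (hu : MemCw u) (hv : MemCw v) : MemCw fun t => u t + v t := by
  simpa using hu.sub (memCw_zero.sub hv)

theorem vecNorm_add_le (v w : VecDist) : vecNorm 2 (v + w) ≤ vecNorm 2 v + vecNorm 2 w := by
  have h1 := vecNorm_sub_le v (0 - w)
  have h2 := vecNorm_sub_le 0 w
  rw [vecNorm_zero, zero_add] at h2
  rw [zero_sub, sub_neg_eq_add] at h1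
  rw [zero_sub] at h2
  exact h1.trans (add_le_add le_rfl h2)

theorem supNorm_le_iff {u : ℝ → VecDist} {M : ℝ≥0∞} :
    supNorm u ≤ M ↔ ∀ t > 0, vecNorm 2 (u t) ≤ M := iSup₂_le_iff

/-- The norm is at most `32 π |c| / (c² - 1)`, and `c² - 1 ≥ 3 c² / 4` for `|c| ≥ 2`. -/
theorem exists_isLandauConstant : ∃ K, IsLandauConstant K := by
  refine ⟨128 * Real.pi / 3, by positivity, fun c hc => ?_⟩
  have hc1 : 1 < |c| := by linarith
  refine ((isLandauTransform hc1).vecNorm_le (landauHatConst_nonneg hc1)).trans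
    (ENNReal.ofReal_le_ofReal ?_)
  have h1 := sq_sub_one_pos hc1
  have h2 := sq_abs c
  have h0 : 0 < |c| := by linarith
  unfold landauHatConst
  rw [div_div, div_le_div_iff₀ h1 (by positivity)]
  have : 3 * |c| ^ 2 ≤ 4 * (c ^ 2 - 1) := by nlinarith
  nlinarith [Real.pi_pos]

/-- For large `|c|` the force and the Slezkin–Landau field are small in terms of the constants. -/
theorem exists_threshold {η K : ℝ} (hη : 0 < η) (hK : IsLandauConstant K) :
    ∃ c₀ : ℝ, 1 < c₀ ∧ 12 * K * η < c₀ ∧ ∀ c : ℝ, c₀ ≤ |c| → 1 < |c| ∧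
      16 * quadConst * |landauKappa c| ≤ 1 ∧ 16 * η * |landauKappa c| ≤ 1 ∧
      vecNorm 2 (landau c 0) < ⊤ ∧ 12 * η * (vecNorm 2 (landau c 0)).toReal ≤ 1 := by
  have hq := quadConst_nonneg
  have hK0 := hK.1
  have hπ := Real.pi_pos
  refine ⟨3 + 12 * K * η + 16 * (η + quadConst) * (600 * Real.pi ^ 2), ?_, ?_, fun c hc => ?_⟩
  · have : 0 ≤ 12 * K * η + 16 * (η + quadConst) * (600 * Real.pi ^ 2) := by positivity
    linarith
  · have : 0 ≤ 16 * (η + quadConst) * (600 * Real.pi ^ 2) := by positivity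
    linarith
  have h1 : 0 ≤ 12 * K * η := by positivity
  have h2 : 0 ≤ 16 * (η + quadConst) * (600 * Real.pi ^ 2) := by positivity
  have hc2 : 2 < |c| := by linarith
  have hc0 : 0 < |c| := by linarith
  have hκ : 16 * (η + quadConst) * |landauKappa c| ≤ 1 := by
    calc _ ≤ 16 * (η + quadConst) * (600 * Real.pi ^ 2 / |c|) := by
          gcongr
          exact abs_landauKappa_le hc2.le
      _ ≤ 1 := by
          rw [← mul_div_assoc, div_le_one hc0]
          linarith
  have hV := hK.2 c hc2
  refine ⟨by linarith, ?_, ?_, hV.trans_lt ENNReal.ofReal_lt_top, ?_⟩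
  · nlinarith [mul_nonneg hη.le (abs_nonneg (landauKappa c))]
  · nlinarith [mul_nonneg hq (abs_nonneg (landauKappa c))]
  · calc _ ≤ 12 * η * (K / |c|) := by
          gcongr
          exact ENNReal.toReal_le_of_le_ofReal (by positivity) hV
      _ ≤ 1 := by
          rw [← mul_div_assoc, div_le_one hc0]
          linarith

end SingularNS

end

theorem theorem5p3 :
    (∃ η₂ : ℝ, IsBilinearConstant η₂) ∧ (∃ K : ℝ, IsLandauConstant K) ∧
    ∀ η₂ K : ℝ, IsBilinearConstant η₂ → IsLandauConstant K →
      ∃ c₀ : ℝ, 1 < c₀ ∧ 12 * K * η₂ < c₀ ∧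
        ∀ c : ℝ, c₀ ≤ |c| → ∀ γ : ℝ → E3, ContinuousOn γ (Set.Ici 0) →
          0 < 1 - 2 * η₂ * (vecNorm 2 (landau c 0)).toReal ∧
          |landauKappa c| < 1 / (8 * η₂) ∧
          ∃ ω u : ℝ → VecDist,
            -- the perturbation equation has a solution in the ball
            (MemCw ω ∧ IsPerturbationSolution c γ ω ∧
              supNorm ω ≤
                ENNReal.ofReal ((1 - 2 * η₂ * (vecNorm 2 (landau c 0)).toReal) / (2 * η₂))) ∧
            -- and no other solution in the ball
            (∀ ω' : ℝ → VecDist, MemCw ω' → IsPerturbationSolution c γ ω' →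
              supNorm ω' ≤
                ENNReal.ofReal ((1 - 2 * η₂ * (vecNorm 2 (landau c 0)).toReal) / (2 * η₂)) →
              ∀ t ≥ 0, ω' t = ω t) ∧
            -- `u` is the unique small solution of the singularly forced problem
            (MemCw u ∧ IsForcedSolution (landauKappa c) γ u ∧
              supNorm u ≤ ENNReal.ofReal (4 * |landauKappa c|)) ∧
            (∀ u' : ℝ → VecDist, MemCw u' → IsForcedSolution (landauKappa c) γ u' →
              supNorm u' ≤ ENNReal.ofReal (4 * |landauKappa c|) → ∀ t ≥ 0, u' t = u t) ∧
            -- and the two are related by `ω = u - V^c_γ`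
            ∀ t ≥ 0, ω t = u t - landau c (γ t) := by
  refine ⟨exists_isBilinearConstant, exists_isLandauConstant, fun η K hη hK => ?_⟩
  have hη0 := hη.1
  obtain ⟨c₀, h1, h2, hc₀⟩ := exists_threshold hη0 hK
  refine ⟨c₀, h1, h2, fun c hc γ hγ => ?_⟩
  obtain ⟨hc1, hqκ, hκ, hfin, hV⟩ := hc₀ c hc
  have hG := isLandauTransform hc1
  set v := (vecNorm 2 (landau c 0)).toReal with hv
  set κ := landauKappa c with hκdef
  have hv0 : 0 ≤ v := ENNReal.toReal_nonneg
  -- multiplied by `2 η`, this is `8 η |κ| + 4 η v ≤ 1 / 2 + 1 / 3`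
  have hball : 4 * |κ| + v ≤ (1 - 2 * η * v) / (2 * η) := by
    rw [le_div_iff₀ (by positivity)]
    linarith
  have hVnorm : ∀ t, vecNorm 2 (landau c (γ t)) = ENNReal.ofReal v := fun t => by
    rw [hG.vecNorm_eq, hv, ENNReal.ofReal_toReal hfin.ne]
  have hVCw := hG.memCw hγ
  obtain ⟨u, hu, hus, hun⟩ := exists_forcedSolution hqκ hγ
  refine ⟨by linarith, ?_, fun t => u t - landau c (γ t), u, ⟨hu.sub hVCw,
    (hG.isPerturbationSolution_iff hγ hu).2 hus, ?_⟩, fun ω' hω' hs' hn' t ht => ?_,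
    ⟨hu, hus, hun⟩, fun u' hu' hs' hn' t ht => ?_, fun t _ => rfl⟩
  · rw [lt_div_iff₀ (by positivity)]
    linarith
  · refine supNorm_le_iff.2 fun t ht => (vecNorm_sub_le _ _).trans ?_
    refine le_trans ?_ (ENNReal.ofReal_le_ofReal hball)
    rw [ENNReal.ofReal_add (by positivity) hv0, hVnorm]
    exact add_le_add ((vecNorm_le_supNorm u ht).trans hun) le_rfl
  · -- `ω' + V_γ` and `u` both solve the forced problem, and `η (‖u‖ + ‖ω'‖ + ‖V‖) < 1`
    have hu' := hω'.add hVCw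
    have hsub : (fun t => (ω' t + landau c (γ t)) - landau c (γ t)) = ω' := by
      ext1 t
      exact add_sub_cancel_right _ _
    have hus' : IsForcedSolution κ γ fun t => ω' t + landau c (γ t) := by
      rw [← hG.isPerturbationSolution_iff hγ hu', hsub]
      exact hs'
    have hun' : supNorm (fun t => ω' t + landau c (γ t)) ≤
        ENNReal.ofReal ((1 - 2 * η * v) / (2 * η) + v) := by
      refine supNorm_le_iff.2 fun t ht => (vecNorm_add_le _ _).trans ?_
      rw [ENNReal.ofReal_add (by linarith [abs_nonneg κ]) hv0, hVnorm]
      exact add_le_add ((vecNorm_le_supNorm ω' ht).trans hn') le_rfl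
    have h := forcedSolution_unique hη hu' hu hus' hus (by
      refine (mul_le_mul_right (add_le_add hun' hun) _).trans_lt ?_
      rw [← ENNReal.ofReal_add (by linarith [abs_nonneg κ]) (by positivity),
        ← ENNReal.ofReal_mul hη0.le, ENNReal.ofReal_lt_one]
      field_simp
      linarith) t ht
    exact eq_sub_of_add_eq h
  · refine forcedSolution_unique hη hu' hu hs' hus ?_ t ht
    refine (mul_le_mul_right (add_le_add hn' hun) _).trans_lt ?_
    rw [← ENNReal.ofReal_add (by positivity) (by positivity), ← ENNReal.ofReal_mul hη0.le,
      ENNReal.ofReal_lt_one]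
    linarith
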